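/- For a number field $K$, let $\mathrm{od}(K)$ be the smallest odd integer $k\ge 3$ for which there are units $\varepsilon_1,\dots,\varepsilon_k$ of the ring of integers of $K$ (not necessarily distinct) with $\varepsilon_1+\dots+\varepsilon_k=0$, and let $\mathrm{ev}(K)$ be the smallest even integer $k\ge 4$ for which there are such units with $\varepsilon_1+\dots+\varepsilon_k=0$ and such that this sum has no proper (nonempty) vanishing subsum; each is $\infty$ if no such $k$ exists. Put $\ell(K)=\min(\mathrm{od}(K),\mathrm{ev}(K))$. Let $\mathcal F$ be the class of number fields $K$ such that $K$ is a quadratic field, or a complex (that is, not totally real) cubic field, or a totally complex quartic field which has no real quadratic subfield and contains no primitive third root of unity. Theorem. For every integer $k\ge 3$ there are only finitely many fields $K\in\mathcal F$ with $\ell(K)\le k$ (as subfields of $\mathbb C$, and hence also up to isomorphism). Moreover, all such fields can be effectively determined: there is an algorithm (a computable function) which for each integer $k\ge 3$ outputs a finite list of monic polynomials $f\in\mathbb Z[x]$, irreducible over $\mathbb Q$, such that a number field $K$ satisfies $K\in\mathcal F$ and $\ell(K)\le k$ if and only if $K$ is isomorphic to $\mathbb Q[x]/(f)$ for some $f$ in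 the list. -/

import Mathlib

open scoped NumberField Polynomial IntermediateField

noncomputable section

namespace UnitSum

/-- `k` units of the ring of integers of `K` (with repetitions allowed) have sum zero. -/
def HasUnitSum (K : Type*) [Field K] (k : ℕ) : Prop :=
  ∃ ε : Fin k → (𝓞 K)ˣ, ∑ i, (ε i : 𝓞 K) = 0

/-- `k` units of the ring of integers of `K` have sum zero, and this sum has no proper
(nonempty) vanishing subsum. -/
def HasNondegenerateUnitSum (K : Type*) [Field K] (k : ℕ) : Prop :=
  ∃ ε : Fin k → (𝓞 K)ˣ, ∑ i, (ε i : 𝓞 K) = 0 ∧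
    ∀ s : Finset (Fin k), s.Nonempty → s ≠ Finset.univ → ∑ i ∈ s, (ε i : 𝓞 K) ≠ 0

/-- The smallest odd `k ≥ 3` such that some `k` units of `K` have sum zero
(`⊤` if there is none). -/
def od (K : Type*) [Field K] : ℕ∞ :=
  sInf {m : ℕ∞ | ∃ k : ℕ, m = k ∧ 3 ≤ k ∧ Odd k ∧ HasUnitSum K k}

/-- The smallest even `k ≥ 4` such that some `k` units of `K` have sum zero without a proper
vanishing subsum (`⊤` if there is none). -/
def ev (K : Type*) [Field K] : ℕ∞ :=
  sInf {m : ℕ∞ | ∃ k : ℕ, m = k ∧ 4 ≤ k ∧ Even k ∧ HasNondegenerateUnitSum K k}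

/-- `ℓ(K)`, the minimum of `od K` and `ev K`. -/
def ell (K : Type*) [Field K] : ℕ∞ := min (od K) (ev K)

/-- `K` is a quadratic field. -/
def IsQuadraticField (K : Type*) [Field K] [CharZero K] : Prop :=
  Module.finrank ℚ K = 2

/-- `K` is a complex cubic field, that is, a cubic field which is not totally real. -/
def IsComplexCubicField (K : Type*) [Field K] [CharZero K] : Prop :=
  Module.finrank ℚ K = 3 ∧ ∃ w : NumberField.InfinitePlace K, w.IsComplex

/-- `K` is a totally complex quartic field. -/
def IsTotallyComplexQuarticField (K : Type*) [Field K] [CharZero K] : Prop :=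
  Module.finrank ℚ K = 4 ∧ NumberField.IsTotallyComplex K

/-- `K` has a subfield which is a real quadratic field. -/
def HasRealQuadraticSubfield (K : Type*) [Field K] [CharZero K] : Prop :=
  ∃ L : IntermediateField ℚ K, IsQuadraticField L ∧ NumberField.IsTotallyReal L

/-- `K` is a quadratic field, a complex cubic field, or a totally complex quartic field without
real quadratic subfield and without primitive third root of unity. -/
def InFamily (K : Type*) [Field K] [CharZero K] : Prop :=
  IsQuadraticField K ∨ IsComplexCubicField K ∨
    (IsTotallyComplexQuarticField K ∧ ¬ HasRealQuadraticSubfield K ∧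
      ¬ ∃ ζ : K, IsPrimitiveRoot ζ 3)

/-- The polynomial `a₀ + a₁ X + a₂ X² + ⋯` with integer coefficients `[a₀, a₁, a₂, …]`,
regarded as a polynomial over `ℚ`. -/
def polyOfCoeffs : List ℤ → ℚ[X]
  | [] => 0
  | a :: l => Polynomial.C (a : ℚ) + Polynomial.X * polyOfCoeffs l

/-- `K = ℚ(α)` for an element `α` with minimal polynomial `f` over `ℚ`; equivalently (for monic
irreducible `f`), `K` is isomorphic to `ℚ[X]/(f)`. -/
def IsDefinedBy (K : Type*) [Field K] [CharZero K] (f : ℚ[X]) : Prop :=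
  ∃ α : K, ℚ⟮α⟯ = ⊤ ∧ minpoly ℚ α = f

end UnitSum

end

/-!
The proof rests on the fact that the unit groups of the fields of the family have rank at most `1`.
Let `K` be a field of the family without primitive third root of unity.
Then all roots of unity of `K` have order dividing `4`, so the units are the `ζ ηⁿ` with `ζ⁴ = 1`
for one unit `η`. Collecting equal powers of `η` turns a nondegenerate vanishing sum of
`3 ≤ m ≤ k` units into a nontrivial relation `Σ (aₙ + bₙ j) ηⁿ = 0` with
`Σ (|aₙ| + |bₙ|) ≤ k`, where `j² = -1`, or all `bₙ` vanish
(`HasNondegenerateUnitSum.exists_isRelation`). In particular `η` has infinite order, because fourth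
roots of unity have no such sum, and it generates `K`. Cauchy's root bound gives `|φ η| < k + 1` for
all embeddings `φ` (`IsRelation.norm_lt`), hence a bound for the coefficients of the minimal
polynomial of `η`. This already proves finiteness.

For the algorithm one has to decide which of the finitely many candidate polynomials occur.

* Whether a root `η` has a short relation is a finite search: the partial sums of a relation in a
  Horner scheme are algebraic integers all of whose conjugates are at most `k` in absolute value, of
  which there are boundedly many, and when two of them agree the digits in between can be deleted
  (`IsRelation.exists_length_le`). The number `j` is eliminated by asking for
  `A(η)² + B(η)² = 0` with integer polynomials `A` and `B`; conversely such an equation gives a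
  vanishing sum of units in which no two terms cancel (`ell_le_of_sq_add_sq`).
* The signature of the field is read off from discriminants and the signs of further expressions in
  the coefficients (`definiteTest_iff`, `exists_nonreal_root_iff`).
* A quartic `X⁴ + a X³ + b X² + c X + 1` factors into quadratics over `ℚ(√D)` only if its resolvent
  cubic has an integer root `s` such that `a² - 4 b + 4 s` and `s² - 4` are rational squares times
  `D`; this detects real quadratic subfields and third roots of unity
  (`hasForbiddenFactorization_of_quartic`, `HasForbiddenFactorization.exists_subfield`), and also
  reducible quartics (`irreducible_quarticPoly`).

A field of the family that contains a primitive third root of unity is `ℚ(ζ₃)`, with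
`1 + ζ₃ + ζ₃² = 0`; its polynomial is put on the list for every `k`. All ingredients of the search
are primitive recursive (`computable_fieldList`), and `inFamily_and_ell_le_iff` says that the list
is correct.
-/

namespace UnitSum

/-! ### Primitive recursive integer arithmetic -/

section IntegerArithmetic

theorem encode_int_natCast (n : ℕ) : Encodable.encode (n : ℤ) = 2 * n := rfl

theorem encode_int_negSucc (n : ℕ) : Encodable.encode (Int.negSucc n) = 2 * n + 1 := rfl

theorem primrec_int_natCast : Primrec (fun n : ℕ => (n : ℤ)) :=
  Primrec.encode_iff.1 (Primrec.nat_double.of_eq fun n => (encode_int_natCast n).symm)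

theorem primrec_int_negSucc : Primrec Int.negSucc :=
  Primrec.encode_iff.1 (Primrec.nat_double_succ.of_eq fun n => (encode_int_negSucc n).symm)

theorem primrec_int_toNat : Primrec Int.toNat := by
  have h : Primrec fun z : ℤ =>
      if Encodable.encode z % 2 = 0 then Encodable.encode z / 2 else 0 :=
    Primrec.ite
      (Primrec.eq.comp (Primrec.nat_mod.comp Primrec.encode (Primrec.const 2)) (Primrec.const 0))
      (Primrec.nat_div.comp Primrec.encode (Primrec.const 2)) (Primrec.const 0)
  refine h.of_eq fun z => ?_
  cases z with
  | ofNat n =>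
    have : Encodable.encode (Int.ofNat n) = 2 * n := encode_int_natCast n
    rw [this, if_pos (by omega)]
    simp
  | negSucc n =>
    rw [encode_int_negSucc, if_neg (by omega)]
    simp

theorem primrec_int_neg_toNat : Primrec fun z : ℤ => (-z).toNat := by
  have h : Primrec fun z : ℤ =>
      if Encodable.encode z % 2 = 0 then 0 else Encodable.encode z / 2 + 1 :=
    Primrec.ite
      (Primrec.eq.comp (Primrec.nat_mod.comp Primrec.encode (Primrec.const 2)) (Primrec.const 0))
      (Primrec.const 0)
      (Primrec.succ.comp (Primrec.nat_div.comp Primrec.encode (Primrec.const 2)))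
  refine h.of_eq fun z => ?_
  cases z with
  | ofNat n =>
    have : Encodable.encode (Int.ofNat n) = 2 * n := encode_int_natCast n
    rw [this, if_pos (by omega)]
    simp
  | negSucc n =>
    rw [encode_int_negSucc, if_neg (by omega)]
    have : -Int.negSucc n = ((n + 1 : ℕ) : ℤ) := rfl
    rw [this, Int.toNat_natCast]
    omega

theorem primrec_natCast_sub_natCast : Primrec₂ fun m n : ℕ => (m : ℤ) - n := by
  have h : Primrec₂ fun m n : ℕ => if n ≤ m then ((m - n : ℕ) : ℤ) else Int.negSucc (n - m - 1) :=
    Primrec.ite (Primrec.nat_le.comp Primrec.snd Primrec.fst)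
      (primrec_int_natCast.comp (Primrec.nat_sub.comp Primrec.fst Primrec.snd))
      (primrec_int_negSucc.comp (Primrec.nat_sub.comp (Primrec.nat_sub.comp Primrec.snd Primrec.fst)
        (Primrec.const 1)))
  refine h.of_eq fun m n => ?_
  split_ifs with hmn
  · omega
  · rw [Int.negSucc_eq]
    omega

variable {α : Type*} [Primcodable α] {f g : α → ℤ}

theorem primrec_int_sub (hf : Primrec f) (hg : Primrec g) : Primrec fun x => f x - g x := by
  have h := primrec_natCast_sub_natCast.comp
    (Primrec.nat_add.comp (primrec_int_toNat.comp hf) (primrec_int_neg_toNat.comp hg))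
    (Primrec.nat_add.comp (primrec_int_neg_toNat.comp hf) (primrec_int_toNat.comp hg))
  refine h.of_eq fun x => ?_
  push_cast
  omega

theorem primrec_int_add (hf : Primrec f) (hg : Primrec g) : Primrec fun x => f x + g x :=
  (primrec_int_sub hf (primrec_int_sub (Primrec.const 0) hg)).of_eq fun x => by ring

theorem primrec_int_neg (hf : Primrec f) : Primrec fun x => -f x :=
  (primrec_int_sub (Primrec.const 0) hf).of_eq fun x => by ring

theorem primrec_int_mul (hf : Primrec f) (hg : Primrec g) : Primrec fun x => f x * g x := by
  have hf1 := primrec_int_toNat.comp hf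
  have hf2 := primrec_int_neg_toNat.comp hf
  have hg1 := primrec_int_toNat.comp hg
  have hg2 := primrec_int_neg_toNat.comp hg
  have h := primrec_natCast_sub_natCast.comp
    (Primrec.nat_add.comp (Primrec.nat_mul.comp hf1 hg1) (Primrec.nat_mul.comp hf2 hg2))
    (Primrec.nat_add.comp (Primrec.nat_mul.comp hf1 hg2) (Primrec.nat_mul.comp hf2 hg1))
  refine h.of_eq fun x => ?_
  have e1 : f x = (f x).toNat - (-f x).toNat := by omega
  have e2 : g x = (g x).toNat - (-g x).toNat := by omega
  push_cast
  conv_rhs => rw [e1, e2]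
  ring

theorem primrec_int_pow (hf : Primrec f) (n : ℕ) : Primrec fun x => f x ^ n := by
  induction n with
  | zero => simpa using Primrec.const (1 : ℤ)
  | succ n ih => exact (primrec_int_mul ih hf).of_eq fun x => (pow_succ _ _).symm

theorem primrec_int_natAbs (hf : Primrec f) : Primrec fun x => (f x).natAbs :=
  (Primrec.nat_add.comp (primrec_int_toNat.comp hf) (primrec_int_neg_toNat.comp hf)).of_eq
    fun x => by omega

theorem primrecPred_int_le (hf : Primrec f) (hg : Primrec g) :
    PrimrecPred fun x => f x ≤ g x :=
  (Primrec.eq.comp (primrec_int_toNat.comp (primrec_int_sub hf hg)) (Primrec.const 0)).of_eq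
    fun x => by omega

theorem primrecPred_int_lt (hf : Primrec f) (hg : Primrec g) :
    PrimrecPred fun x => f x < g x :=
  (primrecPred_int_le hg hf).not.of_eq fun _ => not_le

theorem primrecPred_int_eq (hf : Primrec f) (hg : Primrec g) :
    PrimrecPred fun x => f x = g x :=
  Primrec.eq.comp hf hg

theorem primrec_nat_pow {f : α → ℕ} (hf : Primrec f) (n : ℕ) : Primrec fun x => f x ^ n := by
  induction n with
  | zero => simpa using Primrec.const (1 : ℕ)
  | succ n ih => exact (Primrec.nat_mul.comp ih hf).of_eq fun x => (pow_succ _ _).symm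

/-- The integers of absolute value at most `n`, as a list. -/
def intsUpTo (n : ℕ) : List ℤ := (List.range (2 * n + 1)).map fun i : ℕ => (i : ℤ) - n

theorem mem_intsUpTo {n : ℕ} {z : ℤ} : z ∈ intsUpTo n ↔ |z| ≤ n := by
  simp only [intsUpTo, List.mem_map, List.mem_range, abs_le]
  constructor
  · rintro ⟨i, hi, rfl⟩
    omega
  · intro h
    exact ⟨(z + n).toNat, by omega, by omega⟩

theorem primrec_intsUpTo : Primrec intsUpTo := by
  refine Primrec.list_map (Primrec.list_range.comp (Primrec.succ.comp Primrec.nat_double)) ?_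
  exact primrec_natCast_sub_natCast.comp₂ Primrec₂.right Primrec₂.left

end IntegerArithmetic

/-! ### The algorithm -/

section Closure

variable {α β γ : Type*} [Primcodable α] [Primcodable β] [Primcodable γ]

theorem primrec_id : Primrec fun x : α => x := Primrec.id

theorem primrec_fst_of {f : α → β × γ} (hf : Primrec f) : Primrec fun x => (f x).1 :=
  Primrec.fst.comp hf

theorem primrec_snd_of {f : α → β × γ} (hf : Primrec f) : Primrec fun x => (f x).2 :=
  Primrec.snd.comp hf

theorem primrec_nat_add_of {f g : α → ℕ} (hf : Primrec f) (hg : Primrec g) :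
    Primrec fun x => f x + g x :=
  Primrec.nat_add.comp hf hg

theorem primrec_nat_mul_of {f g : α → ℕ} (hf : Primrec f) (hg : Primrec g) :
    Primrec fun x => f x * g x :=
  Primrec.nat_mul.comp hf hg

theorem primrecPred_nat_le_of {f g : α → ℕ} (hf : Primrec f) (hg : Primrec g) :
    PrimrecPred fun x => f x ≤ g x :=
  Primrec.nat_le.comp hf hg

theorem primrecPred_nat_lt_of {f g : α → ℕ} (hf : Primrec f) (hg : Primrec g) :
    PrimrecPred fun x => f x < g x :=
  Primrec.nat_lt.comp hf hg

theorem primrecPred_exists_mem {l : α → List β} {p : α → β → Prop} (hl : Primrec l)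
    (hp : PrimrecPred fun x : α × β => p x.1 x.2) : PrimrecPred fun x => ∃ y ∈ l x, p x y := by
  have h : PrimrecRel fun (y : β) (x : α) => p x y :=
    PrimrecRel.swap (r := p) (PrimrecPred.primrecRel hp)
  exact h.exists_mem_list.comp hl Primrec.id

end Closure

/-- Quadruples of integers. They serve both as the coefficients `(a, b, c, d)` of
`X⁴ + a X³ + b X² + c X + d` and as the coordinates of `v₀ + v₁ X + v₂ X² + v₃ X³`. -/
abbrev Quad : Type := ℤ × ℤ × ℤ × ℤ

/-- Multiplication by `X` modulo the monic quartic with coefficients `p`. -/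
def mulX (p v : Quad) : Quad :=
  (-(p.2.2.2 * v.2.2.2), v.1 - p.2.2.1 * v.2.2.2, v.2.1 - p.2.1 * v.2.2.2,
    v.2.2.1 - p.1 * v.2.2.2)

/-- Coordinatewise `z • w + v`. -/
def smulAdd (z : ℤ) (w v : Quad) : Quad :=
  (z * w.1 + v.1, z * w.2.1 + v.2.1, z * w.2.2.1 + v.2.2.1, z * w.2.2.2 + v.2.2.2)

/-- Multiplication modulo the monic quartic with coefficients `p`. -/
def mulMod (p v w : Quad) : Quad :=
  smulAdd v.1 w (mulX p (smulAdd v.2.1 w (mulX p (smulAdd v.2.2.1 w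
    (mulX p (smulAdd v.2.2.2 w 0))))))

/-- The state of a Horner evaluation of two integer polynomials modulo a quartic: the two
residues obtained so far, and the sum of the absolute values of the coefficients used. -/
abbrev HornerState : Type := Quad × Quad × ℕ

/-- One Horner step, which appends the coefficients `d.1` and `d.2`. -/
def hornerStep (p : Quad) (d : ℤ × ℤ) (s : HornerState) : HornerState :=
  (smulAdd d.1 (1, 0, 0, 0) (mulX p s.1), smulAdd d.2 (1, 0, 0, 0) (mulX p s.2.1),
    d.1.natAbs + d.2.natAbs + s.2.2)

/-- Pairs of integers of absolute value at most `k`. -/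
def digits (k : ℕ) : List (ℤ × ℤ) :=
  (intsUpTo k).flatMap fun x => (intsUpTo k).map fun y => (x, y)

/-- All states reachable in `n` Horner steps with coefficients of absolute value at most `k`. -/
def hornerStates (k : ℕ) (p : Quad) (n : ℕ) : List HornerState :=
  (fun L : List HornerState => L.flatMap fun s => (digits k).map fun d => hornerStep p d s)^[n]
    [(0, 0, 0)]

/-- A bound for the number of algebraic integers of a field of degree at most `4` all of whose
conjugates have absolute value at most `k`. -/
def lengthBound (k : ℕ) : ℕ := ((4 * k + 1) ^ 2) ^ 4

/-- A bound for the coefficients of the minimal polynomial of an element of degree at most `4`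
all of whose conjugates have absolute value at most `k + 1`. -/
def coeffBound (k : ℕ) : ℕ := 6 * (k + 1) ^ 4

/-- There are integer polynomials `A` and `B`, not both zero, of bounded degree and with sum of
absolute values of coefficients at most `k`, such that `A² + B²` is divisible by the quartic
with coefficients `p` up to powers of `X`. -/
def HasSmallRelation (k : ℕ) (p : Quad) : Prop :=
  ∃ s ∈ hornerStates k p (lengthBound k), 0 < s.2.2 ∧ s.2.2 ≤ k ∧
    mulX p (mulX p (smulAdd 1 (mulMod p s.1 s.1) (mulMod p s.2.1 s.2.1))) = 0

/-- The conditions on `X² (X² + a X + b)` under which `X² + a X + b` defines a quadratic field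
in which its root is a unit of infinite order. -/
def QuadraticTest (p : Quad) : Prop :=
  p.2.2.1 = 0 ∧ p.2.2.2 = 0 ∧ (p.2.1 = 1 ∨ p.2.1 = -1) ∧ 1 + p.1 + p.2.1 ≠ 0 ∧
    1 - p.1 + p.2.1 ≠ 0 ∧ 0 < p.1 ^ 2 - 4 * p.2.1

/-- The conditions on `X (X³ + a X² + b X + c)` under which `X³ + a X² + b X + c` defines a
complex cubic field in which its root is a unit: no rational root, and negative discriminant. -/
def CubicTest (p : Quad) : Prop :=
  p.2.2.2 = 0 ∧ (p.2.2.1 = 1 ∨ p.2.2.1 = -1) ∧ 1 + p.1 + p.2.1 + p.2.2.1 ≠ 0 ∧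
    -1 + p.1 - p.2.1 + p.2.2.1 ≠ 0 ∧
    p.1 ^ 2 * p.2.1 ^ 2 - 4 * p.2.1 ^ 3 - 4 * p.1 ^ 3 * p.2.2.1 + 18 * p.1 * p.2.1 * p.2.2.1
      - 27 * p.2.2.1 ^ 2 < 0

/-- The discriminant of `X⁴ + a X³ + b X² + c X + d`. -/
def quarticDisc {R : Type*} [CommRing R] (a b c d : R) : R :=
  256 * d ^ 3 - 192 * a * c * d ^ 2 - 128 * b ^ 2 * d ^ 2 + 144 * b * c ^ 2 * d - 27 * c ^ 4
    + 144 * a ^ 2 * b * d ^ 2 - 6 * a ^ 2 * c ^ 2 * d - 80 * a * b ^ 2 * c * d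
    + 18 * a * b * c ^ 3 + 16 * b ^ 4 * d - 4 * b ^ 3 * c ^ 2 - 27 * a ^ 4 * d ^ 2
    + 18 * a ^ 3 * b * c * d - 4 * a ^ 3 * c ^ 3 - 4 * a ^ 2 * b ^ 3 * d + a ^ 2 * b ^ 2 * c ^ 2

/-- A condition which says, for a quartic with nonzero discriminant, that
`X⁴ + a X³ + b X² + c X + 1` has no real root: a positive discriminant leaves the cases of no and of
four real roots, and four real roots make both of the other expressions nonpositive, the first one
negative. -/
def DefiniteTest (a b c : ℤ) : Prop :=
  0 < quarticDisc a b c 1 ∧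
    (0 ≤ 8 * b - 3 * a ^ 2 ∨
      0 < 64 - 16 * b ^ 2 + 16 * a ^ 2 * b - 16 * a * c - 3 * a ^ 4)

/-- The integer `s` is a root of a resolvent cubic of `f = X⁴ + a X³ + b X² + c X + 1`; then
`(2 X² + a X + s)² - 4 f` is `u (X + w)²` for rational `u` and `w`, or a constant. -/
def IsResolventRoot (a b c s : ℤ) : Prop :=
  (a ^ 2 - 4 * b + 4 * s) * (s ^ 2 - 4) = (a * s - 2 * c) ^ 2

/-- A resolvent root `s` with nonnegative `a² - 4 b + 4 s` and `s² - 4` belongs to a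
factorization of `X⁴ + a X³ + b X² + c X + 1` over `ℚ` or over a real quadratic field, and one for
which these are `-3 v²` and `-3 t²` to a factorization over `ℚ(√-3)`. The number `n` bounds the
search. -/
def HasForbiddenFactorization (n : ℕ) (a b c : ℤ) : Prop :=
  ∃ s ∈ intsUpTo n, IsResolventRoot a b c s ∧
    ((0 ≤ a ^ 2 - 4 * b + 4 * s ∧ 0 ≤ s ^ 2 - 4) ∨
      ((∃ v ∈ intsUpTo n, a ^ 2 - 4 * b + 4 * s = -3 * v ^ 2) ∧
        ∃ t ∈ intsUpTo n, s ^ 2 - 4 = -3 * t ^ 2))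

/-- A bound for the integers `s`, `v` and `t` of `HasForbiddenFactorization` when the coefficients
of the quartic are bounded by `C`. -/
def searchBound (C : ℕ) : ℕ := 100 * (C + 1) ^ 2

/-- The conditions on `X⁴ + a X³ + b X² + c X + 1` under which it defines a totally complex
quartic field without real quadratic subfield and without primitive third root of unity. -/
def QuarticTest (k : ℕ) (p : Quad) : Prop :=
  p.2.2.2 = 1 ∧ 2 + p.1 + p.2.1 + p.2.2.1 ≠ 0 ∧ 2 - p.1 + p.2.1 - p.2.2.1 ≠ 0 ∧
    DefiniteTest p.1 p.2.1 p.2.2.1 ∧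
    ¬ HasForbiddenFactorization (searchBound (coeffBound k)) p.1 p.2.1 p.2.2.1

/-- All conditions on a candidate. -/
def Accepted (k : ℕ) (p : Quad) : Prop :=
  (QuadraticTest p ∨ CubicTest p ∨ QuarticTest k p) ∧ HasSmallRelation k p

/-- The coefficients, from the constant term up, of the quotient of a quartic by the largest
power of `X` dividing it (for a quotient of degree at least `2`). -/
def outputCoeffs (p : Quad) : List ℤ :=
  open Classical in
  if p.2.2.2 = 0 then
    if p.2.2.1 = 0 then [p.2.1, p.1, 1] else [p.2.2.1, p.2.1, p.1, 1]
  else [p.2.2.2, p.2.2.1, p.2.1, p.1, 1]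

/-- The candidates: quadruples of integers of absolute value at most `n`. -/
def candidates (n : ℕ) : List Quad :=
  (intsUpTo n).flatMap fun a => (intsUpTo n).flatMap fun b =>
    (intsUpTo n).flatMap fun c => (intsUpTo n).map fun d => (a, b, c, d)

open Classical in
/-- The list of the polynomials that define the fields of the family with `ell K ≤ k`. The
polynomial `X² + X + 1` of `ℚ(ζ₃)`, a field without units of infinite order, is added by hand. -/
noncomputable def fieldList (k : ℕ) : List (List ℤ) :=
  [1, 1, 1] :: ((candidates (coeffBound k)).filter fun p => Accepted k p).map outputCoeffs

section Primrec

variable {α : Type*} [Primcodable α]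

theorem primrec_mulX {f g : α → Quad} (hf : Primrec f) (hg : Primrec g) :
    Primrec fun x => mulX (f x) (g x) := by
  unfold mulX
  repeat' with_reducible first
    | exact hf | exact hg | apply primrec_int_sub | apply primrec_int_neg
    | apply primrec_int_mul | apply primrec_fst_of | apply primrec_snd_of | apply Primrec.pair

theorem primrec_smulAdd {z : α → ℤ} {f g : α → Quad} (hz : Primrec z) (hf : Primrec f)
    (hg : Primrec g) : Primrec fun x => smulAdd (z x) (f x) (g x) := by
  unfold smulAdd
  repeat' with_reducible first
    | exact hz | exact hf | exact hg | apply primrec_int_add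
    | apply primrec_int_mul | apply primrec_fst_of | apply primrec_snd_of | apply Primrec.pair

theorem primrec_mulMod {e f g : α → Quad} (he : Primrec e) (hf : Primrec f)
    (hg : Primrec g) : Primrec fun x => mulMod (e x) (f x) (g x) := by
  unfold mulMod
  repeat' with_reducible first
    | exact he | exact hf | exact hg | apply primrec_smulAdd | apply primrec_mulX
    | apply primrec_fst_of | apply primrec_snd_of | apply Primrec.const

theorem primrec_hornerStep {p : α → Quad} {d : α → ℤ × ℤ} {s : α → HornerState}
    (hp : Primrec p) (hd : Primrec d) (hs : Primrec s) :
    Primrec fun x => hornerStep (p x) (d x) (s x) := by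
  unfold hornerStep
  repeat' with_reducible first
    | exact hp | exact hd | exact hs | apply primrec_nat_add_of
    | apply primrec_int_natAbs | apply primrec_smulAdd | apply primrec_mulX
    | apply primrec_fst_of | apply primrec_snd_of | apply Primrec.const | apply Primrec.pair

theorem primrec_digits : Primrec digits := by
  refine Primrec.list_flatMap primrec_intsUpTo ?_
  refine Primrec.list_map (primrec_intsUpTo.comp Primrec.fst) ?_
  exact Primrec.pair (Primrec.snd.comp Primrec.fst) Primrec.snd

theorem primrec_hornerStates {k n : α → ℕ} {p : α → Quad} (hk : Primrec k) (hp : Primrec p)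
    (hn : Primrec n) : Primrec fun x => hornerStates (k x) (p x) (n x) := by
  refine Primrec.nat_iterate hn (Primrec.const _) ?_
  refine Primrec.list_flatMap Primrec.snd ?_
  refine Primrec.list_map (primrec_digits.comp (hk.comp (Primrec.fst.comp Primrec.fst))) ?_
  exact primrec_hornerStep (hp.comp (Primrec.fst.comp (Primrec.fst.comp Primrec.fst)))
    Primrec.snd (Primrec.snd.comp Primrec.fst)

theorem primrec_lengthBound : Primrec lengthBound :=
  primrec_nat_pow (primrec_nat_pow (primrec_nat_add_of
    (primrec_nat_mul_of (Primrec.const 4) Primrec.id) (Primrec.const 1)) 2) 4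

theorem primrec_coeffBound : Primrec coeffBound :=
  primrec_nat_mul_of (Primrec.const 6)
    (primrec_nat_pow (primrec_nat_add_of Primrec.id (Primrec.const 1)) 4)

theorem primrecPred_hasSmallRelation :
    PrimrecPred fun x : ℕ × Quad => HasSmallRelation x.1 x.2 := by
  refine primrecPred_exists_mem (primrec_hornerStates Primrec.fst Primrec.snd
    (primrec_lengthBound.comp Primrec.fst)) ?_
  have hk : Primrec fun x : (ℕ × Quad) × HornerState => x.1.1 := Primrec.fst.comp Primrec.fst
  have hp : Primrec fun x : (ℕ × Quad) × HornerState => x.1.2 := Primrec.snd.comp Primrec.fst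
  have hs : Primrec fun x : (ℕ × Quad) × HornerState => x.2 := Primrec.snd
  have h1 := primrec_fst_of hs
  have h2 := primrec_fst_of (primrec_snd_of hs)
  have h3 := primrec_snd_of (primrec_snd_of hs)
  exact (primrecPred_nat_lt_of (Primrec.const 0) h3).and ((primrecPred_nat_le_of h3 hk).and
    (Primrec.eq.comp (primrec_mulX hp (primrec_mulX hp (primrec_smulAdd (Primrec.const 1)
      (primrec_mulMod hp h1 h1) (primrec_mulMod hp h2 h2)))) (Primrec.const 0)))

theorem primrecPred_quadraticTest : PrimrecPred QuadraticTest := by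
  unfold QuadraticTest
  repeat' with_reducible first
    | apply PrimrecPred.and | apply PrimrecPred.or | apply PrimrecPred.not
    | apply primrecPred_int_lt | apply primrecPred_int_eq
    | apply Primrec.const | apply primrec_int_add | apply primrec_int_sub
    | apply primrec_int_mul | apply primrec_int_pow | apply primrec_fst_of
    | apply primrec_snd_of | apply primrec_id

theorem primrecPred_cubicTest : PrimrecPred CubicTest := by
  unfold CubicTest
  repeat' with_reducible first
    | apply PrimrecPred.and | apply PrimrecPred.or | apply PrimrecPred.not
    | apply primrecPred_int_lt | apply primrecPred_int_eq
    | apply Primrec.const | apply primrec_int_add | apply primrec_int_sub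
    | apply primrec_int_mul | apply primrec_int_pow | apply primrec_fst_of
    | apply primrec_snd_of | apply primrec_id

theorem primrecPred_definiteTest {a b c : α → ℤ} (ha : Primrec a) (hb : Primrec b)
    (hc : Primrec c) : PrimrecPred fun x => DefiniteTest (a x) (b x) (c x) := by
  unfold DefiniteTest quarticDisc
  repeat' with_reducible first
    | exact ha | exact hb | exact hc
    | apply PrimrecPred.and | apply PrimrecPred.or
    | apply primrecPred_int_lt | apply primrecPred_int_le
    | apply Primrec.const | apply primrec_int_add | apply primrec_int_sub
    | apply primrec_int_mul | apply primrec_int_pow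

theorem primrecPred_hasForbiddenFactorization {n : α → ℕ} {a b c : α → ℤ} (hn : Primrec n)
    (ha : Primrec a) (hb : Primrec b) (hc : Primrec c) :
    PrimrecPred fun x => HasForbiddenFactorization (n x) (a x) (b x) (c x) := by
  have h1 : Primrec fun x : α × ℤ => a x.1 ^ 2 - 4 * b x.1 + 4 * x.2 :=
    primrec_int_add (primrec_int_sub (primrec_int_pow (ha.comp Primrec.fst) 2)
      (primrec_int_mul (Primrec.const 4) (hb.comp Primrec.fst)))
      (primrec_int_mul (Primrec.const 4) Primrec.snd)
  have h2 : Primrec fun x : α × ℤ => x.2 ^ 2 - 4 :=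
    primrec_int_sub (primrec_int_pow Primrec.snd 2) (Primrec.const 4)
  have h3 : Primrec fun x : α × ℤ => a x.1 * x.2 - 2 * c x.1 :=
    primrec_int_sub (primrec_int_mul (ha.comp Primrec.fst) Primrec.snd)
      (primrec_int_mul (Primrec.const 2) (hc.comp Primrec.fst))
  have hr : Primrec fun x : α × ℤ => intsUpTo (n x.1) :=
    primrec_intsUpTo.comp (hn.comp Primrec.fst)
  have h4 : Primrec fun x : (α × ℤ) × ℤ => -3 * x.2 ^ 2 :=
    primrec_int_mul (Primrec.const (-3)) (primrec_int_pow Primrec.snd 2)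
  refine primrecPred_exists_mem (primrec_intsUpTo.comp hn) ?_
  refine (primrecPred_int_eq (primrec_int_mul h1 h2) (primrec_int_pow h3 2)).and ?_
  refine ((primrecPred_int_le (Primrec.const 0) h1).and
    (primrecPred_int_le (Primrec.const 0) h2)).or ?_
  exact (primrecPred_exists_mem hr (primrecPred_int_eq (h1.comp Primrec.fst) h4)).and
    (primrecPred_exists_mem hr (primrecPred_int_eq (h2.comp Primrec.fst) h4))

theorem primrec_searchBound : Primrec searchBound :=
  primrec_nat_mul_of (Primrec.const 100)
    (primrec_nat_pow (primrec_nat_add_of Primrec.id (Primrec.const 1)) 2)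

theorem primrecPred_quarticTest : PrimrecPred fun x : ℕ × Quad => QuarticTest x.1 x.2 := by
  have hn : Primrec fun x : ℕ × Quad => searchBound (coeffBound x.1) :=
    primrec_searchBound.comp (primrec_coeffBound.comp Primrec.fst)
  unfold QuarticTest
  repeat' with_reducible first
    | exact hn
    | apply PrimrecPred.and | apply PrimrecPred.not
    | apply primrecPred_int_eq | apply primrecPred_definiteTest
    | apply primrecPred_hasForbiddenFactorization
    | apply Primrec.const | apply primrec_int_add | apply primrec_int_sub
    | apply primrec_fst_of | apply primrec_snd_of | apply primrec_id

theorem primrecPred_accepted : PrimrecPred fun x : ℕ × Quad => Accepted x.1 x.2 :=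
  (((primrecPred_quadraticTest.comp Primrec.snd).or ((primrecPred_cubicTest.comp
    Primrec.snd).or primrecPred_quarticTest))).and primrecPred_hasSmallRelation

theorem primrec_outputCoeffs : Primrec outputCoeffs := by
  unfold outputCoeffs
  repeat' with_reducible first
    | apply Primrec.ite | apply primrecPred_int_eq | apply Primrec.const
    | apply Primrec.list_cons.comp | apply primrec_fst_of
    | apply primrec_snd_of | apply primrec_id

theorem primrec_candidates : Primrec candidates := by
  refine Primrec.list_flatMap primrec_intsUpTo ?_
  refine Primrec.list_flatMap (primrec_intsUpTo.comp Primrec.fst) ?_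
  refine Primrec.list_flatMap (primrec_intsUpTo.comp (Primrec.fst.comp Primrec.fst)) ?_
  refine Primrec.list_map
    (primrec_intsUpTo.comp (Primrec.fst.comp (Primrec.fst.comp Primrec.fst))) ?_
  change Primrec fun x : ((((ℕ × ℤ) × ℤ) × ℤ) × ℤ) => (x.1.1.1.2, x.1.1.2, x.1.2, x.2)
  repeat' with_reducible first
    | apply primrec_fst_of | apply primrec_snd_of | apply primrec_id | apply Primrec.pair

theorem computable_fieldList : Computable fieldList := by
  classical
  apply Primrec.to_comp
  refine Primrec.list_cons.comp (Primrec.const _) ?_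
  refine Primrec.list_map ?_ (primrec_outputCoeffs.comp Primrec.snd)
  have h : PrimrecRel fun (p : Quad) (k : ℕ) => Accepted k p :=
    PrimrecRel.swap (r := Accepted) (PrimrecPred.primrecRel primrecPred_accepted)
  exact h.listFilter.comp (primrec_candidates.comp primrec_coeffBound) Primrec.id

end Primrec

/-! ### Horner evaluation and its correctness modulo a quartic -/

section Horner

variable {K : Type*} [Field K]

/-- The value at `η` of the polynomial whose list of coefficients, from the constant term up, is
`l.map w`. -/
def hornerEval {ι : Type*} (η : K) (w : ι → K) (l : List ι) : K :=
  l.foldr (fun d x => w d + η * x) 0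

@[simp] theorem hornerEval_nil {ι : Type*} (η : K) (w : ι → K) : hornerEval η w [] = 0 := rfl

@[simp] theorem hornerEval_cons {ι : Type*} (η : K) (w : ι → K) (d : ι) (l : List ι) :
    hornerEval η w (d :: l) = w d + η * hornerEval η w l := rfl

theorem hornerEval_append {ι : Type*} (η : K) (w : ι → K) (l₁ l₂ : List ι) :
    hornerEval η w (l₁ ++ l₂) = hornerEval η w l₁ + η ^ l₁.length * hornerEval η w l₂ := by
  induction l₁ with
  | nil => simp
  | cons d l ih =>
    simp only [List.cons_append, hornerEval_cons, ih, List.length_cons]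
    ring

theorem hornerEval_add_mul {ι : Type*} (η j : K) (w₁ w₂ : ι → K) (l : List ι) :
    hornerEval η (fun d => w₁ d + w₂ d * j) l = hornerEval η w₁ l + hornerEval η w₂ l * j := by
  induction l with
  | nil => simp
  | cons d l ih =>
    simp only [hornerEval_cons, ih]
    ring

theorem map_hornerEval {ι L : Type*} [Field L] (φ : K →+* L) (η : K) (w : ι → K) (l : List ι) :
    φ (hornerEval η w l) = hornerEval (φ η) (fun d => φ (w d)) l := by
  induction l with
  | nil => simp
  | cons d l ih => simp only [hornerEval_cons, map_add, map_mul, ih]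

/-- The sum of the absolute values of the entries of a list of pairs. -/
def weight (l : List (ℤ × ℤ)) : ℕ := (l.map fun d => d.1.natAbs + d.2.natAbs).sum

@[simp] theorem weight_nil : weight [] = 0 := rfl

@[simp] theorem weight_cons (d : ℤ × ℤ) (l : List (ℤ × ℤ)) :
    weight (d :: l) = d.1.natAbs + d.2.natAbs + weight l := by
  simp [weight]

@[simp] theorem weight_append (l₁ l₂ : List (ℤ × ℤ)) :
    weight (l₁ ++ l₂) = weight l₁ + weight l₂ := by
  simp [weight]

theorem le_weight_of_mem {l : List (ℤ × ℤ)} {d : ℤ × ℤ} (h : d ∈ l) :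
    d.1.natAbs + d.2.natAbs ≤ weight l :=
  List.single_le_sum (by simp) _ (List.mem_map_of_mem h)

theorem eq_zero_of_weight_eq_zero {l : List (ℤ × ℤ)} (h : weight l = 0) {d : ℤ × ℤ}
    (hd : d ∈ l) : d = (0, 0) := by
  have := le_weight_of_mem hd
  ext <;> simp <;> omega

theorem hornerEval_eq_zero_of_weight {l : List (ℤ × ℤ)} (h : weight l = 0) (η : K)
    {w : ℤ × ℤ → K} (hw : w (0, 0) = 0) : hornerEval η w l = 0 := by
  induction l with
  | nil => rfl
  | cons d l ih =>
    have hd := eq_zero_of_weight_eq_zero h (List.mem_cons_self ..)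
    rw [weight_cons] at h
    rw [hornerEval_cons, ih (by omega), hd, hw]
    ring

/-- The final state of a Horner evaluation. -/
def hornerRun (p : Quad) (l : List (ℤ × ℤ)) : HornerState :=
  l.foldr (hornerStep p) (0, 0, 0)

theorem mem_digits {k : ℕ} {d : ℤ × ℤ} : d ∈ digits k ↔ |d.1| ≤ k ∧ |d.2| ≤ k := by
  obtain ⟨x, y⟩ := d
  simp [digits, mem_intsUpTo]

theorem mem_hornerStates {k : ℕ} {p : Quad} {n : ℕ} {s : HornerState} :
    s ∈ hornerStates k p n ↔
      ∃ l : List (ℤ × ℤ), l.length = n ∧ (∀ d ∈ l, d ∈ digits k) ∧ hornerRun p l = s := by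
  induction n generalizing s with
  | zero =>
    simp only [hornerStates, Function.iterate_zero, id, List.mem_singleton]
    constructor
    · rintro rfl
      exact ⟨[], rfl, by simp, rfl⟩
    · rintro ⟨l, hl, -, rfl⟩
      rw [List.length_eq_zero_iff] at hl
      rw [hl]
      rfl
  | succ n ih =>
    rw [hornerStates, Function.iterate_succ_apply', ← hornerStates]
    simp only [List.mem_flatMap, List.mem_map]
    constructor
    · rintro ⟨t, ht, d, hd, rfl⟩
      obtain ⟨l, hl, hl', rfl⟩ := ih.1 ht
      refine ⟨d :: l, by simp [hl], ?_, rfl⟩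
      simpa [hd] using hl'
    · rintro ⟨l, hl, hl', rfl⟩
      cases l with
      | nil => simp at hl
      | cons d l =>
        exact ⟨hornerRun p l, ih.2 ⟨l, by simpa using hl,
          fun e he => hl' e (List.mem_cons_of_mem _ he), rfl⟩, d,
          hl' d (List.mem_cons_self ..), rfl⟩

/-- The value at `η` of a residue modulo a quartic. -/
def quadEval (η : K) (v : Quad) : K :=
  v.1 + v.2.1 * η + v.2.2.1 * η ^ 2 + v.2.2.2 * η ^ 3

/-- `η` is a root of the monic quartic with coefficients `p`. -/
def IsQuarticRoot (p : Quad) (η : K) : Prop :=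
  η ^ 4 + p.1 * η ^ 3 + p.2.1 * η ^ 2 + p.2.2.1 * η + p.2.2.2 = 0

variable {p : Quad} {η : K}

theorem quadEval_mulX (h : IsQuarticRoot p η) (v : Quad) :
    quadEval η (mulX p v) = η * quadEval η v := by
  simp only [quadEval, mulX]
  push_cast
  rw [IsQuarticRoot] at h
  linear_combination -(v.2.2.2 : K) * h

theorem quadEval_smulAdd (η : K) (z : ℤ) (v w : Quad) :
    quadEval η (smulAdd z v w) = z * quadEval η v + quadEval η w := by
  simp only [quadEval, smulAdd]
  push_cast
  ring

theorem quadEval_mulMod (h : IsQuarticRoot p η) (v w : Quad) :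
    quadEval η (mulMod p v w) = quadEval η v * quadEval η w := by
  have h0 : quadEval η 0 = 0 := by simp [quadEval]
  simp only [mulMod, quadEval_smulAdd, quadEval_mulX h, h0]
  conv_rhs => rw [quadEval]
  ring

theorem quadEval_hornerRun (h : IsQuarticRoot p η) (l : List (ℤ × ℤ)) :
    quadEval η (hornerRun p l).1 = hornerEval η (fun d => (d.1 : K)) l ∧
    quadEval η (hornerRun p l).2.1 = hornerEval η (fun d => (d.2 : K)) l := by
  induction l with
  | nil => simp [hornerRun, quadEval]
  | cons d l ih =>
    have e : hornerRun p (d :: l) = hornerStep p d (hornerRun p l) := rfl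
    have h1 : quadEval η (1, 0, 0, 0) = 1 := by simp [quadEval]
    rw [e, hornerStep]
    simp only [quadEval_smulAdd, quadEval_mulX h, ih, hornerEval_cons, h1, mul_one, and_self]

theorem hornerRun_weight (p : Quad) (l : List (ℤ × ℤ)) : (hornerRun p l).2.2 = weight l := by
  induction l with
  | nil => rfl
  | cons d l ih =>
    have e : hornerRun p (d :: l) = hornerStep p d (hornerRun p l) := rfl
    rw [e, weight_cons, ← ih]
    rfl

theorem HasSmallRelation.exists_list {k : ℕ} (h : HasSmallRelation k p)
    (hη : IsQuarticRoot p η) (h0 : η ≠ 0) :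
    ∃ l : List (ℤ × ℤ), 0 < weight l ∧ weight l ≤ k ∧
      hornerEval η (fun d => (d.1 : K)) l ^ 2 + hornerEval η (fun d => (d.2 : K)) l ^ 2 = 0 := by
  obtain ⟨s, hs, h1, h2, h3⟩ := h
  obtain ⟨l, -, -, rfl⟩ := mem_hornerStates.1 hs
  rw [hornerRun_weight] at h1 h2
  refine ⟨l, h1, h2, ?_⟩
  have h4 := congrArg (quadEval η) h3
  have h5 : quadEval η 0 = 0 := by simp [quadEval]
  rw [quadEval_mulX hη, quadEval_mulX hη, quadEval_smulAdd, quadEval_mulMod hη,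
    quadEval_mulMod hη, (quadEval_hornerRun hη l).1, (quadEval_hornerRun hη l).2, h5] at h4
  have h6 := (mul_eq_zero.1 ((mul_eq_zero.1 h4).resolve_left h0)).resolve_left h0
  rw [← h6]
  push_cast
  ring

theorem hasSmallRelation_of_list {k : ℕ} (hη : IsQuarticRoot p η)
    (hker : ∀ v : Quad, quadEval η v = 0 → mulX p (mulX p v) = 0)
    {l : List (ℤ × ℤ)} (hlen : l.length ≤ lengthBound k) (h1 : 0 < weight l) (h2 : weight l ≤ k)
    (h3 : hornerEval η (fun d => (d.1 : K)) l ^ 2 +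
      hornerEval η (fun d => (d.2 : K)) l ^ 2 = 0) :
    HasSmallRelation k p := by
  -- The states are those after exactly `lengthBound k` steps, so leading zeros are added.
  set z : List (ℤ × ℤ) := List.replicate (lengthBound k - l.length) (0, 0) with hz
  have hzw : weight z = 0 := by simp [weight, hz]
  refine ⟨hornerRun p (l ++ z), mem_hornerStates.2 ⟨l ++ z, ?_, fun d hd => ?_, rfl⟩, ?_, ?_, ?_⟩
  · simp [hz, hlen]
  · have := le_weight_of_mem hd
    rw [weight_append, hzw] at this
    rw [mem_digits, Int.abs_eq_natAbs, Int.abs_eq_natAbs]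
    omega
  · rw [hornerRun_weight, weight_append, hzw]
    omega
  · rw [hornerRun_weight, weight_append, hzw]
    omega
  · apply hker
    rw [quadEval_smulAdd, quadEval_mulMod hη, quadEval_mulMod hη, (quadEval_hornerRun hη _).1,
      (quadEval_hornerRun hη _).2, hornerEval_append, hornerEval_append,
      hornerEval_eq_zero_of_weight hzw η (by simp), hornerEval_eq_zero_of_weight hzw η (by simp)]
    push_cast
    linear_combination h3

end Horner

/-! ### From relations to vanishing sums of units -/

section UnitSums

variable {K : Type*} [Field K]

theorem od_le_iff {k : ℕ} :
    od K ≤ k ↔ ∃ m : ℕ, m ≤ k ∧ 3 ≤ m ∧ Odd m ∧ HasUnitSum K m := by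
  constructor
  · intro h
    have hne : {m : ℕ∞ | ∃ k : ℕ, m = k ∧ 3 ≤ k ∧ Odd k ∧ HasUnitSum K k}.Nonempty := by
      by_contra hne
      rw [Set.not_nonempty_iff_eq_empty] at hne
      rw [od, hne, sInf_empty] at h
      exact absurd h (by simp)
    obtain ⟨m, hm, hm'⟩ := csInf_mem hne
    exact ⟨m, by rw [od, hm] at h; exact_mod_cast h, hm'⟩
  · rintro ⟨m, hmk, hm⟩
    have h : od K ≤ (m : ℕ∞) := sInf_le ⟨m, rfl, hm⟩
    exact h.trans (by exact_mod_cast hmk)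

theorem ev_le_iff {k : ℕ} :
    ev K ≤ k ↔ ∃ m : ℕ, m ≤ k ∧ 4 ≤ m ∧ Even m ∧ HasNondegenerateUnitSum K m := by
  constructor
  · intro h
    have hne : {m : ℕ∞ | ∃ k : ℕ, m = k ∧ 4 ≤ k ∧ Even k ∧
        HasNondegenerateUnitSum K k}.Nonempty := by
      by_contra hne
      rw [Set.not_nonempty_iff_eq_empty] at hne
      rw [ev, hne, sInf_empty] at h
      exact absurd h (by simp)
    obtain ⟨m, hm, hm'⟩ := csInf_mem hne
    exact ⟨m, by rw [ev, hm] at h; exact_mod_cast h, hm'⟩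
  · rintro ⟨m, hmk, hm⟩
    have h : ev K ≤ (m : ℕ∞) := sInf_le ⟨m, rfl, hm⟩
    exact h.trans (by exact_mod_cast hmk)

theorem hasNondegenerateUnitSum_card {ι : Type*} {s : Finset ι} {ε : ι → (𝓞 K)ˣ}
    (h0 : ∑ i ∈ s, (ε i : 𝓞 K) = 0)
    (h : ∀ t ⊆ s, t.Nonempty → t ≠ s → ∑ i ∈ t, (ε i : 𝓞 K) ≠ 0) :
    HasNondegenerateUnitSum K s.card := by
  classical
  let e := s.equivFin.symm
  have hinj : Function.Injective fun i => (e i : ι) :=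
    Subtype.val_injective.comp e.injective
  have himg : Finset.univ.image (fun i => (e i : ι)) = s := by
    ext x
    simp only [Finset.mem_image, Finset.mem_univ, true_and]
    exact ⟨fun ⟨i, hi⟩ => hi ▸ (e i).2, fun hx => ⟨e.symm ⟨x, hx⟩, by simp⟩⟩
  have hsum : ∀ t : Finset (Fin s.card),
      ∑ i ∈ t, (ε (e i) : 𝓞 K) = ∑ i ∈ t.image fun i => (e i : ι), (ε i : 𝓞 K) := fun t =>
    (Finset.sum_image (f := fun i => (ε i : 𝓞 K)) fun x _ y _ hxy => hinj hxy).symm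
  refine ⟨fun i => ε (e i), ?_, fun t ht ht' => ?_⟩
  · rw [hsum, himg, h0]
  · rw [hsum]
    refine h _ ?_ (ht.image _) fun hts => ht' ?_
    · exact (Finset.image_subset_image (Finset.subset_univ _)).trans himg.subset
    · exact Finset.image_injective hinj (hts.trans himg.symm)

/-- An odd vanishing sum of units contains a nondegenerate one of odd length: of two complementary
vanishing subsums one is odd. -/
theorem HasUnitSum.exists_nondegenerate {k : ℕ} (hk : Odd k) (h : HasUnitSum K k) :
    ∃ m, 3 ≤ m ∧ m ≤ k ∧ HasNondegenerateUnitSum K m := by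
  classical
  obtain ⟨ε, hε⟩ := h
  let S := (Finset.univ : Finset (Finset (Fin k))).filter
    fun s => Odd s.card ∧ ∑ i ∈ s, (ε i : 𝓞 K) = 0
  have hS : S.Nonempty := ⟨Finset.univ, by simpa [S] using ⟨hk, hε⟩⟩
  obtain ⟨s, hs, hmin⟩ := S.exists_min_image Finset.card hS
  simp only [S, Finset.mem_filter, Finset.mem_univ, true_and] at hs hmin
  refine ⟨s.card, ?_, (Finset.card_le_univ s).trans (by simp),
    hasNondegenerateUnitSum_card hs.2 fun t hts ht htne ht0 => ?_⟩
  · by_contra hlt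
    have h1 : s.card = 1 := by
      obtain ⟨r, hr⟩ := hs.1
      omega
    obtain ⟨i, rfl⟩ := Finset.card_eq_one.1 h1
    exact (ε i).ne_zero (by simpa using hs.2)
  · have hlt : t.card < s.card := Finset.card_lt_card (hts.ssubset_of_ne htne)
    have hcard := Finset.card_sdiff_add_card_eq_card hts
    have hpos := ht.card_pos
    have hsum := Finset.sum_sdiff (f := fun i => (ε i : 𝓞 K)) hts
    rw [ht0, add_zero, hs.2] at hsum
    rcases Nat.even_or_odd t.card with hev | hodd
    · have : Odd (s \ t).card := by
        by_contra hno
        rw [Nat.not_odd_iff_even] at hno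
        have := hno.add hev
        rw [hcard] at this
        exact (Nat.not_even_iff_odd.2 hs.1) this
      have := hmin _ ⟨this, hsum⟩
      omega
    · have := hmin t ⟨hodd, ht0⟩
      omega

theorem exists_nondegenerate_of_ell_le {k : ℕ} (h : ell K ≤ k) :
    ∃ m, 3 ≤ m ∧ m ≤ k ∧ HasNondegenerateUnitSum K m := by
  rw [ell, min_le_iff, od_le_iff, ev_le_iff] at h
  rcases h with ⟨m, hmk, -, hodd, hm⟩ | ⟨m, hmk, hm4, -, hm⟩
  · obtain ⟨n, h3, hn, hn'⟩ := hm.exists_nondegenerate hodd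
    exact ⟨n, h3, hn.trans hmk, hn'⟩
  · exact ⟨m, by omega, hmk, hm⟩

theorem ell_le_of_nondegenerate {k m : ℕ} (h3 : 3 ≤ m) (hmk : m ≤ k)
    (h : HasNondegenerateUnitSum K m) : ell K ≤ k := by
  rw [ell, min_le_iff, od_le_iff, ev_le_iff]
  rcases Nat.even_or_odd m with hev | hodd
  · refine Or.inr ⟨m, hmk, ?_, hev, h⟩
    obtain ⟨r, hr⟩ := hev
    omega
  · obtain ⟨ε, hε, -⟩ := h
    exact Or.inl ⟨m, hmk, h3, hodd, ε, hε⟩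

/-- A vanishing sum of units in which no two terms cancel bounds `ell`: a minimal vanishing subsum
has at least three terms. -/
theorem ell_le_of_sum_eq_zero {k m : ℕ} (ε : Fin m → (𝓞 K)ˣ) (hm : 0 < m) (hmk : m ≤ k)
    (h0 : ∑ i, (ε i : 𝓞 K) = 0) (hne : ∀ i j, ε i ≠ -ε j) : ell K ≤ k := by
  classical
  let S := (Finset.univ : Finset (Finset (Fin m))).filter
    fun s => s.Nonempty ∧ ∑ i ∈ s, (ε i : 𝓞 K) = 0
  have hS : S.Nonempty :=
    ⟨Finset.univ, by simpa [S, Finset.univ_nonempty_iff, h0] using ⟨⟨0, hm⟩⟩⟩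
  obtain ⟨s, hs, hmin⟩ := S.exists_min_image Finset.card hS
  simp only [S, Finset.mem_filter, Finset.mem_univ, true_and] at hs hmin
  refine ell_le_of_nondegenerate (m := s.card) ?_
    ((Finset.card_le_univ s).trans (by simpa using hmk))
    (hasNondegenerateUnitSum_card hs.2 fun t hts ht htne ht0 => ?_)
  · by_contra hlt
    have hpos := hs.1.card_pos
    have h12 : s.card = 1 ∨ s.card = 2 := by omega
    rcases h12 with h1 | h2
    · obtain ⟨i, rfl⟩ := Finset.card_eq_one.1 h1
      exact (ε i).ne_zero (by simpa using hs.2)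
    · obtain ⟨i, j, hij, rfl⟩ := Finset.card_eq_two.1 h2
      have := hs.2
      rw [Finset.sum_pair hij] at this
      refine hne i j (Units.ext ?_)
      rw [Units.val_neg]
      exact eq_neg_of_add_eq_zero_left this
  · have hlt : t.card < s.card := Finset.card_lt_card (hts.ssubset_of_ne htne)
    have := hmin t ⟨ht, ht0⟩
    omega

theorem ell_le_of_list {k : ℕ} (L : List (𝓞 K)ˣ) (hL : L ≠ []) (hLk : L.length ≤ k)
    (h0 : (L.map fun u : (𝓞 K)ˣ => ((u : 𝓞 K) : K)).sum = 0) (hne : ∀ u ∈ L, ∀ v ∈ L, u ≠ -v) :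
    ell K ≤ k := by
  refine ell_le_of_sum_eq_zero (m := L.length) (fun i => L.get i) (List.length_pos_iff.2 hL) hLk
    ?_ fun i j => hne _ (List.get_mem _ _) _ (List.get_mem _ _)
  apply FaithfulSMul.algebraMap_injective (𝓞 K) K
  rw [map_zero, map_sum, ← h0]
  rw [← List.sum_ofFn]
  congr 1
  conv_rhs => rw [← List.ofFn_get L, List.map_ofFn]
  rfl

/-- The unit `1` or `-1` with the sign of `a`. -/
def signUnit (R : Type*) [CommRing R] (a : ℤ) : Rˣ := if 0 ≤ a then 1 else -1

theorem natAbs_mul_signUnit (R : Type*) [CommRing R] (a : ℤ) :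
    (a.natAbs : R) * (signUnit R a : R) = a := by
  rcases le_or_gt 0 a with h | h
  · lift a to ℕ using h
    simp [signUnit]
  · obtain ⟨n, rfl⟩ : ∃ n : ℕ, a = -n := ⟨a.natAbs, by omega⟩
    rw [signUnit, if_neg (by omega)]
    simp

/-- The list of units that arises from a list of pairs `(aₙ, bₙ)` when `Σ (aₙ + bₙ j) ηⁿ` is
written as a sum of units `± ηⁿ` and `± j ηⁿ`. -/
def unitList (η j : (𝓞 K)ˣ) : List (ℤ × ℤ) → List (𝓞 K)ˣ
  | [] => []
  | d :: l => List.replicate d.1.natAbs (signUnit _ d.1) ++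
      (List.replicate d.2.natAbs (signUnit _ d.2 * j) ++ (unitList η j l).map (η * ·))

theorem length_unitList (η j : (𝓞 K)ˣ) (l : List (ℤ × ℤ)) :
    (unitList η j l).length = weight l := by
  induction l with
  | nil => rfl
  | cons d l ih =>
    simp only [unitList, List.length_append, List.length_replicate, List.length_map, ih,
      weight_cons]
    ring

theorem sum_unitList (η j : (𝓞 K)ˣ) (l : List (ℤ × ℤ)) :
    ((unitList η j l).map fun u : (𝓞 K)ˣ => ((u : 𝓞 K) : K)).sum =
      hornerEval ((η : 𝓞 K) : K) (fun d : ℤ × ℤ => (d.1 : K) + d.2 * ((j : 𝓞 K) : K)) l := by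
  induction l with
  | nil => rfl
  | cons d l ih =>
    have h1 := congrArg (algebraMap (𝓞 K) K) (natAbs_mul_signUnit (𝓞 K) d.1)
    have h2 := congrArg (algebraMap (𝓞 K) K) (natAbs_mul_signUnit (𝓞 K) d.2)
    rw [map_mul, map_natCast, map_intCast] at h1 h2
    have h3 : ((unitList η j l).map fun u : (𝓞 K)ˣ => (((η * u : (𝓞 K)ˣ) : 𝓞 K) : K)).sum =
        ((η : 𝓞 K) : K) * ((unitList η j l).map fun u : (𝓞 K)ˣ => ((u : 𝓞 K) : K)).sum := by
      rw [← List.sum_map_mul_left]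
      simp
    rw [hornerEval_cons, ← ih, ← h3, ← h1, ← h2]
    simp only [unitList, List.map_append, List.sum_append, List.map_replicate,
      List.sum_replicate, List.map_map, nsmul_eq_mul, Units.val_mul, map_mul]
    simp only [Function.comp_def, Units.val_mul, map_mul]
    ring

theorem signUnit_pow_four (R : Type*) [CommRing R] (a : ℤ) : signUnit R a ^ 4 = 1 := by
  rw [signUnit]
  split_ifs
  · simp
  · exact Even.neg_one_pow (by decide)

theorem exists_of_mem_unitList {η j : (𝓞 K)ˣ} (hj : j ^ 4 = 1) {l : List (ℤ × ℤ)}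
    {u : (𝓞 K)ˣ} (hu : u ∈ unitList η j l) : ∃ z : (𝓞 K)ˣ, ∃ n : ℕ, z ^ 4 = 1 ∧ u = z * η ^ n := by
  induction l generalizing u with
  | nil => simp [unitList] at hu
  | cons d l ih =>
    simp only [unitList, List.mem_append, List.mem_replicate, List.mem_map] at hu
    rcases hu with ⟨-, rfl⟩ | ⟨-, rfl⟩ | ⟨v, hv, rfl⟩
    · exact ⟨signUnit _ d.1, 0, signUnit_pow_four _ _, by simp⟩
    · exact ⟨signUnit _ d.2 * j, 0, by rw [mul_pow, signUnit_pow_four, hj, one_mul], by simp⟩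
    · obtain ⟨z, n, hz, rfl⟩ := ih hv
      exact ⟨z, n + 1, hz, by rw [pow_succ', mul_left_comm]⟩

variable [CharZero K]

theorem unit_ne_neg_self (u : (𝓞 K)ˣ) : u ≠ -u := by
  intro h
  have h1 := congrArg (fun v : (𝓞 K)ˣ => (v : 𝓞 K)) h
  simp only [Units.val_neg] at h1
  exact u.ne_zero (self_eq_neg.1 h1)

theorem unitList_ne_neg {η j : (𝓞 K)ˣ} (hη : ∀ n : ℕ, 0 < n → η ^ n ≠ 1) (hj : j ^ 4 = 1)
    {l : List (ℤ × ℤ)} (hl : ∀ d ∈ l, d.2 ≠ 0 → j ^ 2 = -1) :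
    ∀ u ∈ unitList η j l, ∀ v ∈ unitList η j l, u ≠ -v := by
  -- A root of unity of order dividing `4` is not opposite to a unit from a later position.
  have key : ∀ (l' : List (ℤ × ℤ)) (z v : (𝓞 K)ˣ), z ^ 4 = 1 → v ∈ unitList η j l' →
      z ≠ -(η * v) := by
    rintro l' z v hz hv h
    obtain ⟨y, n, hy, rfl⟩ := exists_of_mem_unitList hj hv
    refine hη ((n + 1) * 4) (by omega) ?_
    have h1 := congrArg (· ^ 4) h
    simp only [hz, Even.neg_pow (show Even 4 by decide), mul_pow, hy, one_mul] at h1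
    rw [pow_mul, pow_succ' η n, mul_pow, ← h1]
  have sgn : ∀ a : ℤ, signUnit (𝓞 K) a ^ 2 = 1 := fun a => by
    rw [signUnit]
    split_ifs <;> simp
  have key2 : ∀ a b : ℤ, j ^ 2 = -1 → signUnit (𝓞 K) a ≠ -(signUnit (𝓞 K) b * j) := by
    intro a b hj2 h
    have h1 := congrArg (· ^ 2) h
    simp only [sgn a, neg_sq, mul_pow, sgn b, one_mul, hj2] at h1
    exact unit_ne_neg_self 1 h1
  induction l with
  | nil => simp [unitList]
  | cons d l ih =>
    have ih' := ih fun e he => hl e (List.mem_cons_of_mem _ he)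
    have hj2 : d.2.natAbs ≠ 0 → j ^ 2 = -1 := fun h =>
      hl d (List.mem_cons_self ..) (by simpa using h)
    have hz : (signUnit (𝓞 K) d.2 * j) ^ 4 = 1 := by rw [mul_pow, signUnit_pow_four, hj, one_mul]
    intro u hu v hv
    simp only [unitList, List.mem_append, List.mem_replicate, List.mem_map] at hu hv
    rcases hu with ⟨-, rfl⟩ | ⟨h, rfl⟩ | ⟨u, hu, rfl⟩ <;>
      rcases hv with ⟨-, rfl⟩ | ⟨h', rfl⟩ | ⟨v, hv, rfl⟩
    · exact unit_ne_neg_self _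
    · exact key2 _ _ (hj2 h')
    · exact key _ _ _ (signUnit_pow_four _ _) hv
    · exact fun e => key2 _ _ (hj2 h) (neg_eq_iff_eq_neg.1 e.symm)
    · exact unit_ne_neg_self _
    · exact key _ _ _ hz hv
    · exact fun e => key _ _ _ (signUnit_pow_four _ _) hu (neg_eq_iff_eq_neg.1 e.symm)
    · exact fun e => key _ _ _ hz hu (neg_eq_iff_eq_neg.1 e.symm)
    · intro e
      rw [← mul_neg] at e
      exact ih' u hu v hv (mul_left_cancel e)

theorem ell_le_of_hornerEval {k : ℕ} {η j : (𝓞 K)ˣ} (hη : ∀ n : ℕ, 0 < n → η ^ n ≠ 1)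
    (hj : j ^ 4 = 1) {l : List (ℤ × ℤ)} (hl : ∀ d ∈ l, d.2 ≠ 0 → j ^ 2 = -1)
    (h1 : 0 < weight l) (h2 : weight l ≤ k)
    (h0 : hornerEval ((η : 𝓞 K) : K)
      (fun d : ℤ × ℤ => (d.1 : K) + d.2 * ((j : 𝓞 K) : K)) l = 0) : ell K ≤ k := by
  refine ell_le_of_list (unitList η j l) ?_ ?_ ?_ (unitList_ne_neg hη hj hl)
  · rw [← List.length_pos_iff, length_unitList]
    exact h1
  · rwa [length_unitList]
  · rw [sum_unitList, h0]

/-- A relation `A(η)² + B(η)² = 0` comes either from a relation over `ℤ`, or, when the field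
contains `i`, from a relation over `ℤ[i]`. -/
theorem ell_le_of_sq_add_sq {k : ℕ} {η : (𝓞 K)ˣ} (hη : ∀ n : ℕ, 0 < n → η ^ n ≠ 1)
    {l : List (ℤ × ℤ)} (h1 : 0 < weight l) (h2 : weight l ≤ k)
    (h0 : hornerEval ((η : 𝓞 K) : K) (fun d : ℤ × ℤ => (d.1 : K)) l ^ 2 +
      hornerEval ((η : 𝓞 K) : K) (fun d : ℤ × ℤ => (d.2 : K)) l ^ 2 = 0) : ell K ≤ k := by
  set A := hornerEval ((η : 𝓞 K) : K) (fun d : ℤ × ℤ => (d.1 : K)) l with hA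
  set B := hornerEval ((η : 𝓞 K) : K) (fun d : ℤ × ℤ => (d.2 : K)) l with hB
  by_cases hB0 : B = 0
  · have hA0 : A = 0 := by simpa [hB0] using h0
    have hmap : ∀ g : ℤ × ℤ → ℤ, hornerEval ((η : 𝓞 K) : K) (fun d : ℤ × ℤ => (d.1 : K) +
        d.2 * (((1 : (𝓞 K)ˣ) : 𝓞 K) : K)) (l.map fun d => (g d, 0)) =
        hornerEval ((η : 𝓞 K) : K) (fun d : ℤ × ℤ => (g d : K)) l := by
      intro g
      simp [hornerEval, List.foldr_map]
    have hw : weight l = weight (l.map fun d => (d.1, (0 : ℤ))) +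
        weight (l.map fun d => (d.2, (0 : ℤ))) := by
      clear_value A B
      clear hA hB h1 h2 hmap
      induction l with
      | nil => rfl
      | cons d l ih =>
        simp only [List.map_cons, weight_cons, ih, Int.natAbs_zero]
        ring
    rcases Nat.eq_zero_or_pos (weight (l.map fun d => (d.1, (0 : ℤ)))) with hw1 | hw1
    · refine ell_le_of_hornerEval hη (j := 1) (one_pow _) (l := l.map fun d => (d.2, (0 : ℤ)))
        (fun d hd hd' => absurd (List.mem_map.1 hd) (by rintro ⟨e, -, rfl⟩; exact hd' rfl))
        (by omega) (by omega) ?_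
      rw [hmap fun d => d.2, ← hB, hB0]
    · refine ell_le_of_hornerEval hη (j := 1) (one_pow _) (l := l.map fun d => (d.1, (0 : ℤ)))
        (fun d hd hd' => absurd (List.mem_map.1 hd) (by rintro ⟨e, -, rfl⟩; exact hd' rfl))
        (by omega) (by omega) ?_
      rw [hmap fun d => d.1, ← hA, hA0]
  · have hi : (-A / B) ^ 2 = -1 := by
      field_simp
      linear_combination h0
    have hint : IsIntegral ℤ (-A / B) :=
      IsIntegral.of_pow (n := 2) (by norm_num) (by rw [hi]; exact isIntegral_one.neg)
    let i : 𝓞 K := ⟨-A / B, hint⟩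
    have hii : i * i = -1 := by
      apply FaithfulSMul.algebraMap_injective (𝓞 K) K
      rw [map_mul, map_neg, map_one, ← hi, sq]
      rfl
    let j : (𝓞 K)ˣ := ⟨i, -i, by rw [mul_neg, hii, neg_neg], by rw [neg_mul, hii, neg_neg]⟩
    have hj2 : j ^ 2 = -1 := Units.ext (by rw [sq]; exact hii)
    refine ell_le_of_hornerEval hη (j := j) ?_ (l := l) (fun _ _ _ => hj2) h1 h2 ?_
    · rw [show 4 = 2 * 2 from rfl, pow_mul, hj2, neg_one_sq]
    · rw [hornerEval_add_mul, ← hA, ← hB]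
      change A + B * (-A / B) = 0
      field_simp
      ring

end UnitSums

/-! ### From vanishing sums of units to relations -/

section Extraction

variable {K : Type*} [Field K]

theorem hornerEval_map_range (η : K) {ι : Type*} (w : ι → K) (g : ℕ → ι) (M : ℕ) :
    hornerEval η w ((List.range M).map g) = ∑ n ∈ Finset.range M, w (g n) * η ^ n := by
  induction M with
  | zero => simp
  | succ M ih =>
    rw [List.range_succ, List.map_append, hornerEval_append, ih, Finset.sum_range_succ]
    simp [mul_comm]

theorem weight_map_range (g : ℕ → ℤ × ℤ) (M : ℕ) :
    weight ((List.range M).map g) =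
      ∑ n ∈ Finset.range M, ((g n).1.natAbs + (g n).2.natAbs) := by
  induction M with
  | zero => simp
  | succ M ih =>
    rw [List.range_succ, List.map_append, weight_append, ih, Finset.sum_range_succ]
    simp

theorem eq_neg_of_dot_neg {d e : ℤ × ℤ} (hd : d.1.natAbs + d.2.natAbs = 1)
    (he : e.1.natAbs + e.2.natAbs = 1) (h : d.1 * e.1 + d.2 * e.2 < 0) : e = -d := by
  obtain ⟨a, b⟩ := d
  obtain ⟨x, y⟩ := e
  simp only at hd he h
  have h1 : -1 ≤ a ∧ a ≤ 1 := by omega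
  have h2 : -1 ≤ x ∧ x ≤ 1 := by omega
  obtain ⟨h1, h1'⟩ := h1
  obtain ⟨h2, h2'⟩ := h2
  have hb : b = 0 ∨ b = 1 ∨ b = -1 := by omega
  have hy : y = 0 ∨ y = 1 ∨ y = -1 := by omega
  rw [Prod.neg_mk, Prod.mk.injEq]
  rcases hb with rfl | rfl | rfl <;> rcases hy with rfl | rfl | rfl <;> interval_cases a <;>
    interval_cases x <;> simp_all

theorem exists_opposite_of_sum_eq_zero {ι : Type*} {δ : ι → ℤ × ℤ}
    (hδ : ∀ i, (δ i).1.natAbs + (δ i).2.natAbs = 1) {s : Finset ι} (hs : s.Nonempty)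
    (h0 : ∑ i ∈ s, δ i = 0) : ∃ a b, (a ≠ b ∧ a ∈ s ∧ b ∈ s) ∧ δ b = -δ a := by
  obtain ⟨a, ha⟩ := hs
  -- Some vector of the sum has negative scalar product with `δ a`.
  have hdot : ∑ i ∈ s, -((δ a).1 * (δ i).1 + (δ a).2 * (δ i).2) = 0 := by
    simp only [Prod.ext_iff, Prod.fst_sum, Prod.snd_sum, Prod.fst_zero, Prod.snd_zero] at h0
    rw [Finset.sum_neg_distrib, Finset.sum_add_distrib, ← Finset.mul_sum, ← Finset.mul_sum,
      h0.1, h0.2]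
    simp
  have h00 : -((δ a).1 * (δ a).1 + (δ a).2 * (δ a).2) ≠ 0 := by
    have := hδ a
    intro h
    have h1 : (δ a).1 = 0 := by nlinarith [mul_self_nonneg (δ a).1, mul_self_nonneg (δ a).2]
    have h2 : (δ a).2 = 0 := by nlinarith [mul_self_nonneg (δ a).1, mul_self_nonneg (δ a).2]
    rw [h1, h2] at this
    simp at this
  obtain ⟨b, hb, hpos⟩ := Finset.exists_pos_of_sum_zero_of_exists_nonzero _ hdot ⟨a, ha, h00⟩
  refine ⟨a, b, ⟨?_, ha, hb⟩, eq_neg_of_dot_neg (hδ a) (hδ b) (by linarith)⟩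
  rintro rfl
  nlinarith [mul_self_nonneg (δ a).1, mul_self_nonneg (δ a).2]

/-- The roots of unity of order dividing `4` are the numbers `±1` and `±j`, for a suitable `j`
which is a square root of `-1`, or `0` if there is no such root. -/
theorem exists_digits_of_pow_four_eq_one {m : ℕ} (ζ : Fin m → (𝓞 K)ˣ) (hζ : ∀ i, ζ i ^ 4 = 1) :
    ∃ (j : 𝓞 K) (δ : Fin m → ℤ × ℤ), (j ^ 2 = -1 ∨ j = 0 ∧ ∀ i, (δ i).2 = 0) ∧
      (∀ i, (δ i).1.natAbs + (δ i).2.natAbs = 1) ∧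
      ∀ i, (ζ i : 𝓞 K) = (δ i).1 + (δ i).2 * j := by
  have hsq : ∀ i, (ζ i : 𝓞 K) = 1 ∨ (ζ i : 𝓞 K) = -1 ∨ (ζ i : 𝓞 K) ^ 2 = -1 := by
    intro i
    have h1 : (ζ i : 𝓞 K) ^ 4 = 1 := by
      rw [← Units.val_pow_eq_pow_val, hζ, Units.val_one]
    have h2 : ((ζ i : 𝓞 K) - 1) * (((ζ i : 𝓞 K) + 1) * ((ζ i : 𝓞 K) ^ 2 + 1)) = 0 := by
      linear_combination h1
    rcases mul_eq_zero.1 h2 with h | h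
    · exact Or.inl (sub_eq_zero.1 h)
    · rcases mul_eq_zero.1 h with h | h
      · exact Or.inr (Or.inl (eq_neg_of_add_eq_zero_left h))
      · exact Or.inr (Or.inr (eq_neg_of_add_eq_zero_left h))
  by_cases hex : ∃ j : 𝓞 K, j ^ 2 = -1
  · obtain ⟨j, hj⟩ := hex
    have hδ : ∀ i, ∃ d : ℤ × ℤ, d.1.natAbs + d.2.natAbs = 1 ∧ (ζ i : 𝓞 K) = d.1 + d.2 * j := by
      intro i
      rcases hsq i with h | h | h
      · exact ⟨(1, 0), rfl, by simp [h]⟩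
      · exact ⟨(-1, 0), rfl, by simp [h]⟩
      · have h2 : ((ζ i : 𝓞 K) - j) * ((ζ i : 𝓞 K) + j) = 0 := by linear_combination h - hj
        rcases mul_eq_zero.1 h2 with h | h
        · exact ⟨(0, 1), rfl, by simp [sub_eq_zero.1 h]⟩
        · exact ⟨(0, -1), rfl, by simp [eq_neg_of_add_eq_zero_left h]⟩
    choose δ hδ1 hδ2 using hδ
    exact ⟨j, δ, Or.inl hj, hδ1, hδ2⟩
  · have hδ : ∀ i, ∃ d : ℤ × ℤ, d.2 = 0 ∧ d.1.natAbs + d.2.natAbs = 1 ∧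
        (ζ i : 𝓞 K) = d.1 + d.2 * 0 := by
      intro i
      rcases hsq i with h | h | h
      · exact ⟨(1, 0), rfl, rfl, by simp [h]⟩
      · exact ⟨(-1, 0), rfl, rfl, by simp [h]⟩
      · exact absurd ⟨_, h⟩ hex
    choose δ hδ0 hδ1 hδ2 using hδ
    exact ⟨0, δ, Or.inr ⟨rfl, hδ0⟩, hδ1, hδ2⟩

/-- A list of pairs `(aₙ, bₙ)`, not all zero, with `Σ (|aₙ| + |bₙ|) ≤ k` and
`Σ (aₙ + bₙ j) ηⁿ = 0`. When `j` is not a square root of `-1` it is `0`, and so are the `bₙ`. -/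
structure IsRelation (k : ℕ) (η j : 𝓞 K) (l : List (ℤ × ℤ)) : Prop where
  sq : j ^ 2 = -1 ∨ j = 0 ∧ ∀ d ∈ l, d.2 = 0
  weight_pos : 0 < weight l
  weight_le : weight l ≤ k
  eval_eq : hornerEval (η : K) (fun d : ℤ × ℤ => (d.1 : K) + d.2 * (j : K)) l = 0

theorem IsRelation.sq_add_sq {k : ℕ} {η j : 𝓞 K} {l : List (ℤ × ℤ)} (h : IsRelation k η j l) :
    hornerEval (η : K) (fun d => (d.1 : K)) l ^ 2 +
      hornerEval (η : K) (fun d => (d.2 : K)) l ^ 2 = 0 := by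
  have h0 := h.eval_eq
  rw [hornerEval_add_mul] at h0
  rcases h.sq with hj | ⟨hj, hl⟩
  · have hj' : (j : K) ^ 2 = -1 := by
      have := congrArg (algebraMap (𝓞 K) K) hj
      simpa using this
    have : hornerEval (η : K) (fun d => (d.1 : K)) l =
        -(hornerEval (η : K) (fun d => (d.2 : K)) l * j) := eq_neg_of_add_eq_zero_left h0
    rw [this, neg_sq, mul_pow, hj']
    ring
  · have hB : hornerEval (η : K) (fun d : ℤ × ℤ => (d.2 : K)) l = 0 := by
      clear h0 h
      induction l with
      | nil => rfl
      | cons d l ih =>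
        rw [hornerEval_cons, ih fun e he => hl e (List.mem_cons_of_mem _ he),
          hl d (List.mem_cons_self ..)]
        simp
    rw [hB, zero_mul, add_zero] at h0
    rw [hB, h0]
    ring

/-- Collecting equal powers of `η` turns a nondegenerate vanishing sum of units `ζ ηⁿ` with
`ζ⁴ = 1` into a nontrivial relation: terms that cancel each other would form a vanishing
subsum of two terms. -/
theorem HasNondegenerateUnitSum.exists_isRelation {m k : ℕ} (h3 : 3 ≤ m) (hmk : m ≤ k)
    (h : HasNondegenerateUnitSum K m) {η : (𝓞 K)ˣ}
    (hη : ∀ u : (𝓞 K)ˣ, ∃ ζ : (𝓞 K)ˣ, ∃ n : ℤ, ζ ^ 4 = 1 ∧ u = ζ * η ^ n) :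
    ∃ (j : 𝓞 K) (l : List (ℤ × ℤ)), IsRelation k (η : 𝓞 K) j l := by
  classical
  obtain ⟨ε, hε, hnd⟩ := h
  choose ζ e hζ hεe using fun i => hη (ε i)
  obtain ⟨j, δ, hj, hδ, hζδ⟩ := exists_digits_of_pow_four_eq_one ζ hζ
  -- Multiplication by a power of `η` makes all exponents nonnegative.
  obtain ⟨N, hN⟩ : ∃ N : ℕ, ∀ i, 0 ≤ e i + N := by
    refine ⟨∑ i, (e i).natAbs, fun i => ?_⟩
    have := Finset.single_le_sum (f := fun i => (e i).natAbs) (fun _ _ => Nat.zero_le _)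
      (Finset.mem_univ i)
    omega
  set n : Fin m → ℕ := fun i => (e i + N).toNat with hn
  have hεn : ∀ i, η ^ N * ε i = ζ i * η ^ n i := by
    intro i
    rw [hεe, ← zpow_natCast η (n i), ← zpow_natCast η N, hn]
    simp only
    rw [Int.toNat_of_nonneg (hN i), add_comm (e i), zpow_add, mul_left_comm]
  obtain ⟨M, hM⟩ : ∃ M : ℕ, ∀ i, n i < M := by
    refine ⟨∑ i, n i + 1, fun i => Nat.lt_succ_of_le ?_⟩
    exact Finset.single_le_sum (f := n) (fun _ _ => Nat.zero_le _) (Finset.mem_univ i)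
  set g : ℕ → ℤ × ℤ := fun r => ∑ i with n i = r, δ i with hg
  have hmaps : ∀ i ∈ (Finset.univ : Finset (Fin m)), n i ∈ Finset.range M := fun i _ =>
    Finset.mem_range.2 (hM i)
  have habs : ∀ (s : Finset (Fin m)),
      (∑ i ∈ s, δ i).1.natAbs + (∑ i ∈ s, δ i).2.natAbs ≤ s.card := by
    intro s
    rw [Prod.fst_sum, Prod.snd_sum]
    have h1 : (∑ i ∈ s, (δ i).1).natAbs ≤ ∑ i ∈ s, (δ i).1.natAbs :=
      Finset.le_sum_of_subadditive Int.natAbs le_rfl Int.natAbs_add_le s _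
    have h2 : (∑ i ∈ s, (δ i).2).natAbs ≤ ∑ i ∈ s, (δ i).2.natAbs :=
      Finset.le_sum_of_subadditive Int.natAbs le_rfl Int.natAbs_add_le s _
    have h4 : ∑ i ∈ s, ((δ i).1.natAbs + (δ i).2.natAbs) = s.card := by simp [hδ]
    rw [Finset.sum_add_distrib] at h4
    omega
  refine ⟨j, (List.range M).map g, ?_, ?_, ?_, ?_⟩
  · refine hj.imp_right fun ⟨h0, hδ0⟩ => ⟨h0, fun d hd => ?_⟩
    obtain ⟨r, -, rfl⟩ := List.mem_map.1 hd
    simp only [hg, Prod.snd_sum]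
    exact Finset.sum_eq_zero fun i _ => hδ0 i
  · by_contra hw
    have i₀ : Fin m := ⟨0, by omega⟩
    have hg0 : g (n i₀) = (0, 0) := eq_zero_of_weight_eq_zero (Nat.eq_zero_of_not_pos hw)
      (List.mem_map_of_mem (List.mem_range.2 (hM i₀)))
    obtain ⟨i₁, i₂, ⟨hne, hi₁, hi₂⟩, hneg⟩ := exists_opposite_of_sum_eq_zero hδ
      (s := Finset.univ.filter fun i => n i = n i₀) ⟨i₀, by simp⟩ hg0
    have hn₁ : n i₁ = n i₀ := (Finset.mem_filter.1 hi₁).2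
    have hn₂ : n i₂ = n i₀ := (Finset.mem_filter.1 hi₂).2
    refine hnd {i₁, i₂} (by simp) (fun hu => ?_) ?_
    · have := congrArg Finset.card hu
      rw [Finset.card_pair hne] at this
      simp at this
      omega
    · rw [Finset.sum_pair hne]
      have h1 := congrArg (fun u : (𝓞 K)ˣ => (u : 𝓞 K)) (hεn i₁)
      have h2 := congrArg (fun u : (𝓞 K)ˣ => (u : 𝓞 K)) (hεn i₂)
      simp only [Units.val_mul, hζδ, hn₁, hn₂, hneg, Prod.fst_neg, Prod.snd_neg] at h1 h2
      rw [Int.cast_neg, Int.cast_neg] at h2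
      have h4 : ((η ^ N : (𝓞 K)ˣ) : 𝓞 K) * (ε i₁ + ε i₂ : 𝓞 K) = 0 := by
        linear_combination h1 + h2
      exact (mul_eq_zero.1 h4).resolve_left (Units.ne_zero _)
  · rw [weight_map_range]
    calc ∑ r ∈ Finset.range M, ((g r).1.natAbs + (g r).2.natAbs)
        ≤ ∑ r ∈ Finset.range M, (Finset.univ.filter fun i => n i = r).card :=
          Finset.sum_le_sum fun r _ => habs _
      _ = (Finset.univ : Finset (Fin m)).card := (Finset.card_eq_sum_card_fiberwise hmaps).symm
      _ ≤ k := by simpa using hmk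
  · rw [hornerEval_map_range]
    have h1 : ∀ r ∈ Finset.range M,
        (((g r).1 : K) + (g r).2 * (j : K)) * ((η : 𝓞 K) : K) ^ r =
          ∑ i with n i = r, ((((η ^ N : (𝓞 K)ˣ) : 𝓞 K) * (ε i : 𝓞 K) : 𝓞 K) : K) := by
      intro r _
      have h2 : ((g r).1 : K) + (g r).2 * (j : K) = ∑ i with n i = r, ((ζ i : 𝓞 K) : K) := by
        simp only [hg, Prod.fst_sum, Prod.snd_sum, hζδ]
        push_cast
        rw [Finset.sum_mul, ← Finset.sum_add_distrib]
        refine Finset.sum_congr rfl fun i _ => ?_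
        simp
      rw [h2, Finset.sum_mul]
      refine Finset.sum_congr rfl fun i hi => ?_
      have h3 := congrArg (fun u : (𝓞 K)ˣ => (u : 𝓞 K)) (hεn i)
      simp only [Units.val_mul, (Finset.mem_filter.1 hi).2] at h3
      rw [h3, Units.val_pow_eq_pow_val]
      push_cast
      rfl
    rw [Finset.sum_congr rfl h1, Finset.sum_fiberwise_of_maps_to hmaps, ← map_sum,
      ← Finset.mul_sum, hε, mul_zero, map_zero]

end Extraction

/-! ### Bounds for relations -/

section Bounds

theorem norm_hornerEval_le {ι : Type*} {z : ℂ} (hz : ‖z‖ ≤ 1) {w : ι → ℂ} {c : ι → ℕ}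
    (hw : ∀ d, ‖w d‖ ≤ c d) (l : List ι) : ‖hornerEval z w l‖ ≤ (l.map c).sum := by
  induction l with
  | nil => simp
  | cons d l ih =>
    rw [hornerEval_cons, List.map_cons, List.sum_cons, Nat.cast_add]
    refine (norm_add_le _ _).trans (add_le_add (hw d) ?_)
    rw [norm_mul]
    exact (mul_le_of_le_one_left (norm_nonneg _) hz).trans ih

theorem norm_hornerEval_le_mul_pow {ι : Type*} {z : ℂ} (hz : 1 ≤ ‖z‖) {w : ι → ℂ} {c : ι → ℕ}
    (hw : ∀ d, ‖w d‖ ≤ c d) (l : List ι) :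
    ‖hornerEval z w l‖ ≤ (l.map c).sum * ‖z‖ ^ l.length := by
  induction l with
  | nil => simp
  | cons d l ih =>
    rw [hornerEval_cons, List.map_cons, List.sum_cons, List.length_cons, Nat.cast_add, add_mul]
    refine (norm_add_le _ _).trans (add_le_add ?_ ?_)
    · exact (hw d).trans (le_mul_of_one_le_right (Nat.cast_nonneg _) (one_le_pow₀ hz))
    · rw [norm_mul]
      calc ‖z‖ * ‖hornerEval z w l‖ ≤ ‖z‖ * ((l.map c).sum * ‖z‖ ^ l.length) := by gcongr
        _ = _ := by ring

/-- Cauchy's bound for the roots: for large `z` the leading coefficient dominates. -/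
theorem one_le_norm_hornerEval {k : ℕ} {z : ℂ} (hz : (k : ℝ) + 1 ≤ ‖z‖) {w : ℤ × ℤ → ℂ}
    (hw : ∀ d, ‖w d‖ ≤ (d.1.natAbs + d.2.natAbs : ℕ)) {l : List (ℤ × ℤ)}
    (hl : ∀ d ∈ l, d ≠ (0, 0) → 1 ≤ ‖w d‖) (h1 : 0 < weight l) (h2 : weight l ≤ k) :
    1 ≤ ‖hornerEval z w l‖ := by
  induction l with
  | nil => simp at h1
  | cons d l ih =>
    rw [weight_cons] at h1 h2
    rw [hornerEval_cons]
    rcases Nat.eq_zero_or_pos (weight l) with h0 | h0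
    · have hw0 : w (0, 0) = 0 := by simpa using hw (0, 0)
      rw [hornerEval_eq_zero_of_weight h0 z hw0, mul_zero, add_zero]
      refine hl d (List.mem_cons_self ..) ?_
      rintro rfl
      simp [h0] at h1
    · have h3 := ih (fun e he => hl e (List.mem_cons_of_mem _ he)) h0 (by omega)
      have h4 : ‖w d‖ ≤ k := (hw d).trans (by exact_mod_cast (by omega))
      have h5 : ‖z‖ * 1 ≤ ‖z‖ * ‖hornerEval z w l‖ := by gcongr
      have h6 := norm_sub_norm_le (z * hornerEval z w l) (-w d)
      rw [norm_mul, norm_neg, sub_neg_eq_add, add_comm (z * _)] at h6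
      linarith

theorem norm_int_add_mul_le {j : ℂ} (hj : ‖j‖ ≤ 1) (d : ℤ × ℤ) :
    ‖(d.1 : ℂ) + d.2 * j‖ ≤ (d.1.natAbs + d.2.natAbs : ℕ) := by
  refine (norm_add_le _ _).trans ?_
  rw [norm_mul, Complex.norm_intCast, Complex.norm_intCast]
  push_cast
  rw [Nat.cast_natAbs, Nat.cast_natAbs]
  push_cast
  gcongr
  exact mul_le_of_le_one_right (abs_nonneg _) hj

theorem eq_I_or_eq_neg_I {j : ℂ} (hj : j ^ 2 = -1) : j = Complex.I ∨ j = -Complex.I := by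
  rw [← sq_eq_sq_iff_eq_or_eq_neg, hj, Complex.I_sq]

theorem norm_le_one_of_sq {j : ℂ} (hj : j ^ 2 = -1 ∨ j = 0) : ‖j‖ ≤ 1 := by
  rcases hj with hj | rfl
  · rcases eq_I_or_eq_neg_I hj with rfl | rfl <;> simp
  · simp

theorem one_le_norm_int_add_mul {j : ℂ} {d : ℤ × ℤ} (hj : j ^ 2 = -1 ∨ j = 0 ∧ d.2 = 0)
    (hd : d ≠ (0, 0)) : 1 ≤ ‖(d.1 : ℂ) + d.2 * j‖ := by
  have key : ∀ a b : ℤ, (a, b) ≠ (0, 0) → 1 ≤ ‖(a : ℂ) + b * Complex.I‖ := by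
    intro a b hab
    rw [← one_le_sq_iff₀ (norm_nonneg _), ← Complex.normSq_eq_norm_sq]
    have : Complex.normSq ((a : ℂ) + b * Complex.I) = ((a * a + b * b : ℤ) : ℝ) := by
      simp [Complex.normSq_apply]
    rw [this]
    have h1 : (1 : ℤ) ≤ a * a + b * b := by
      by_contra hlt
      have ha : a = 0 := by nlinarith [mul_self_nonneg a, mul_self_nonneg b]
      have hb : b = 0 := by nlinarith [mul_self_nonneg a, mul_self_nonneg b]
      exact hab (by rw [ha, hb])
    exact_mod_cast h1
  obtain ⟨a, b⟩ := d
  rcases hj with hj | ⟨rfl, hb⟩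
  · rcases eq_I_or_eq_neg_I hj with rfl | rfl
    · exact key a b hd
    · have := key a (-b) (by simpa using hd)
      simpa using this
  · simp only at hb
    subst hb
    simpa using key a 0 hd

variable {K : Type*} [Field K] {k : ℕ} {η j : 𝓞 K} {l : List (ℤ × ℤ)}

theorem IsRelation.map_sq (h : IsRelation k η j l) (φ : K →+* ℂ) :
    φ j ^ 2 = -1 ∨ φ j = 0 ∧ ∀ d ∈ l, d.2 = 0 := by
  refine h.sq.imp (fun hj => ?_) fun ⟨hj, hl⟩ => ⟨by simp [hj], hl⟩
  have := congrArg (fun x : 𝓞 K => φ x) hj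
  simpa using this

theorem IsRelation.map_eval_eq (φ : K →+* ℂ) (l : List (ℤ × ℤ)) :
    φ (hornerEval (η : K) (fun d : ℤ × ℤ => (d.1 : K) + d.2 * (j : K)) l) =
      hornerEval (φ η) (fun d : ℤ × ℤ => (d.1 : ℂ) + d.2 * φ j) l := by
  rw [map_hornerEval]
  simp

theorem IsRelation.norm_lt (h : IsRelation k η j l) (φ : K →+* ℂ) : ‖φ η‖ < k + 1 := by
  by_contra hlt
  have h1 := one_le_norm_hornerEval (not_lt.1 hlt)
    (w := fun d : ℤ × ℤ => (d.1 : ℂ) + d.2 * φ j)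
    (norm_int_add_mul_le (norm_le_one_of_sq ((h.map_sq φ).imp_right And.left))) (l := l)
    (fun d hd => one_le_norm_int_add_mul ((h.map_sq φ).imp_right fun h' => ⟨h'.1, h'.2 d hd⟩))
    h.weight_pos h.weight_le
  rw [← IsRelation.map_eval_eq, h.eval_eq, map_zero, norm_zero] at h1
  linarith

/-- The partial values of the Horner evaluation of a relation have all conjugates bounded: up to
the factor `ηᵗ`, such a value is a sum of few units `± ηⁿ`, `± j ηⁿ` with `n ≥ t`, and its negative
is one with `n < t`. -/
theorem IsRelation.norm_drop_le (h : IsRelation k η j l) (φ : K →+* ℂ) (t : ℕ) :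
    ‖φ (hornerEval (η : K) (fun d : ℤ × ℤ => (d.1 : K) + d.2 * (j : K)) (l.drop t))‖ ≤ k := by
  have hw := norm_int_add_mul_le (norm_le_one_of_sq ((h.map_sq φ).imp_right And.left))
  have hsum : weight (l.take t) + weight (l.drop t) = weight l := by
    rw [← weight_append, List.take_append_drop]
  have hk := h.weight_le
  rw [IsRelation.map_eval_eq]
  rcases le_or_gt ‖φ η‖ 1 with hz | hz
  · refine (norm_hornerEval_le hz hw _).trans ?_
    have : weight (l.drop t) ≤ k := by omega
    exact_mod_cast this
  · have h0 := congrArg φ h.eval_eq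
    rw [IsRelation.map_eval_eq, map_zero, ← List.take_append_drop t l, hornerEval_append] at h0
    have h1 := norm_hornerEval_le_mul_pow hz.le hw (l.take t)
    have h2 := congrArg norm (eq_neg_of_add_eq_zero_left h0)
    rw [norm_neg, norm_mul, norm_pow] at h2
    rw [h2, mul_comm] at h1
    refine (le_of_mul_le_mul_right h1 (by positivity)).trans ?_
    have : weight (l.take t) ≤ k := by omega
    exact_mod_cast this

variable [NumberField K]

theorem eq_of_norm_sub_lt_one {x y : 𝓞 K} (h : ∀ φ : K →+* ℂ, ‖φ x - φ y‖ < 1) : x = y := by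
  by_contra hne
  obtain ⟨w⟩ : Nonempty (NumberField.InfinitePlace K) := inferInstance
  have hlt : ∀ z : NumberField.InfinitePlace K, z ((x - y : 𝓞 K) : K) < 1 := by
    intro z
    rw [← NumberField.InfinitePlace.norm_embedding_eq]
    have h1 : ((x - y : 𝓞 K) : K) = (x : K) - (y : K) := map_sub (algebraMap (𝓞 K) K) x y
    rw [h1, map_sub]
    exact h _
  have := NumberField.InfinitePlace.one_le_of_lt_one (w := w) (sub_ne_zero.2 hne)
    fun z _ => hlt z
  exact absurd (hlt w) (not_lt.2 this)

/-- Two of sufficiently many algebraic integers with bounded conjugates are equal, because the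
approximate positions of the conjugates coincide for two of them. -/
theorem exists_eq_of_norm_le {n : ℕ} (hd : Module.finrank ℚ K ≤ 4) (hn : lengthBound k < n)
    (v : ℕ → 𝓞 K) (hv : ∀ t < n, ∀ φ : K →+* ℂ, ‖φ (v t)‖ ≤ k) :
    ∃ s t, s < t ∧ t < n ∧ v s = v t := by
  classical
  let B : Finset (ℤ × ℤ) := Finset.Icc (-2 * k : ℤ) (2 * k) ×ˢ Finset.Icc (-2 * k : ℤ) (2 * k)
  let T : Finset ((K →+* ℂ) → ℤ × ℤ) := Fintype.piFinset fun _ => B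
  let f : ℕ → (K →+* ℂ) → ℤ × ℤ := fun t φ => (⌊2 * (φ (v t)).re⌋, ⌊2 * (φ (v t)).im⌋)
  have hB : B.card = (4 * k + 1) ^ 2 := by
    rw [Finset.card_product, Int.card_Icc, sq]
    congr 1 <;> omega
  have hT : T.card ≤ lengthBound k := by
    rw [Fintype.card_piFinset]
    simp only [hB, Finset.prod_const, Finset.card_univ, NumberField.Embeddings.card K ℂ]
    exact Nat.pow_le_pow_right (by positivity) hd
  have hmaps : Set.MapsTo f (Finset.range n) T := by
    intro t ht
    have ht' : t < n := by simpa using ht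
    refine Finset.mem_coe.2 (Fintype.mem_piFinset.2 fun φ => ?_)
    have h1 := abs_le.1 ((Complex.abs_re_le_norm _).trans (hv t ht' φ))
    have h2 := abs_le.1 ((Complex.abs_im_le_norm _).trans (hv t ht' φ))
    simp only [B, f, Finset.mem_product, Finset.mem_Icc, Int.le_floor]
    refine ⟨⟨?_, ?_⟩, ?_, ?_⟩
    · push_cast
      linarith [h1.1]
    · have : (⌊2 * (φ (v t)).re⌋ : ℝ) ≤ ((2 * k : ℤ) : ℝ) := by
        refine (Int.floor_le _).trans ?_
        push_cast
        linarith [h1.2]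
      exact_mod_cast this
    · push_cast
      linarith [h2.1]
    · have : (⌊2 * (φ (v t)).im⌋ : ℝ) ≤ ((2 * k : ℤ) : ℝ) := by
        refine (Int.floor_le _).trans ?_
        push_cast
        linarith [h2.2]
      exact_mod_cast this
  have heq : ∀ s t, f s = f t → v s = v t := by
    intro s t hst
    refine eq_of_norm_sub_lt_one fun φ => ?_
    have h1 := congrFun hst φ
    simp only [f, Prod.mk.injEq] at h1
    have h2 := Int.abs_sub_lt_one_of_floor_eq_floor h1.1
    have h3 := Int.abs_sub_lt_one_of_floor_eq_floor h1.2
    rw [← mul_sub, abs_mul, abs_two] at h2 h3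
    refine (Complex.norm_le_abs_re_add_abs_im _).trans_lt ?_
    rw [Complex.sub_re, Complex.sub_im]
    linarith
  obtain ⟨s, hs, t, ht, hne, hst⟩ := Finset.exists_ne_map_eq_of_card_lt_of_maps_to
    (s := Finset.range n) (t := T) (by rw [Finset.card_range]; omega) hmaps
  rw [Finset.mem_range] at hs ht
  rcases lt_or_gt_of_ne hne with h | h
  · exact ⟨s, t, h, ht, heq s t hst⟩
  · exact ⟨t, s, h, hs, (heq s t hst).symm⟩

/-- When two partial values of the Horner evaluation agree, the digits in between can be removed.
Hence the shortest relation is short. -/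
theorem IsRelation.exists_length_le (h : IsRelation k η j l) (hd : Module.finrank ℚ K ≤ 4) :
    ∃ l', IsRelation k η j l' ∧ l'.length ≤ lengthBound k := by
  classical
  have hex : ∃ n, ∃ l', IsRelation k η j l' ∧ l'.length = n := ⟨_, l, h, rfl⟩
  obtain ⟨l', hl', hlen⟩ := Nat.find_spec hex
  have hmin : ∀ l'', IsRelation k η j l'' → l'.length ≤ l''.length := by
    intro l'' h''
    rw [hlen]
    exact Nat.find_min' hex ⟨l'', h'', rfl⟩
  refine ⟨l', hl', ?_⟩
  by_contra hlong
  rw [not_le] at hlong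
  set w : ℤ × ℤ → K := fun d => (d.1 : K) + d.2 * (j : K) with hw
  have hint : ∀ l'' : List (ℤ × ℤ), IsIntegral ℤ (hornerEval (η : K) w l'') := by
    intro l''
    induction l'' with
    | nil => exact isIntegral_zero
    | cons d l'' ih =>
      exact ((isIntegral_intCast d.1).add ((isIntegral_intCast d.2).mul
        (NumberField.RingOfIntegers.isIntegral_coe j))).add
          ((NumberField.RingOfIntegers.isIntegral_coe η).mul ih)
  obtain ⟨s, t, hst, ht, hv⟩ := exists_eq_of_norm_le hd hlong
    (fun t => ⟨hornerEval (η : K) w (l'.drop t), hint _⟩) fun t _ φ => hl'.norm_drop_le φ t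
  have hv' : hornerEval (η : K) w (l'.drop s) = hornerEval (η : K) w (l'.drop t) :=
    congrArg (fun x : 𝓞 K => (x : K)) hv
  have hsplit : ∀ r, hornerEval (η : K) w (l'.take r) +
      (η : K) ^ (l'.take r).length * hornerEval (η : K) w (l'.drop r) = 0 := by
    intro r
    rw [← hornerEval_append, List.take_append_drop]
    exact hl'.eval_eq
  have hwt : ∀ r, weight (l'.take r) + weight (l'.drop r) = weight l' := fun r => by
    rw [← weight_append, List.take_append_drop]
  have hwle := hl'.weight_le
  have hwpos := hl'.weight_pos
  rcases Nat.eq_zero_or_pos (weight (l'.drop t)) with h0 | h0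
  · -- Vanishing leading coefficients can be dropped.
    have hrel : IsRelation k η j (l'.take t) := by
      refine ⟨hl'.sq.imp_right fun h' => ⟨h'.1, fun d hd => h'.2 d (List.mem_of_mem_take hd)⟩,
        by have := hwt t; omega, by have := hwt t; omega, ?_⟩
      have := hsplit t
      rwa [hornerEval_eq_zero_of_weight h0 _ (by simp [hw]), mul_zero, add_zero] at this
    have := hmin _ hrel
    rw [List.length_take] at this
    omega
  · have hrel : IsRelation k η j (l'.take s ++ l'.drop t) := by
      have hdrop : weight (l'.drop t) ≤ weight (l'.drop s) := by
        have : l'.drop t = (l'.drop s).drop (t - s) := by rw [List.drop_drop]; congr 1; omega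
        have h2 := congrArg weight (List.take_append_drop (t - s) (l'.drop s))
        rw [weight_append, ← this] at h2
        omega
      refine ⟨hl'.sq.imp_right fun h' => ⟨h'.1, fun d hd => h'.2 d
        ((List.mem_append.1 hd).elim List.mem_of_mem_take List.mem_of_mem_drop)⟩, ?_, ?_, ?_⟩
      · rw [weight_append]
        omega
      · rw [weight_append]
        have := hwt s
        omega
      · rw [hornerEval_append]
        change _ + _ * hornerEval (η : K) w _ = 0
        rw [← hv']
        exact hsplit s
    have := hmin _ hrel
    rw [List.length_append, List.length_take, List.length_drop] at this
    omega

end Bounds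

/-! ### Units and roots of unity in the fields of the family -/

section NumberFields

open NumberField Polynomial

variable {K : Type*} [Field K] [NumberField K]

theorem ringHom_ext_of_adjoin_eq_top {x : K} (hx : ℚ⟮x⟯ = ⊤) {φ ψ : K →+* ℂ}
    (h : φ x = ψ x) : φ = ψ := by
  have h1 : φ.toRatAlgHom = ψ.toRatAlgHom :=
    AlgHom.ext_of_adjoin_eq_top (IntermediateField.adjoin_eq_top_iff.1 hx) (by simpa using h)
  ext y
  exact DFunLike.congr_fun h1 y

theorem hasRealQuadraticSubfield_of_real {x : K} (hdeg : (minpoly ℚ x).natDegree = 2)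
    (hx : ∀ φ : K →+* ℂ, star (φ x) = φ x) : HasRealQuadraticSubfield K := by
  have hint : IsIntegral ℚ x := Algebra.IsIntegral.isIntegral x
  refine ⟨ℚ⟮x⟯, by rw [IsQuadraticField, IntermediateField.adjoin.finrank hint, hdeg], ⟨?_⟩⟩
  intro v
  rw [InfinitePlace.isReal_iff, ComplexEmbedding.isReal_iff]
  set ψ := v.embedding
  have h1 : ψ (IntermediateField.AdjoinSimple.gen ℚ x) = ComplexEmbedding.lift K ψ x :=
    (ComplexEmbedding.lift_algebraMap_apply K ψ _).symm
  have h2 : (ComplexEmbedding.conjugate ψ).toRatAlgHom = ψ.toRatAlgHom := by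
    refine IntermediateField.adjoin_algHom_ext ℚ fun y hy => ?_
    rw [Set.mem_singleton_iff] at hy
    subst hy
    change star (ψ (IntermediateField.AdjoinSimple.gen ℚ y)) =
      ψ (IntermediateField.AdjoinSimple.gen ℚ y)
    rw [h1, hx]
  ext y
  exact DFunLike.congr_fun h2 y

theorem exists_generator_of_rank_le_one (h : Units.rank K ≤ 1) :
    ∃ η : (𝓞 K)ˣ, ∀ u : (𝓞 K)ˣ, ∃ ζ ∈ Units.torsion K, ∃ n : ℤ, u = ζ * η ^ n := by
  rcases Nat.eq_zero_or_pos (Units.rank K) with h0 | h0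
  · refine ⟨1, fun u => ?_⟩
    obtain ⟨⟨ζ, e⟩, hu, -⟩ := Units.exist_unique_eq_mul_prod K u
    have : IsEmpty (Fin (Units.rank K)) := by
      rw [h0]
      infer_instance
    exact ⟨ζ, ζ.2, 0, by simpa using hu⟩
  · have : Subsingleton (Fin (Units.rank K)) := Fin.subsingleton_iff_le_one.2 h
    refine ⟨Units.fundSystem K ⟨0, h0⟩, fun u => ?_⟩
    obtain ⟨⟨ζ, e⟩, hu, -⟩ := Units.exist_unique_eq_mul_prod K u
    refine ⟨ζ, ζ.2, e ⟨0, h0⟩, ?_⟩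
    rw [hu, Fintype.prod_subsingleton _ ⟨0, h0⟩]

theorem rank_le_one_of_inFamily (h : InFamily K) : Units.rank K ≤ 1 := by
  have h1 := InfinitePlace.card_add_two_mul_card_eq_rank K
  have h2 := InfinitePlace.card_eq_nrRealPlaces_add_nrComplexPlaces K
  rw [Units.rank, h2]
  rcases h with h | ⟨h, w, hw⟩ | ⟨⟨h, ht⟩, -⟩
  · rw [IsQuadraticField] at h
    omega
  · have : 0 < InfinitePlace.nrComplexPlaces K := by
      classical exact Fintype.card_pos_iff.2 ⟨⟨w, hw⟩⟩
    omega
  · have : InfinitePlace.nrRealPlaces K = 0 := IsTotallyComplex.nrRealPlaces_eq_zero K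
    omega

theorem minpoly_rat_eq_map (η : 𝓞 K) :
    minpoly ℚ (η : K) = (minpoly ℤ (η : K)).map (algebraMap ℤ ℚ) :=
  minpoly.isIntegrallyClosed_eq_field_fractions' ℚ (RingOfIntegers.isIntegral_coe η)

theorem natDegree_minpoly_int (η : 𝓞 K) :
    (minpoly ℤ (η : K)).natDegree = (minpoly ℚ (η : K)).natDegree := by
  rw [minpoly_rat_eq_map, (minpoly.monic (RingOfIntegers.isIntegral_coe η)).natDegree_map]

theorem coeff_zero_minpoly_unit (η : (𝓞 K)ˣ) :
    (minpoly ℤ ((η : 𝓞 K) : K)).coeff 0 = 1 ∨ (minpoly ℤ ((η : 𝓞 K) : K)).coeff 0 = -1 := by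
  set x : K := ((η : 𝓞 K) : K) with hx
  have hint : IsIntegral ℚ x := Algebra.IsIntegral.isIntegral x
  have h1 : |Algebra.norm ℚ x| = 1 := Units.norm K η
  have h2 := Algebra.PowerBasis.norm_gen_eq_coeff_zero_minpoly
    (IntermediateField.adjoin.powerBasis hint)
  rw [IntermediateField.adjoin.powerBasis_gen, IntermediateField.minpoly_gen] at h2
  have h3 : (minpoly ℚ x).coeff 0 = ((minpoly ℤ x).coeff 0 : ℤ) := by
    rw [hx, minpoly_rat_eq_map, coeff_map]
    rfl
  rw [Algebra.norm_eq_norm_adjoin, h2, abs_pow, abs_mul, abs_pow, abs_neg, abs_one,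
    one_pow, one_mul, h3] at h1
  have h4 := (pow_eq_one_iff_of_nonneg (abs_nonneg _) Module.finrank_pos.ne').1 h1
  have h5 : |(minpoly ℤ x).coeff 0| = 1 := by exact_mod_cast h4
  exact (abs_eq zero_le_one).1 h5

theorem eq_one_or_neg_one_of_natDegree_eq_one {η : (𝓞 K)ˣ}
    (h : (minpoly ℚ ((η : 𝓞 K) : K)).natDegree = 1) : η = 1 ∨ η = -1 := by
  have hmon := minpoly.monic (RingOfIntegers.isIntegral_coe (η : 𝓞 K))
  rw [← natDegree_minpoly_int] at h
  obtain ⟨c, hc⟩ := isMonicOfDegree_one_iff.1 ⟨h, hmon⟩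
  have h0 := coeff_zero_minpoly_unit η
  have h1 := minpoly.aeval ℤ ((η : 𝓞 K) : K)
  rw [hc] at h0 h1
  simp only [coeff_add, coeff_X_zero, coeff_C_zero, zero_add] at h0
  have h2 : (((η : 𝓞 K) : K)) = ((-c : ℤ) : K) := by
    simp only [map_add, aeval_X, aeval_C] at h1
    rw [eq_neg_of_add_eq_zero_left h1]
    simp
  have h3 : (η : 𝓞 K) = ((-c : ℤ) : 𝓞 K) := by
    apply FaithfulSMul.algebraMap_injective (𝓞 K) K
    exact h2.trans (by simp)
  rcases h0 with rfl | rfl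
  · exact Or.inr (Units.ext (by rw [h3]; simp))
  · exact Or.inl (Units.ext (by rw [h3]; simp))

theorem exists_int_quadratic {η : (𝓞 K)ˣ} (h : (minpoly ℚ ((η : 𝓞 K) : K)).natDegree = 2) :
    ∃ p q : ℤ, (q = 1 ∨ q = -1) ∧ (η : 𝓞 K) ^ 2 + p * (η : 𝓞 K) + q = 0 := by
  have hmon := minpoly.monic (RingOfIntegers.isIntegral_coe (η : 𝓞 K))
  rw [← natDegree_minpoly_int] at h
  obtain ⟨p, q, hpq⟩ := isMonicOfDegree_two_iff.1 ⟨h, hmon⟩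
  have h0 := coeff_zero_minpoly_unit η
  have h1 := minpoly.aeval ℤ ((η : 𝓞 K) : K)
  rw [hpq] at h0 h1
  refine ⟨p, q, by simpa using h0, ?_⟩
  apply FaithfulSMul.algebraMap_injective (𝓞 K) K
  simpa using h1

theorem star_eq_self_of_sq {z : ℂ} {D : ℝ} (hD : 0 ≤ D) (h : z ^ 2 = D) : star z = z := by
  have h1 := congrArg Complex.re h
  have h2 := congrArg Complex.im h
  simp only [sq, Complex.mul_re, Complex.mul_im, Complex.ofReal_re, Complex.ofReal_im] at h1 h2
  have h3 : z.im = 0 := by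
    by_contra hne
    have h4 : z.re = 0 := by
      have : z.re * z.im = 0 := by linarith
      exact (mul_eq_zero.1 this).resolve_right hne
    rw [h4] at h1
    have := mul_self_pos.2 hne
    linarith
  exact Complex.conj_eq_iff_im.2 h3

theorem isPrimitiveRoot_three {F : Type*} [Field F] [CharZero F] {x : F}
    (h : x ^ 2 + x + 1 = 0) : IsPrimitiveRoot x 3 := by
  have hx1 : x ≠ 1 := by
    rintro rfl
    norm_num at h
  have h3 : x ^ 3 = 1 := by linear_combination (x - 1) * h
  refine IsPrimitiveRoot.mk_of_lt x (by norm_num) h3 fun l hl hl3 hx => ?_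
  interval_cases l
  · exact hx1 (by simpa using hx)
  · exact hx1 (by rw [pow_succ, hx, one_mul] at h3; exact h3)

/-- A unit of degree at most `2` is a root of unity of an imaginary quadratic field, or all its
conjugates are real. -/
theorem pow_four_eq_one_or_real {η : (𝓞 K)ˣ}
    (hdeg : (minpoly ℚ ((η : 𝓞 K) : K)).natDegree ≤ 2) (h3 : ¬ ∃ ζ : K, IsPrimitiveRoot ζ 3) :
    η ^ 4 = 1 ∨ (minpoly ℚ ((η : 𝓞 K) : K)).natDegree = 2 ∧
      ∀ φ : K →+* ℂ, star (φ (η : 𝓞 K)) = φ (η : 𝓞 K) := by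
  have hpos : 0 < (minpoly ℚ ((η : 𝓞 K) : K)).natDegree :=
    minpoly.natDegree_pos (Algebra.IsIntegral.isIntegral _)
  have h12 : (minpoly ℚ ((η : 𝓞 K) : K)).natDegree = 1 ∨
    (minpoly ℚ ((η : 𝓞 K) : K)).natDegree = 2 := by omega
  rcases h12 with h | h
  · left
    rcases eq_one_or_neg_one_of_natDegree_eq_one h with rfl | rfl
    · simp
    · exact Even.neg_one_pow (by decide)
  obtain ⟨p, q, hq, hη⟩ := exists_int_quadratic h
  have hK : ((η : 𝓞 K) : K) ^ 2 + p * ((η : 𝓞 K) : K) + q = 0 := by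
    have := congrArg (algebraMap (𝓞 K) K) hη
    simpa using this
  rcases lt_or_ge (p ^ 2 - 4 * q) 0 with hD | hD
  · left
    have hq1 : q = 1 := by
      rcases hq with h | h
      · exact h
      · nlinarith [sq_nonneg p]
    subst hq1
    have hp1 : -1 ≤ p := by nlinarith
    have hp2 : p ≤ 1 := by nlinarith
    have hp : p = -1 ∨ p = 0 ∨ p = 1 := by omega
    rcases hp with rfl | rfl | rfl
    · refine absurd ⟨-((η : 𝓞 K) : K), isPrimitiveRoot_three ?_⟩ h3
      push_cast at hK
      linear_combination hK
    · refine Units.ext ?_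
      rw [Units.val_pow_eq_pow_val, Units.val_one]
      push_cast at hη
      linear_combination ((η : 𝓞 K) ^ 2 - 1) * hη
    · refine absurd ⟨((η : 𝓞 K) : K), isPrimitiveRoot_three ?_⟩ h3
      push_cast at hK
      linear_combination hK
  · right
    refine ⟨h, fun φ => ?_⟩
    have h1 : (2 * φ (η : 𝓞 K) + p) ^ 2 = ((p ^ 2 - 4 * q : ℤ) : ℝ) := by
      have := congrArg φ hK
      simp only [map_add, map_mul, map_pow, map_intCast, map_zero] at this
      push_cast
      linear_combination 4 * this
    have h2 := star_eq_self_of_sq (by exact_mod_cast hD) h1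
    simp only [star_add, star_mul', star_ofNat, RCLike.star_def, map_intCast] at h2 ⊢
    linear_combination h2 / 2

theorem norm_eq_one_of_mem_torsion {z : (𝓞 K)ˣ} (hz : z ∈ Units.torsion K) (φ : K →+* ℂ) :
    ‖φ (z : 𝓞 K)‖ = 1 :=
  (Units.mem_torsion K).1 hz (InfinitePlace.mk φ)

theorem natDegree_le_two_of_quadratic {x : K} {a b : ℚ}
    (h : x ^ 2 + algebraMap ℚ K a * x + algebraMap ℚ K b = 0) : (minpoly ℚ x).natDegree ≤ 2 := by
  have hm := isMonicOfDegree_add_add_two a b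
  rw [← hm.natDegree_eq]
  exact natDegree_le_of_dvd (minpoly.dvd ℚ x (by simpa using h)) hm.ne_zero

/-- In a totally complex quartic field without real quadratic subfield every root of unity `z` has
degree at most `2`, because otherwise `z + z⁻¹` would generate a real quadratic subfield. -/
theorem natDegree_le_two_of_mem_torsion (h4 : Module.finrank ℚ K = 4) (hc : IsTotallyComplex K)
    (hr : ¬ HasRealQuadraticSubfield K) {z : (𝓞 K)ˣ} (hz : z ∈ Units.torsion K) :
    (minpoly ℚ ((z : 𝓞 K) : K)).natDegree ≤ 2 := by
  set x : K := ((z : 𝓞 K) : K) with hx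
  have hx0 : x ≠ 0 := Units.coe_ne_zero z
  set y : K := x + x⁻¹ with hy
  have hyx : x ^ 2 + -y * x + 1 = 0 := by
    rw [hy]
    field_simp
    ring
  have hreal : ∀ φ : K →+* ℂ, star (φ y) = φ y := by
    intro φ
    have h1 := norm_eq_one_of_mem_torsion hz φ
    have h2 : star (φ x) = (φ x)⁻¹ := by
      rw [Complex.inv_def, Complex.normSq_eq_norm_sq, h1]
      simp
    rw [hy, map_add, map_inv₀, star_add, star_inv₀, h2, inv_inv, add_comm]
  have hdvd := minpoly.degree_dvd (K := ℚ) (Algebra.IsIntegral.isIntegral (R := ℚ) y)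
  rw [h4] at hdvd
  have hle := Nat.le_of_dvd (by norm_num) hdvd
  have hpos : 0 < (minpoly ℚ y).natDegree :=
    minpoly.natDegree_pos (Algebra.IsIntegral.isIntegral _)
  have hcases : (minpoly ℚ y).natDegree = 1 ∨ (minpoly ℚ y).natDegree = 2 ∨
      (minpoly ℚ y).natDegree = 4 := by
    interval_cases (minpoly ℚ y).natDegree <;> simp_all
  rcases hcases with h | h | h
  · obtain ⟨c, hc⟩ := minpoly.natDegree_eq_one_iff.1 h
    refine natDegree_le_two_of_quadratic (a := -c) (b := 1) ?_
    have hc' : algebraMap ℚ K c = y := hc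
    rw [map_neg, map_one, hc', hyx]
  · exact absurd (hasRealQuadraticSubfield_of_real h hreal) hr
  · exfalso
    have htop : ℚ⟮y⟯ = ⊤ :=
      (Field.primitive_element_iff_minpoly_natDegree_eq ℚ y).2 (h.trans h4.symm)
    obtain ⟨w⟩ : Nonempty (InfinitePlace K) := inferInstance
    have hw := hc.isComplex w
    rw [InfinitePlace.isComplex_iff, ComplexEmbedding.isReal_iff] at hw
    exact hw (ringHom_ext_of_adjoin_eq_top htop (hreal _))

theorem pow_four_eq_one_of_mem_torsion (h : InFamily K) (h3 : ¬ ∃ ζ : K, IsPrimitiveRoot ζ 3)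
    {z : (𝓞 K)ˣ} (hz : z ∈ Units.torsion K) : z ^ 4 = 1 := by
  have key : (minpoly ℚ ((z : 𝓞 K) : K)).natDegree ≤ 2 → z ^ 4 = 1 := by
    intro hdeg
    rcases pow_four_eq_one_or_real hdeg h3 with h1 | ⟨-, h1⟩
    · exact h1
    obtain ⟨w⟩ : Nonempty (InfinitePlace K) := inferInstance
    have h2 := norm_eq_one_of_mem_torsion hz w.embedding
    obtain ⟨r, hr⟩ := Complex.conj_eq_iff_real.1 (h1 w.embedding)
    rw [hr, Complex.norm_real, Real.norm_eq_abs, abs_eq zero_le_one] at h2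
    have h4 : w.embedding ((z : 𝓞 K) : K) ^ 4 = 1 := by
      rw [hr]
      rcases h2 with rfl | rfl <;> norm_num
    refine Units.ext (FaithfulSMul.algebraMap_injective (𝓞 K) K (w.embedding.injective ?_))
    rw [Units.val_pow_eq_pow_val, Units.val_one, map_pow, map_pow, map_one, map_one]
    exact h4
  rcases h with h | ⟨h, -⟩ | ⟨⟨h, hc⟩, hr, -⟩
  · exact key ((minpoly.natDegree_le _).trans h.le)
  · rcases Units.torsion_eq_one_or_neg_one_of_odd_finrank (by rw [h]; decide) ⟨z, hz⟩ with h1 | h1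
    · simp only at h1
      rw [h1, one_pow]
    · simp only at h1
      rw [h1]
      exact Even.neg_one_pow (by decide)
  · exact key (natDegree_le_two_of_mem_torsion h hc hr hz)

/-- A unit of infinite order generates a field of the family that contains no primitive third root
of unity. -/
theorem adjoin_eq_top_of_pow_ne_one (h : InFamily K) (h3 : ¬ ∃ ζ : K, IsPrimitiveRoot ζ 3)
    {η : (𝓞 K)ˣ} (hη : ∀ n : ℕ, 0 < n → η ^ n ≠ 1) : ℚ⟮((η : 𝓞 K) : K)⟯ = ⊤ := by
  rw [Field.primitive_element_iff_minpoly_natDegree_eq]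
  set x : K := ((η : 𝓞 K) : K) with hx
  have hdvd := minpoly.degree_dvd (K := ℚ) (Algebra.IsIntegral.isIntegral (R := ℚ) x)
  have hle := Nat.le_of_dvd Module.finrank_pos hdvd
  have hpos : 0 < (minpoly ℚ x).natDegree :=
    minpoly.natDegree_pos (Algebra.IsIntegral.isIntegral _)
  have h1 : (minpoly ℚ x).natDegree ≠ 1 := by
    intro h1
    rcases eq_one_or_neg_one_of_natDegree_eq_one h1 with h | h
    · exact hη 1 one_pos (by rw [h, one_pow])
    · exact hη 2 two_pos (by rw [h, neg_one_sq])
  rcases h with h | ⟨h, -⟩ | ⟨⟨h, hc⟩, hr, -⟩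
  · rw [IsQuadraticField] at h
    omega
  · rw [h] at hdvd hle ⊢
    interval_cases (minpoly ℚ x).natDegree <;> simp_all
  · have h2 : (minpoly ℚ x).natDegree ≠ 2 := by
      intro h2
      rcases pow_four_eq_one_or_real h2.le h3 with h4 | ⟨-, h4⟩
      · exact hη 4 (by norm_num) h4
      · exact hr (hasRealQuadraticSubfield_of_real h2 h4)
    rw [h] at hdvd hle ⊢
    interval_cases (minpoly ℚ x).natDegree <;> simp_all

/-- Fourth roots of unity have no nondegenerate vanishing sums of more than two terms. -/
theorem not_hasNondegenerateUnitSum_of_pow_four {m : ℕ} (hm : 3 ≤ m)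
    (h4 : ∀ u : (𝓞 K)ˣ, u ^ 4 = 1) : ¬ HasNondegenerateUnitSum K m := by
  rintro ⟨ε, hε, hnd⟩
  obtain ⟨j, δ, hj, hδ, hεδ⟩ := exists_digits_of_pow_four_eq_one ε fun i => h4 _
  have hsum : ((∑ i, δ i).1 : 𝓞 K) + (∑ i, δ i).2 * j = 0 := by
    rw [← hε, Prod.fst_sum, Prod.snd_sum]
    push_cast
    rw [Finset.sum_mul, ← Finset.sum_add_distrib]
    exact Finset.sum_congr rfl fun i _ => (hεδ i).symm
  have h0 : ∑ i, δ i = 0 := by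
    set s := ∑ i, δ i with hs
    rcases hj with hj | ⟨hj, hδ0⟩
    · have h1 : ((s.1 * s.1 + s.2 * s.2 : ℤ) : 𝓞 K) = 0 := by
        push_cast
        linear_combination (s.1 - s.2 * j : 𝓞 K) * hsum + (s.2 : 𝓞 K) ^ 2 * hj
      have h2 : s.1 * s.1 + s.2 * s.2 = 0 := by exact_mod_cast h1
      have ha : s.1 = 0 := by nlinarith [mul_self_nonneg s.1, mul_self_nonneg s.2]
      have hb : s.2 = 0 := by nlinarith [mul_self_nonneg s.1, mul_self_nonneg s.2]
      exact Prod.ext ha hb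
    · rw [hj, mul_zero, add_zero] at hsum
      refine Prod.ext (by exact_mod_cast hsum) ?_
      rw [hs, Prod.snd_sum]
      exact Finset.sum_eq_zero fun i _ => hδ0 i
  obtain ⟨a, b, hab, hneg⟩ := exists_opposite_of_sum_eq_zero hδ
    ⟨⟨0, by omega⟩, Finset.mem_univ _⟩ h0
  refine hnd {a, b} (by simp) (fun hu => ?_) ?_
  · have := congrArg Finset.card hu
    rw [Finset.card_pair hab.1] at this
    simp at this
    omega
  · rw [Finset.sum_pair hab.1, hεδ, hεδ, hneg]
    simp
    ring

end NumberFields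

/-! ### Cubic and quartic polynomials -/

section Polynomials

open Polynomial

variable {R : Type*} [CommRing R]

/-- The polynomial `X³ + a X² + b X + c`. -/
noncomputable def cubicPoly (a b c : R) : R[X] := X ^ 3 + C a * X ^ 2 + C b * X + C c

/-- The polynomial `X⁴ + a X³ + b X² + c X + d`. -/
noncomputable def quarticPoly (a b c d : R) : R[X] :=
  X ^ 4 + C a * X ^ 3 + C b * X ^ 2 + C c * X + C d

theorem isMonicOfDegree_cubicPoly [Nontrivial R] (a b c : R) :
    IsMonicOfDegree (cubicPoly a b c) 3 := by
  unfold cubicPoly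
  refine ⟨by compute_degree!, by monicity!⟩

theorem isMonicOfDegree_quarticPoly [Nontrivial R] (a b c d : R) :
    IsMonicOfDegree (quarticPoly a b c d) 4 := by
  unfold quarticPoly
  refine ⟨by compute_degree!, by monicity!⟩

theorem eq_cubicPoly {f : R[X]} (hf : IsMonicOfDegree f 3) :
    f = cubicPoly (f.coeff 2) (f.coeff 1) (f.coeff 0) := by
  have h3 : f.coeff 3 = 1 := hf.natDegree_eq ▸ hf.monic
  conv_lhs => rw [f.as_sum_range_C_mul_X_pow, hf.natDegree_eq]
  simp only [Finset.sum_range_succ, Finset.sum_range_zero, h3, cubicPoly, map_one]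
  ring

theorem eq_quarticPoly {f : R[X]} (hf : IsMonicOfDegree f 4) :
    f = quarticPoly (f.coeff 3) (f.coeff 2) (f.coeff 1) (f.coeff 0) := by
  have h4 : f.coeff 4 = 1 := hf.natDegree_eq ▸ hf.monic
  conv_lhs => rw [f.as_sum_range_C_mul_X_pow, hf.natDegree_eq]
  simp only [Finset.sum_range_succ, Finset.sum_range_zero, h4, quarticPoly, map_one]
  ring

theorem cubicPoly_inj {a b c a' b' c' : R} (h : cubicPoly a b c = cubicPoly a' b' c') :
    a = a' ∧ b = b' ∧ c = c' := by
  have h0 := congrArg (coeff · 0) h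
  have h1 := congrArg (coeff · 1) h
  have h2 := congrArg (coeff · 2) h
  simp [cubicPoly, coeff_X, coeff_C, coeff_X_pow] at h0 h1 h2
  exact ⟨h2, h1, h0⟩

theorem quarticPoly_inj {a b c d a' b' c' d' : R}
    (h : quarticPoly a b c d = quarticPoly a' b' c' d') :
    a = a' ∧ b = b' ∧ c = c' ∧ d = d' := by
  have h0 := congrArg (coeff · 0) h
  have h1 := congrArg (coeff · 1) h
  have h2 := congrArg (coeff · 2) h
  have h3 := congrArg (coeff · 3) h
  simp [quarticPoly, coeff_X, coeff_C, coeff_X_pow] at h0 h1 h2 h3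
  exact ⟨h3, h2, h1, h0⟩

theorem mul_eq_cubicPoly (p q r : R) : (X ^ 2 + C p * X + C q) * (X + C r) =
    cubicPoly (p + r) (q + p * r) (q * r) := by
  simp only [cubicPoly, map_add, map_mul]
  ring

theorem mul_eq_quarticPoly (p q r s : R) : (X ^ 2 + C p * X + C q) * (X ^ 2 + C r * X + C s) =
    quarticPoly (p + r) (q + s + p * r) (p * s + q * r) (q * s) := by
  simp only [quarticPoly, map_add, map_mul]
  ring

theorem exists_real_factors_cubic (a b c : ℝ) :
    ∃ p q r : ℝ, a = p + r ∧ b = q + p * r ∧ c = q * r := by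
  obtain ⟨f, g, hf, hg, hfg⟩ :=
    IsMonicOfDegree.eq_isMonicOfDegree_two_mul_isMonicOfDegree (n := 1)
      (isMonicOfDegree_cubicPoly a b c)
  obtain ⟨p, q, rfl⟩ := isMonicOfDegree_two_iff.1 hf
  obtain ⟨r, rfl⟩ := isMonicOfDegree_one_iff.1 hg
  rw [mul_eq_cubicPoly] at hfg
  exact ⟨p, q, r, cubicPoly_inj hfg⟩

theorem exists_real_factors_quartic (a b c d : ℝ) :
    ∃ p q r s : ℝ, a = p + r ∧ b = q + s + p * r ∧ c = p * s + q * r ∧ d = q * s := by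
  obtain ⟨f, g, hf, hg, hfg⟩ :=
    IsMonicOfDegree.eq_isMonicOfDegree_two_mul_isMonicOfDegree (n := 2)
      (isMonicOfDegree_quarticPoly a b c d)
  obtain ⟨p, q, rfl⟩ := isMonicOfDegree_two_iff.1 hf
  obtain ⟨r, s, rfl⟩ := isMonicOfDegree_two_iff.1 hg
  rw [mul_eq_quarticPoly] at hfg
  exact ⟨p, q, r, s, quarticPoly_inj hfg⟩

theorem quarticDisc_eq (p q r s : R) :
    quarticDisc (p + r) (q + s + p * r) (p * s + q * r) (q * s) =
      (p ^ 2 - 4 * q) * (r ^ 2 - 4 * s) * ((q - s) ^ 2 + (p - r) * (p * s - q * r)) ^ 2 := by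
  unfold quarticDisc
  ring

/-- With `M = 4 q - p²`, `N = 4 s - r²` and `t = p - r` the two auxiliary expressions of
`DefiniteTest` are `2 (M + N) - t²` and `2 t² (M + N) - (M - N)²`. -/
theorem definite_iff {a b c p q r s : ℝ} (ha : a = p + r) (hb : b = q + s + p * r)
    (hc : c = p * s + q * r) (hd : 1 = q * s)
    (hres : p ^ 2 < 4 * q → r ^ 2 < 4 * s → (q - s) ^ 2 + (p - r) * (p * s - q * r) ≠ 0) :
    (0 < quarticDisc a b c 1 ∧ (0 ≤ 8 * b - 3 * a ^ 2 ∨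
      0 < 64 - 16 * b ^ 2 + 16 * a ^ 2 * b - 16 * a * c - 3 * a ^ 4)) ↔
      p ^ 2 < 4 * q ∧ r ^ 2 < 4 * s := by
  have hdisc : quarticDisc a b c 1 = (p ^ 2 - 4 * q) * (r ^ 2 - 4 * s) *
      ((q - s) ^ 2 + (p - r) * (p * s - q * r)) ^ 2 := by
    rw [hd, ha, hb, hc, quarticDisc_eq]
  have h1 : 8 * b - 3 * a ^ 2 = 2 * ((4 * q - p ^ 2) + (4 * s - r ^ 2)) - (p - r) ^ 2 := by
    rw [ha, hb]
    ring
  have h2 : 64 - 16 * b ^ 2 + 16 * a ^ 2 * b - 16 * a * c - 3 * a ^ 4 =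
      2 * (p - r) ^ 2 * ((4 * q - p ^ 2) + (4 * s - r ^ 2)) -
        ((4 * q - p ^ 2) - (4 * s - r ^ 2)) ^ 2 := by
    rw [ha, hb, hc]
    linear_combination 64 * hd
  rw [hdisc, h1, h2]
  set M := 4 * q - p ^ 2 with hM
  set N := 4 * s - r ^ 2 with hN
  set E := (q - s) ^ 2 + (p - r) * (p * s - q * r)
  have h3 : (p ^ 2 - 4 * q) * (r ^ 2 - 4 * s) = M * N := by ring
  rw [h3]
  have ht := sq_nonneg (p - r)
  constructor
  · rintro ⟨hpos, hor⟩
    have hMN : 0 < M * N := by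
      by_contra hle
      exact absurd hpos (not_lt.2 (mul_nonpos_of_nonpos_of_nonneg (not_lt.1 hle) (sq_nonneg _)))
    rcases mul_pos_iff.1 hMN with ⟨hM0, hN0⟩ | ⟨hM0, hN0⟩
    · exact ⟨by linarith, by linarith⟩
    · exfalso
      rcases hor with h | h
      · linarith
      · have : (p - r) ^ 2 * (M + N) ≤ 0 := mul_nonpos_of_nonneg_of_nonpos ht (by linarith)
        nlinarith [sq_nonneg (M - N)]
  · rintro ⟨hM0, hN0⟩
    have hM0' : 0 < M := by linarith
    have hN0' : 0 < N := by linarith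
    have hE := hres hM0 hN0
    refine ⟨by positivity, ?_⟩
    by_contra hcon
    push Not at hcon
    obtain ⟨h4, h5⟩ := hcon
    have h6 : 2 * (M + N) * (M + N) < (p - r) ^ 2 * (M + N) :=
      mul_lt_mul_of_pos_right (by linarith) (by linarith)
    nlinarith [mul_pos hM0' hN0']

theorem quadratic_pos {p q : ℝ} (h : p ^ 2 < 4 * q) (x : ℝ) : 0 < x ^ 2 + p * x + q := by
  nlinarith [sq_nonneg (2 * x + p)]

theorem exists_root_of_le {p q : ℝ} (h : 4 * q ≤ p ^ 2) : ∃ x : ℝ, x ^ 2 + p * x + q = 0 := by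
  refine ⟨(-p + √(p ^ 2 - 4 * q)) / 2, ?_⟩
  have := Real.sq_sqrt (show 0 ≤ p ^ 2 - 4 * q by linarith)
  linear_combination this / 4

/-- A quartic without multiple factors has no real root if and only if it passes the test. -/
theorem definiteTest_iff {a b c : ℤ} (hsq : Squarefree (quarticPoly (a : ℝ) b c 1)) :
    DefiniteTest a b c ↔ ∀ x : ℝ, x ^ 4 + a * x ^ 3 + b * x ^ 2 + c * x + 1 ≠ 0 := by
  obtain ⟨p, q, r, s, ha, hb, hc, hd⟩ := exists_real_factors_quartic (a : ℝ) b c 1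
  have hres : p ^ 2 < 4 * q → r ^ 2 < 4 * s →
      (q - s) ^ 2 + (p - r) * (p * s - q * r) ≠ 0 := by
    intro hp hr h0
    -- A vanishing resultant of two definite quadratics means that they are equal.
    have hM : 0 < 4 * q - p ^ 2 := by linarith
    have hN : 0 < 4 * s - r ^ 2 := by linarith
    have h1 : ((4 * q - p ^ 2) - (4 * s - r ^ 2)) ^ 2 + 2 * (p - r) ^ 2 *
        ((4 * q - p ^ 2) + (4 * s - r ^ 2)) + (p - r) ^ 4 = 0 := by
      linear_combination 16 * h0
    have h2 : p - r = 0 := by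
      by_contra hne
      have := pow_pos (sq_pos_of_ne_zero hne) 2
      have h3 : 0 < (p - r) ^ 4 := by
        calc 0 < ((p - r) ^ 2) ^ 2 := this
          _ = (p - r) ^ 4 := by ring
      nlinarith [sq_nonneg ((4 * q - p ^ 2) - (4 * s - r ^ 2)), mul_nonneg (sq_nonneg (p - r))
        (add_pos hM hN).le]
    have hpr : p = r := sub_eq_zero.1 h2
    have hqs : q = s := by
      rw [hpr] at h0
      have : (q - s) ^ 2 = 0 := by linear_combination h0
      exact sub_eq_zero.1 (pow_eq_zero_iff two_ne_zero |>.1 this)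
    rw [ha, hb, hc, hd, ← mul_eq_quarticPoly, ← hpr, ← hqs] at hsq
    have h4 := hsq _ dvd_rfl
    have h5 := natDegree_eq_zero_of_isUnit h4
    rw [(isMonicOfDegree_add_add_two p q).natDegree_eq] at h5
    exact two_ne_zero h5
  have hiff := definite_iff ha hb hc hd hres
  have hcast : DefiniteTest a b c ↔ (0 < quarticDisc (a : ℝ) b c 1 ∧
      (0 ≤ 8 * (b : ℝ) - 3 * (a : ℝ) ^ 2 ∨ 0 < 64 - 16 * (b : ℝ) ^ 2 + 16 * (a : ℝ) ^ 2 * b -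
        16 * a * c - 3 * (a : ℝ) ^ 4)) := by
    unfold DefiniteTest quarticDisc
    norm_cast
  have hfac : ∀ x : ℝ, x ^ 4 + a * x ^ 3 + b * x ^ 2 + c * x + 1 =
      (x ^ 2 + p * x + q) * (x ^ 2 + r * x + s) := by
    intro x
    rw [ha, hb, hc, hd]
    ring
  rw [hcast, hiff]
  constructor
  · rintro ⟨h1, h2⟩ x
    rw [hfac]
    exact (mul_pos (quadratic_pos h1 x) (quadratic_pos h2 x)).ne'
  · intro h
    by_contra hcon
    rw [not_and_or, not_lt, not_lt] at hcon
    rcases hcon with h1 | h1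
    · obtain ⟨x, hx⟩ := exists_root_of_le h1
      exact h x (by rw [hfac, hx, zero_mul])
    · obtain ⟨x, hx⟩ := exists_root_of_le h1
      exact h x (by rw [hfac, hx, mul_zero])

/-- A real quartic without real roots has positive constant term. -/
theorem constant_pos_of_no_real_root {a b c d : ℝ}
    (h : ∀ x : ℝ, x ^ 4 + a * x ^ 3 + b * x ^ 2 + c * x + d ≠ 0) : 0 < d := by
  obtain ⟨p, q, r, s, ha, hb, hc, hd⟩ := exists_real_factors_quartic a b c d
  have hfac : ∀ x : ℝ, x ^ 4 + a * x ^ 3 + b * x ^ 2 + c * x + d =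
      (x ^ 2 + p * x + q) * (x ^ 2 + r * x + s) := by
    intro x
    rw [ha, hb, hc, hd]
    ring
  have hq : 0 < q := by
    by_contra hle
    obtain ⟨x, hx⟩ := exists_root_of_le (p := p) (q := q) (by nlinarith [sq_nonneg p])
    exact h x (by rw [hfac, hx, zero_mul])
  have hs : 0 < s := by
    by_contra hle
    obtain ⟨x, hx⟩ := exists_root_of_le (p := r) (q := s) (by nlinarith [sq_nonneg r])
    exact h x (by rw [hfac, hx, mul_zero])
  rw [hd]
  exact mul_pos hq hs

/-- A real cubic has a nonreal root if and only if its discriminant is negative. -/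
theorem exists_nonreal_root_iff (a b c : ℝ) :
    (∃ z : ℂ, z ^ 3 + a * z ^ 2 + b * z + c = 0 ∧ star z ≠ z) ↔
      a ^ 2 * b ^ 2 - 4 * b ^ 3 - 4 * a ^ 3 * c + 18 * a * b * c - 27 * c ^ 2 < 0 := by
  obtain ⟨p, q, r, ha, hb, hc⟩ := exists_real_factors_cubic a b c
  have hdisc : a ^ 2 * b ^ 2 - 4 * b ^ 3 - 4 * a ^ 3 * c + 18 * a * b * c - 27 * c ^ 2 =
      (p ^ 2 - 4 * q) * (r ^ 2 - p * r + q) ^ 2 := by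
    rw [ha, hb, hc]
    ring
  have hfac : ∀ z : ℂ, z ^ 3 + a * z ^ 2 + b * z + c = (z ^ 2 + p * z + q) * (z + r) := by
    intro z
    rw [ha, hb, hc]
    push_cast
    ring
  rw [hdisc]
  constructor
  · rintro ⟨z, hz, hne⟩
    rw [hfac] at hz
    have h1 : z ^ 2 + p * z + q = 0 := by
      refine (mul_eq_zero.1 hz).resolve_right fun h => hne ?_
      rw [eq_neg_of_add_eq_zero_left h]
      simp
    have h2 : p ^ 2 < 4 * q := by
      by_contra hle
      have h3 : (2 * z + p) ^ 2 = ((p ^ 2 - 4 * q : ℝ) : ℂ) := by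
        push_cast
        linear_combination 4 * h1
      have h4 := star_eq_self_of_sq (by linarith) h3
      apply hne
      simp only [star_add, star_mul', star_ofNat, RCLike.star_def, Complex.conj_ofReal] at h4 ⊢
      linear_combination h4 / 2
    have h3 : 0 < r ^ 2 - p * r + q := by
      have := quadratic_pos h2 (-r)
      linarith
    exact mul_neg_of_neg_of_pos (by linarith) (by positivity)
  · intro h
    have h2 : p ^ 2 - 4 * q < 0 := by
      by_contra hle
      exact absurd h (not_lt.2 (mul_nonneg (not_lt.1 hle) (sq_nonneg _)))
    have hs := Real.sq_sqrt (show 0 ≤ 4 * q - p ^ 2 by linarith)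
    have hpos := Real.sqrt_pos.2 (show 0 < 4 * q - p ^ 2 by linarith)
    set w := √(4 * q - p ^ 2)
    refine ⟨(-p + w * Complex.I) / 2, ?_, ?_⟩
    · rw [hfac]
      have hs' : (w : ℂ) ^ 2 = 4 * q - p ^ 2 := by exact_mod_cast hs
      have : ((-p + w * Complex.I) / 2 : ℂ) ^ 2 + p * ((-p + w * Complex.I) / 2) + q = 0 := by
        linear_combination (w : ℂ) ^ 2 / 4 * Complex.I_sq - hs' / 4
      rw [this, zero_mul]
    · rw [RCLike.star_def, Ne, Complex.conj_eq_iff_im]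
      simp
      exact hpos.ne'

end Polynomials

/-! ### Quadratic subfields of quartic fields, and signatures -/

section Subfields

open NumberField Polynomial

variable {K : Type*} [Field K] [NumberField K]

theorem eq_zero_of_natDegree_lt {x : K} {p : ℚ[X]} (hp : p.natDegree < (minpoly ℚ x).natDegree)
    (h : aeval x p = 0) : p = 0 := by
  by_contra hne
  exact absurd (natDegree_le_natDegree (minpoly.degree_le_of_ne_zero ℚ x hne h)) hp.not_ge

theorem eq_zero_of_quartic_degree {x : K} (hx : (minpoly ℚ x).natDegree = 4) {u v w t : ℚ}
    (h : (u : K) + v * x + w * x ^ 2 + t * x ^ 3 = 0) : u = 0 ∧ v = 0 ∧ w = 0 ∧ t = 0 := by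
  have h0 := eq_zero_of_natDegree_lt (x := x) (p := C t * X ^ 3 + C w * X ^ 2 + C v * X + C u)
    (by rw [hx]; exact natDegree_cubic_le.trans_lt (by norm_num)) (by
      simp only [map_add, map_mul, aeval_C, aeval_X, map_pow, eq_ratCast]
      linear_combination h)
  have h1 := congrArg (coeff · 0) h0
  have h2 := congrArg (coeff · 1) h0
  have h3 := congrArg (coeff · 2) h0
  have h4 := congrArg (coeff · 3) h0
  simp [coeff_X, coeff_C] at h1 h2 h3 h4
  exact ⟨h1, h2, h3, h4⟩

theorem eq_zero_of_cubic_degree {x : K} (hx : (minpoly ℚ x).natDegree = 3) {u v w : ℚ}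
    (h : (u : K) + v * x + w * x ^ 2 = 0) : u = 0 ∧ v = 0 ∧ w = 0 := by
  have h0 := eq_zero_of_natDegree_lt (x := x) (p := C w * X ^ 2 + C v * X + C u)
    (by rw [hx]; exact natDegree_quadratic_le.trans_lt (by norm_num)) (by
      simp only [map_add, map_mul, aeval_C, aeval_X, map_pow, eq_ratCast]
      linear_combination h)
  have h1 := congrArg (coeff · 0) h0
  have h2 := congrArg (coeff · 1) h0
  have h3 := congrArg (coeff · 2) h0
  simp [coeff_X, coeff_C] at h1 h2 h3
  exact ⟨h1, h2, h3⟩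

theorem eq_zero_of_quadratic_degree {x : K} (hx : (minpoly ℚ x).natDegree = 2) {u v : ℚ}
    (h : (u : K) + v * x = 0) : u = 0 ∧ v = 0 := by
  have h0 := eq_zero_of_natDegree_lt (x := x) (p := C v * X + C u)
    (by rw [hx]; exact natDegree_linear_le.trans_lt (by norm_num)) (by
      simp only [map_add, map_mul, aeval_C, aeval_X, eq_ratCast]
      linear_combination h)
  have h1 := congrArg (coeff · 0) h0
  have h2 := congrArg (coeff · 1) h0
  simp [coeff_X, coeff_C] at h1 h2
  exact ⟨h1, h2⟩

/-- An element of degree `4` of a quartic field that contains a square root `r` of `D ∈ ℚ`, `r ∉ ℚ`,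
satisfies a monic quadratic equation over `ℚ(r)`. The product of this equation with its conjugate is
the minimal polynomial, and the comparison of coefficients gives a rational root `s` of the
resolvent cubic. -/
theorem exists_resolvent_of_sq (h4 : Module.finrank ℚ K = 4) {x r : K}
    (hx : (minpoly ℚ x).natDegree = 4) {a b c D : ℚ} (hr : r ^ 2 = D) (hrq : ∀ q : ℚ, r ≠ q)
    (hroot : x ^ 4 + a * x ^ 3 + b * x ^ 2 + c * x + 1 = 0) :
    ∃ s α β : ℚ, a ^ 2 - 4 * b + 4 * s = 4 * D * α ^ 2 ∧ s ^ 2 - 4 = 4 * D * β ^ 2 ∧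
      a * s - 2 * c = 4 * D * α * β := by
  -- `D` is not a square in `ℚ`.
  have hsq : ∀ u v : ℚ, u ^ 2 = D * v ^ 2 → u = 0 ∧ v = 0 := by
    intro u v h
    by_cases hv : v = 0
    · subst hv
      exact ⟨by simpa using h, rfl⟩
    · exfalso
      have hv' : (v : K) ≠ 0 := by exact_mod_cast hv
      have h1 : (u : K) ^ 2 = D * (v : K) ^ 2 := by exact_mod_cast h
      have h2 : (r * v - u) * (r * v + u) = 0 := by
        linear_combination (v : K) ^ 2 * hr - h1
      rcases mul_eq_zero.1 h2 with h3 | h3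
      · refine hrq (u / v) ?_
        push_cast
        rw [eq_div_iff hv']
        linear_combination h3
      · refine hrq (-u / v) ?_
        push_cast
        rw [eq_div_iff hv']
        linear_combination h3
  have hli : LinearIndependent ℚ ![1, x, r, r * x] := by
    rw [Fintype.linearIndependent_iff]
    intro g hg
    simp only [Fin.sum_univ_four, Rat.smul_def, Matrix.cons_val_zero, Matrix.cons_val_one,
      Matrix.cons_val] at hg
    have h1 := eq_zero_of_quartic_degree hx (u := g 0 ^ 2 - D * g 2 ^ 2)
      (v := 2 * g 0 * g 1 - 2 * D * g 2 * g 3) (w := g 1 ^ 2 - D * g 3 ^ 2) (t := 0) (by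
        push_cast
        linear_combination (g 0 + g 1 * x - r * (g 2 + g 3 * x)) * hg
          + (g 2 + g 3 * x) ^ 2 * hr)
    obtain ⟨h1, -, h2, -⟩ := h1
    obtain ⟨h10, h12⟩ := hsq _ _ (sub_eq_zero.1 h1)
    obtain ⟨h11, h13⟩ := hsq _ _ (sub_eq_zero.1 h2)
    intro i
    fin_cases i <;> assumption
  -- The quadratic equation over `ℚ(r)` is `x² + g₁ x + g₀ + r (g₃ x + g₂) = 0`.
  have hspan := hli.span_eq_top_of_card_eq_finrank (by simp [h4])
  have hmem : -x ^ 2 ∈ Submodule.span ℚ (Set.range ![1, x, r, r * x]) := by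
    rw [hspan]
    trivial
  obtain ⟨g, hg⟩ := (Submodule.mem_span_range_iff_exists_fun ℚ).1 hmem
  simp only [Fin.sum_univ_four, Rat.smul_def, Matrix.cons_val_zero, Matrix.cons_val_one,
    Matrix.cons_val] at hg
  have h1 := eq_zero_of_quartic_degree hx (u := g 0 ^ 2 - D * g 2 ^ 2 - 1)
    (v := 2 * g 0 * g 1 - 2 * D * g 2 * g 3 - c)
    (w := 2 * g 0 + g 1 ^ 2 - D * g 3 ^ 2 - b) (t := 2 * g 1 - a) (by
      push_cast
      linear_combination (x ^ 2 + g 1 * x + g 0 - r * (g 2 + g 3 * x)) * hg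
          + (g 2 + g 3 * x) ^ 2 * hr - hroot)
  obtain ⟨e1, e2, e3, e4⟩ := h1
  refine ⟨2 * g 0, g 3, g 2, ?_, ?_, ?_⟩
  · linear_combination (-a - 2 * g 1) * e4 + 4 * e3
  · linear_combination 4 * e1
  · linear_combination (- 2 * g 0) * e4 + 2 * e2

theorem exists_int_of_sq {q : ℚ} {n : ℤ} (h : q ^ 2 = n) : ∃ m : ℤ, q = m := by
  have : IsIntegral ℤ q := ⟨X ^ 2 - C n, monic_X_pow_sub_C n two_ne_zero, by
    simp [-eq_intCast, -map_intCast, h]⟩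
  obtain ⟨m, hm⟩ := IsIntegrallyClosed.isIntegral_iff.1 this
  exact ⟨m, by simpa using hm.symm⟩

/-- Rational roots of the resolvent cubic are integers. -/
theorem exists_int_of_resolvent {s : ℚ} {a b c : ℤ}
    (h : ((a : ℚ) ^ 2 - 4 * b + 4 * s) * (s ^ 2 - 4) = (a * s - 2 * c) ^ 2) :
    ∃ m : ℤ, s = m := by
  have : IsIntegral ℤ s := by
    -- A quarter of the difference of the two sides is a monic cubic in `s`.
    refine ⟨cubicPoly (-b) (a * c - 4) (-(a ^ 2 - 4 * b + c ^ 2)),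
      (isMonicOfDegree_cubicPoly _ _ _).monic, ?_⟩
    simp only [cubicPoly, eval₂_add, eval₂_mul, eval₂_pow, eval₂_X, eval₂_C]
    simp only [eq_intCast]
    push_cast
    linear_combination h / 4
  obtain ⟨m, hm⟩ := IsIntegrallyClosed.isIntegral_iff.1 this
  exact ⟨m, by simpa using hm.symm⟩

theorem abs_le_of_resolvent {C : ℕ} {a b c s : ℤ} (ha : |a| ≤ C) (hb : |b| ≤ C) (hc : |c| ≤ C)
    (h : IsResolventRoot a b c s) : |s| ≤ 3 * C ^ 2 + 5 * C + 4 := by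
  rcases Int.lt_or_le |s| 1 with h1 | h1
  · have : (0 : ℤ) ≤ 3 * C ^ 2 + 5 * C + 4 := by positivity
    omega
  have h2 : s ^ 3 = b * s ^ 2 - (a * c - 4) * s + (a ^ 2 - 4 * b + c ^ 2) := by
    unfold IsResolventRoot at h
    linarith
  have hac : |a * c| ≤ (C : ℤ) ^ 2 := by
    rw [abs_mul, sq]
    exact mul_le_mul ha hc (abs_nonneg _) (by positivity)
  have haa : a ^ 2 ≤ (C : ℤ) ^ 2 := sq_le_sq.2 (ha.trans (le_abs_self _))
  have hcc : c ^ 2 ≤ (C : ℤ) ^ 2 := sq_le_sq.2 (hc.trans (le_abs_self _))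
  have h3 : |s| ^ 3 ≤ C * |s| ^ 2 + (C ^ 2 + 4) * |s| + (2 * C ^ 2 + 4 * C) := by
    rw [← abs_pow, h2]
    refine (abs_add_le _ _).trans (add_le_add ((abs_sub _ _).trans (add_le_add ?_ ?_)) ?_)
    · rw [abs_mul, abs_pow]
      gcongr
    · rw [abs_mul]
      gcongr
      refine (abs_sub _ _).trans ?_
      simpa using hac
    · rw [abs_le] at hb ⊢
      constructor <;> nlinarith [sq_nonneg a, sq_nonneg c]
  have h4 : |s| ≤ |s| ^ 2 := by nlinarith
  have h5 : |s| ^ 3 ≤ (3 * C ^ 2 + 5 * C + 4) * |s| ^ 2 := by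
    have hC : (0 : ℤ) ≤ C := by positivity
    nlinarith [mul_le_mul_of_nonneg_left h4 (by positivity : (0 : ℤ) ≤ C ^ 2 + 4),
      mul_le_mul_of_nonneg_left (h1.trans h4) (by positivity : (0 : ℤ) ≤ 2 * C ^ 2 + 4 * C)]
  by_contra hlt
  push Not at hlt
  have : (3 * (C : ℤ) ^ 2 + 5 * C + 4) * |s| ^ 2 < |s| * |s| ^ 2 :=
    mul_lt_mul_of_pos_right hlt (by positivity)
  nlinarith

/-- The case of a subfield `ℚ(√D)` with `D ≥ 0` or `D = -3`; in the latter case `v` and `t` are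
integers because their squares times `3` are. -/
theorem hasForbiddenFactorization_of_sq (h4 : Module.finrank ℚ K = 4) {x r : K}
    (hx : (minpoly ℚ x).natDegree = 4) {a b c : ℤ} {D : ℚ} (hr : r ^ 2 = D)
    (hrq : ∀ q : ℚ, r ≠ q) (hD : 0 ≤ D ∨ D = -3)
    (hroot : x ^ 4 + a * x ^ 3 + b * x ^ 2 + c * x + 1 = 0) {C : ℕ} (ha : |a| ≤ C)
    (hb : |b| ≤ C) (hc : |c| ≤ C) : HasForbiddenFactorization (searchBound C) a b c := by
  obtain ⟨s, α, β, e1, e2, e3⟩ := exists_resolvent_of_sq h4 hx (a := a) (b := b) (c := c) hr hrq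
    (by push_cast; exact hroot)
  obtain ⟨s, rfl⟩ := exists_int_of_resolvent (s := s) (a := a) (b := b) (c := c) (by
    rw [e1, e2, e3]
    ring)
  have hs : IsResolventRoot a b c s := by
    unfold IsResolventRoot
    have : ((a : ℚ) ^ 2 - 4 * b + 4 * s) * (s ^ 2 - 4) = (a * s - 2 * c) ^ 2 := by
      rw [e1, e2, e3]
      ring
    exact_mod_cast this
  have hsC := abs_le_of_resolvent ha hb hc hs
  have hC : (0 : ℤ) ≤ C := by positivity
  refine ⟨s, mem_intsUpTo.2 (hsC.trans ?_), hs, ?_⟩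
  · unfold searchBound
    push_cast
    nlinarith
  rcases hD with hD | rfl
  · left
    constructor
    · have : (0 : ℚ) ≤ a ^ 2 - 4 * b + 4 * s := by
        rw [e1]
        positivity
      exact_mod_cast this
    · have : (0 : ℚ) ≤ s ^ 2 - 4 := by
        rw [e2]
        positivity
      exact_mod_cast this
  · right
    have key : ∀ (y : ℚ) (n : ℤ), (n : ℚ) = 4 * -3 * y ^ 2 → ∃ m : ℤ, n = -3 * m ^ 2 := by
      intro y n h
      obtain ⟨m, hm⟩ := exists_int_of_sq (q := 6 * y) (n := -3 * n) (by
        push_cast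
        linear_combination 3 * h)
      have h1 : m ^ 2 = -3 * n := by
        have : (m : ℚ) ^ 2 = -3 * n := by
          rw [← hm]
          linear_combination 3 * h
        exact_mod_cast this
      have h2 : (3 : ℤ) ∣ m := Int.prime_three.dvd_of_dvd_pow (n := 2) ⟨-n, by rw [h1]; ring⟩
      obtain ⟨l, rfl⟩ := h2
      exact ⟨l, by linarith⟩
    obtain ⟨v, hv⟩ := key α (a ^ 2 - 4 * b + 4 * s) (by push_cast; exact e1)
    obtain ⟨t, ht⟩ := key β (s ^ 2 - 4) (by push_cast; exact e2)
    refine ⟨⟨v, mem_intsUpTo.2 (abs_le_of_sq_le_sq' ?_ (by positivity) |> abs_le.2), hv⟩,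
      t, mem_intsUpTo.2 (abs_le_of_sq_le_sq' ?_ (by positivity) |> abs_le.2), ht⟩
    · unfold searchBound
      push_cast
      rw [abs_le] at hb hsC
      have h1 : v ^ 2 ≤ 4 * C + 4 * (3 * C ^ 2 + 5 * C + 4) := by
        nlinarith [sq_nonneg a, sq_nonneg v]
      have h2 : (1 : ℤ) ≤ (C + 1) ^ 2 := by nlinarith
      nlinarith [mul_le_mul_of_nonneg_left h2 (by positivity : (0 : ℤ) ≤ (C + 1) ^ 2)]
    · unfold searchBound
      push_cast
      have h1 : t ^ 2 ≤ 2 := by nlinarith [sq_nonneg s, sq_nonneg t]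
      have h2 : (1 : ℤ) ≤ (C + 1) ^ 2 := by nlinarith
      nlinarith [mul_le_mul_of_nonneg_left h2 (by positivity : (0 : ℤ) ≤ (C + 1) ^ 2)]

theorem exists_sq_of_hasRealQuadraticSubfield (h : HasRealQuadraticSubfield K) :
    ∃ (r : K) (D : ℚ), r ^ 2 = D ∧ 0 ≤ D ∧ ∀ q : ℚ, r ≠ q := by
  obtain ⟨L, hL, hr⟩ := h
  rw [IsQuadraticField] at hL
  have hne : (⊥ : Subalgebra ℚ L) ≠ ⊤ := fun h => by
    have := Subalgebra.bot_eq_top_iff_finrank_eq_one.1 h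
    omega
  obtain ⟨x, hx⟩ : ∃ x : L, x ∉ (⊥ : Subalgebra ℚ L) := by
    by_contra hcon
    push Not at hcon
    exact hne (eq_top_iff.2 fun y _ => hcon y)
  have hint : IsIntegral ℚ x := Algebra.IsIntegral.isIntegral x
  have hd : (minpoly ℚ x).natDegree = 2 := by
    have h1 : (minpoly ℚ x).natDegree ≠ 1 := fun h => by
      obtain ⟨q, hq⟩ := minpoly.natDegree_eq_one_iff.1 h
      exact hx ⟨q, hq⟩
    have h2 := minpoly.natDegree_pos hint
    have h3 : (minpoly ℚ x).natDegree ≤ Module.finrank ℚ L := minpoly.natDegree_le x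
    omega
  obtain ⟨p, q, hpq⟩ := isMonicOfDegree_two_iff.1 ⟨hd, minpoly.monic hint⟩
  have h0 := minpoly.aeval ℚ x
  rw [hpq] at h0
  simp only [map_add, map_mul, aeval_C, aeval_X, map_pow, eq_ratCast] at h0
  have hsq : (2 * x + p) ^ 2 = ((p ^ 2 - 4 * q : ℚ) : L) := by
    push_cast
    linear_combination 4 * h0
  refine ⟨((2 * x + p : L) : K), p ^ 2 - 4 * q, ?_, ?_, fun y hy => hx ?_⟩
  · have := congrArg (algebraMap L K) hsq
    rwa [map_pow, map_ratCast] at this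
  · obtain ⟨w⟩ : Nonempty (InfinitePlace L) := inferInstance
    have h1 := InfinitePlace.isReal_iff.1 (hr.isReal w)
    rw [ComplexEmbedding.isReal_iff] at h1
    obtain ⟨y, hy⟩ := Complex.conj_eq_iff_real.1 (DFunLike.congr_fun h1 (2 * x + p))
    have h2 := congrArg w.embedding hsq
    rw [map_pow, hy, map_ratCast] at h2
    have h3 : y ^ 2 = ((p ^ 2 - 4 * q : ℚ) : ℝ) := by exact_mod_cast h2
    have h4 : (0 : ℝ) ≤ ((p ^ 2 - 4 * q : ℚ) : ℝ) := h3 ▸ sq_nonneg y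
    exact_mod_cast h4
  · have h1 : 2 * x + p = ((y : ℚ) : L) := by
      apply Subtype.val_injective
      rw [hy]
      rfl
    refine ⟨(y - p) / 2, ?_⟩
    change algebraMap ℚ L _ = x
    rw [eq_ratCast]
    push_cast
    linear_combination -h1 / 2

theorem exists_sq_of_isPrimitiveRoot_three {ζ : K} (h : IsPrimitiveRoot ζ 3) :
    ∃ r : K, r ^ 2 = ((-3 : ℚ) : K) ∧ ∀ q : ℚ, r ≠ q := by
  have h0 : ζ ^ 2 + ζ + 1 = 0 := by
    have h1 : ζ - 1 ≠ 0 := sub_ne_zero.2 (h.ne_one (by norm_num))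
    refine (mul_eq_zero.1 (?_ : (ζ - 1) * (ζ ^ 2 + ζ + 1) = 0)).resolve_left h1
    linear_combination h.pow_eq_one
  have hr : (2 * ζ + 1) ^ 2 = ((-3 : ℚ) : K) := by
    push_cast
    linear_combination 4 * h0
  refine ⟨2 * ζ + 1, hr, fun q hq => ?_⟩
  rw [hq] at hr
  have : q ^ 2 = -3 := by exact_mod_cast hr
  nlinarith [sq_nonneg q]

/-- The test excludes all quartics whose field has a real quadratic subfield or contains a primitive
third root of unity. -/
theorem hasForbiddenFactorization_of_quartic (h4 : Module.finrank ℚ K = 4) {x : K}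
    (hx : (minpoly ℚ x).natDegree = 4) {a b c : ℤ}
    (hroot : x ^ 4 + a * x ^ 3 + b * x ^ 2 + c * x + 1 = 0) {C : ℕ} (ha : |a| ≤ C)
    (hb : |b| ≤ C) (hc : |c| ≤ C)
    (h : HasRealQuadraticSubfield K ∨ ∃ ζ : K, IsPrimitiveRoot ζ 3) :
    HasForbiddenFactorization (searchBound C) a b c := by
  rcases h with h | ⟨ζ, h⟩
  · obtain ⟨r, D, hr, hD, hrq⟩ := exists_sq_of_hasRealQuadraticSubfield h
    exact hasForbiddenFactorization_of_sq h4 hx hr hrq (Or.inl hD) hroot ha hb hc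
  · obtain ⟨r, hr, hrq⟩ := exists_sq_of_isPrimitiveRoot_three h
    exact hasForbiddenFactorization_of_sq h4 hx hr hrq (Or.inr rfl) hroot ha hb hc

theorem hasRealQuadraticSubfield_of_sq {r : K} {D : ℤ} (hD : 0 ≤ D) (hr : r ^ 2 = D)
    (hrq : ∀ q : ℚ, r ≠ q) : HasRealQuadraticSubfield K := by
  have hint : IsIntegral ℚ r := Algebra.IsIntegral.isIntegral r
  refine hasRealQuadraticSubfield_of_real (x := r) ?_ fun φ => ?_
  · have h1 : (minpoly ℚ r).natDegree ≠ 1 := fun h => by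
      obtain ⟨q, hq⟩ := minpoly.natDegree_eq_one_iff.1 h
      exact hrq q (hq.symm.trans (eq_ratCast _ q))
    have h2 := minpoly.natDegree_pos hint
    have h3 := natDegree_le_two_of_quadratic (x := r) (a := 0) (b := -D) (by simp [hr])
    omega
  · refine star_eq_self_of_sq (D := (D : ℝ)) (by exact_mod_cast hD) ?_
    have := congrArg φ hr
    simpa using this

/-- The converse of `hasForbiddenFactorization_of_quartic`: from
`(2 x² + a x + s)² = X x² + 2 Y x + Z` with `X Z = Y²` one reads off a square root of `X` or, if
`X = 0`, of `Z`. -/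
theorem HasForbiddenFactorization.exists_subfield {x : K}
    (hx : (minpoly ℚ x).natDegree = 4) {a b c : ℤ}
    (hroot : x ^ 4 + a * x ^ 3 + b * x ^ 2 + c * x + 1 = 0) {n : ℕ}
    (h : HasForbiddenFactorization n a b c) :
    HasRealQuadraticSubfield K ∨ ∃ ζ : K, IsPrimitiveRoot ζ 3 := by
  obtain ⟨s, -, hs, hcase⟩ := h
  unfold IsResolventRoot at hs
  obtain ⟨X, hX⟩ : ∃ X, X = a ^ 2 - 4 * b + 4 * s := ⟨_, rfl⟩
  obtain ⟨Y, hY⟩ : ∃ Y, Y = a * s - 2 * c := ⟨_, rfl⟩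
  obtain ⟨Z, hZ⟩ : ∃ Z, Z = s ^ 2 - 4 := ⟨_, rfl⟩
  obtain ⟨w, hw⟩ : ∃ w : K, w = 2 * x ^ 2 + a * x + s := ⟨_, rfl⟩
  rw [← hX, ← hY, ← hZ] at hs
  rw [← hX, ← hZ] at hcase
  have hq : ∀ q : ℚ, w ≠ q := fun q h => by
    have := eq_zero_of_quartic_degree hx (u := s - q) (v := a) (w := 2) (t := 0) (by
      push_cast
      linear_combination h - hw)
    norm_num at this
  have hw0 : w ≠ 0 := fun h => hq 0 (by rw [h, Rat.cast_zero])
  have hw2 : w ^ 2 = X * x ^ 2 + 2 * Y * x + Z := by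
    rw [hw, hX, hY, hZ]
    push_cast
    linear_combination 4 * hroot
  have hsK : (X : K) * Z = Y ^ 2 := by exact_mod_cast hs
  have hXw : (X * x + Y) ^ 2 = X * w ^ 2 := by linear_combination -X * hw2 - hsK
  -- Independence of `1`, `x`, `x²` over `ℚ` shows that the square roots found are irrational.
  have hXq : X ≠ 0 → ∀ q : ℚ, X * x + Y ≠ q * w := fun hX0 q h => by
    have := eq_zero_of_quartic_degree hx (u := Y - q * s) (v := X - q * a) (w := -2 * q) (t := 0)
      (by
        push_cast
        linear_combination h + q * hw)
    obtain ⟨-, h1, h2, -⟩ := this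
    have hq0 : q = 0 := by linarith
    rw [hq0] at h1
    exact hX0 (by simpa using h1)
  have hY0 : X = 0 → w ^ 2 = Z := fun h => by
    rw [h] at hsK hw2
    have : (Y : K) = 0 := by simpa using hsK.symm
    rw [hw2, this]
    simp
  rcases hcase with ⟨hX0, hZ0⟩ | ⟨⟨v, -, hv⟩, t, -, ht⟩
  · left
    by_cases h0 : X = 0
    · exact hasRealQuadraticSubfield_of_sq hZ0 (hY0 h0) hq
    · refine hasRealQuadraticSubfield_of_sq (r := (X * x + Y) / w) hX0 ?_ fun q h => ?_
      · rw [div_pow, hXw, mul_div_cancel_right₀ _ (pow_ne_zero 2 hw0)]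
      · exact hXq h0 q ((div_eq_iff hw0).1 h)
  · right
    have key : ∀ r : K, r ^ 2 = -3 → ∃ ζ : K, IsPrimitiveRoot ζ 3 := fun r hr =>
      ⟨(-1 + r) / 2, isPrimitiveRoot_three (by linear_combination hr / 4)⟩
    by_cases h0 : X = 0
    · have h1 := hY0 h0
      rw [ht] at h1
      push_cast at h1
      have ht0 : (t : K) ≠ 0 := fun h => hw0 (by
        rw [h] at h1
        simpa using h1)
      refine key (w / t) ?_
      rw [div_pow, h1]
      field_simp
    · have hXK : (X : K) ≠ 0 := by exact_mod_cast h0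
      have hv' : (X : K) = -3 * v ^ 2 := by rw [hv]; push_cast; ring
      have hv0 : (v : K) ≠ 0 := fun h => hXK (by rw [hv', h]; ring)
      refine key ((X * x + Y) / (w * v)) ?_
      rw [div_pow, hXw, mul_pow, hv']
      field_simp

theorem isReal_mk_iff_of_adjoin_eq_top {x : K} (hx : ℚ⟮x⟯ = ⊤) (φ : K →+* ℂ) :
    (InfinitePlace.mk φ).IsReal ↔ star (φ x) = φ x := by
  rw [InfinitePlace.isReal_mk_iff, ComplexEmbedding.isReal_iff]
  exact ⟨fun h => DFunLike.congr_fun h x, fun h => ringHom_ext_of_adjoin_eq_top hx h⟩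

theorem exists_embedding_iff (x : K) (z : ℂ) :
    (∃ φ : K →+* ℂ, φ x = z) ↔ aeval z (minpoly ℚ x) = 0 := by
  have h := Embeddings.range_eval_eq_rootSet_minpoly K ℂ x
  have h1 := Set.ext_iff.1 h z
  rw [mem_rootSet_of_ne (minpoly.ne_zero (Algebra.IsIntegral.isIntegral x))] at h1
  exact h1

theorem isTotallyComplex_iff_of_adjoin_eq_top {x : K} (hx : ℚ⟮x⟯ = ⊤) :
    IsTotallyComplex K ↔ ∀ y : ℝ, aeval y (minpoly ℚ x) ≠ 0 := by
  have hy : ∀ y : ℝ, aeval (y : ℂ) (minpoly ℚ x) = (aeval y (minpoly ℚ x) : ℝ) := fun y =>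
    aeval_algebraMap_apply ℂ y (minpoly ℚ x)
  constructor
  · intro h y h0
    obtain ⟨φ, hφ⟩ := (exists_embedding_iff x (y : ℂ)).2 (by rw [hy, h0, Complex.ofReal_zero])
    have h1 := h.isComplex (InfinitePlace.mk φ)
    rw [← InfinitePlace.not_isReal_iff_isComplex, isReal_mk_iff_of_adjoin_eq_top hx, hφ] at h1
    exact h1 (Complex.conj_ofReal y)
  · intro h
    refine ⟨fun w => ?_⟩
    rw [← InfinitePlace.not_isReal_iff_isComplex, ← InfinitePlace.mk_embedding w,
      isReal_mk_iff_of_adjoin_eq_top hx]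
    intro h1
    obtain ⟨y, hy'⟩ := Complex.conj_eq_iff_real.1 h1
    have h2 := (exists_embedding_iff x _).1 ⟨w.embedding, hy'⟩
    rw [hy] at h2
    exact h y (by exact_mod_cast h2)

theorem exists_isComplex_iff_of_adjoin_eq_top {x : K} (hx : ℚ⟮x⟯ = ⊤) :
    (∃ w : InfinitePlace K, w.IsComplex) ↔
      ∃ z : ℂ, aeval z (minpoly ℚ x) = 0 ∧ star z ≠ z := by
  constructor
  · rintro ⟨w, hw⟩
    rw [← InfinitePlace.not_isReal_iff_isComplex, ← InfinitePlace.mk_embedding w,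
      isReal_mk_iff_of_adjoin_eq_top hx] at hw
    exact ⟨_, (exists_embedding_iff x _).1 ⟨w.embedding, rfl⟩, hw⟩
  · rintro ⟨z, hz, hne⟩
    obtain ⟨φ, rfl⟩ := (exists_embedding_iff x z).2 hz
    refine ⟨InfinitePlace.mk φ, ?_⟩
    rwa [← InfinitePlace.not_isReal_iff_isComplex, isReal_mk_iff_of_adjoin_eq_top hx]

end Subfields

/-! ### Irreducibility of the listed polynomials -/

section Irreducibility

open Polynomial

theorem polyOfCoeffs_quadratic (a b : ℤ) :
    polyOfCoeffs [b, a, 1] = (X ^ 2 + C a * X + C b : ℤ[X]).map (algebraMap ℤ ℚ) := by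
  simp only [polyOfCoeffs, Polynomial.map_add, Polynomial.map_mul, Polynomial.map_pow, map_X,
    map_C, algebraMap_int_eq, Int.coe_castRingHom, Int.cast_one, map_one]
  ring

theorem polyOfCoeffs_cubic (a b c : ℤ) :
    polyOfCoeffs [c, b, a, 1] = (cubicPoly a b c).map (algebraMap ℤ ℚ) := by
  simp only [polyOfCoeffs, cubicPoly, Polynomial.map_add, Polynomial.map_mul, Polynomial.map_pow,
    map_X, map_C, algebraMap_int_eq, Int.coe_castRingHom, Int.cast_one, map_one]
  ring

theorem polyOfCoeffs_quartic (a b c d : ℤ) :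
    polyOfCoeffs [d, c, b, a, 1] = (quarticPoly a b c d).map (algebraMap ℤ ℚ) := by
  simp only [polyOfCoeffs, quarticPoly, Polynomial.map_add, Polynomial.map_mul,
    Polynomial.map_pow, map_X, map_C, algebraMap_int_eq, Int.coe_castRingHom, Int.cast_one,
    map_one]
  ring

theorem eval_ne_zero_of_coeff_zero {f : ℤ[X]} (h0 : f.coeff 0 = 1 ∨ f.coeff 0 = -1)
    (h1 : f.eval 1 ≠ 0) (h2 : f.eval (-1) ≠ 0) (x : ℤ) : f.eval x ≠ 0 := by
  intro hx
  have hd : x ∣ f.coeff 0 := by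
    have h := sub_dvd_eval_sub x 0 f
    rw [hx, zero_sub, sub_zero, dvd_neg, ← coeff_zero_eq_eval_zero] at h
    exact h
  have hu : IsUnit x := isUnit_of_dvd_unit hd (by rcases h0 with h | h <;> simp [h])
  rcases Int.isUnit_iff.1 hu with rfl | rfl
  · exact h1 hx
  · exact h2 hx

theorem irreducible_map_of_natDegree_le_three {f : ℤ[X]} (hf : f.Monic) (hd : 2 ≤ f.natDegree)
    (hd' : f.natDegree ≤ 3) (h0 : f.coeff 0 = 1 ∨ f.coeff 0 = -1)
    (h1 : f.eval 1 ≠ 0) (h2 : f.eval (-1) ≠ 0) : Irreducible (f.map (algebraMap ℤ ℚ)) := by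
  rw [← hf.irreducible_iff_irreducible_map_fraction_map,
    hf.irreducible_iff_roots_eq_zero_of_degree_le_three hd hd', Multiset.eq_zero_iff_forall_notMem]
  exact fun x hx => eval_ne_zero_of_coeff_zero h0 h1 h2 x (isRoot_of_mem_roots hx)

/-- An integer quartic with constant term `1` which splits into two quadratic factors over `ℚ` has
a factorization excluded by the test, with `s = 2` or `s = -2`. -/
theorem irreducible_quarticPoly {a b c : ℤ} {n : ℕ} (hn : 2 ≤ n) (h1 : 2 + a + b + c ≠ 0)
    (h2 : 2 - a + b - c ≠ 0) (h : ¬ HasForbiddenFactorization n a b c) :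
    Irreducible ((quarticPoly a b c 1).map (algebraMap ℤ ℚ)) := by
  have hf := isMonicOfDegree_quarticPoly a b c 1
  rw [← hf.monic.irreducible_iff_irreducible_map_fraction_map,
    hf.monic.irreducible_iff_natDegree']
  refine ⟨fun h => ?_, ?_⟩
  · have := hf.natDegree_eq
    rw [h, natDegree_one] at this
    omega
  intro f g hfm hgm hfg hmem
  rw [hf.natDegree_eq, Finset.mem_Ioc] at hmem
  have hsum : f.natDegree + g.natDegree = 4 := by
    rw [← hfm.natDegree_mul hgm, hfg, hf.natDegree_eq]
  have hcases : g.natDegree = 1 ∨ g.natDegree = 2 := by omega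
  rcases hcases with hg | hg
  · obtain ⟨r, rfl⟩ := isMonicOfDegree_one_iff.1 ⟨hg, hgm⟩
    refine eval_ne_zero_of_coeff_zero (f := quarticPoly a b c 1) (Or.inl ?_) ?_ ?_ (-r) ?_
    · simp [quarticPoly]
    · simp only [quarticPoly, eval_add, eval_mul, eval_pow, eval_X, eval_C]
      contrapose! h1
      linarith
    · simp only [quarticPoly, eval_add, eval_mul, eval_pow, eval_X, eval_C]
      contrapose! h2
      linarith
    · rw [← hfg]
      simp
  · obtain ⟨r, s, rfl⟩ := isMonicOfDegree_two_iff.1 ⟨hg, hgm⟩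
    obtain ⟨p, q, rfl⟩ := isMonicOfDegree_two_iff.1 ⟨by omega, hfm⟩
    rw [mul_eq_quarticPoly] at hfg
    obtain ⟨rfl, rfl, rfl, hqs⟩ := quarticPoly_inj hfg
    have hs : (q = 1 ∧ s = 1) ∨ (q = -1 ∧ s = -1) := Int.mul_eq_one_iff_eq_one_or_neg_one.1 hqs
    have hqs' : q = s := by omega
    subst hqs'
    refine h ⟨q + q, mem_intsUpTo.2 ?_, ?_, Or.inl ⟨?_, ?_⟩⟩
    · rcases hs with ⟨rfl, -⟩ | ⟨rfl, -⟩ <;> simp <;> omega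
    · unfold IsResolventRoot
      rcases hs with ⟨rfl, -⟩ | ⟨rfl, -⟩ <;> ring
    · nlinarith [sq_nonneg (p - r)]
    · rcases hs with ⟨rfl, -⟩ | ⟨rfl, -⟩ <;> norm_num

end Irreducibility

/-! ### Listed polynomials define fields of the family -/

section Soundness

open NumberField Polynomial

variable {K : Type*} [Field K] [NumberField K]

omit [NumberField K] in
theorem exists_unit_eq_of_root {x : K} {f : ℤ[X]} (hf : f.Monic)
    (h0 : f.coeff 0 = 1 ∨ f.coeff 0 = -1) (hx : aeval x f = 0) :
    ∃ η : (𝓞 K)ˣ, ((η : 𝓞 K) : K) = x := by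
  have hint : IsIntegral ℤ x := ⟨f, hf, hx⟩
  set y : 𝓞 K := ⟨x, hint⟩ with hy
  have hy0 : aeval y f = 0 := by
    apply FaithfulSMul.algebraMap_injective (𝓞 K) K
    rw [← aeval_algebraMap_apply, map_zero]
    exact hx
  rw [← divX_mul_X_add f, map_add, map_mul, aeval_X, aeval_C] at hy0
  have hu : IsUnit y := by
    rcases h0 with h | h
    · rw [h] at hy0
      refine IsUnit.of_mul_eq_one (-aeval y f.divX) ?_
      simp only [map_one] at hy0
      linear_combination -hy0
    · rw [h] at hy0
      refine IsUnit.of_mul_eq_one (aeval y f.divX) ?_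
      simp only [map_neg, map_one] at hy0
      linear_combination hy0
  obtain ⟨η, hη⟩ := hu
  exact ⟨η, congrArg (algebraMap (𝓞 K) K) hη⟩

omit [NumberField K] in
theorem mem_torsion_of_pow_eq_one {η : (𝓞 K)ˣ} {n : ℕ} (hn : 0 < n) (h : η ^ n = 1) :
    η ∈ Units.torsion K :=
  (isOfFinOrder_iff_pow_eq_one).2 ⟨n, hn, h⟩

theorem eq_one_or_neg_one_of_real {η : (𝓞 K)ˣ} (h : η ∈ Units.torsion K) {φ : K →+* ℂ}
    (hφ : star (φ (η : 𝓞 K)) = φ (η : 𝓞 K)) : ((η : 𝓞 K) : K) = 1 ∨ ((η : 𝓞 K) : K) = -1 := by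
  have h2 := norm_eq_one_of_mem_torsion h φ
  obtain ⟨r, hr⟩ := Complex.conj_eq_iff_real.1 hφ
  rw [hr, Complex.norm_real, Real.norm_eq_abs, abs_eq zero_le_one] at h2
  refine h2.imp (fun h => φ.injective ?_) fun h => φ.injective ?_ <;> rw [hr, h] <;> simp

theorem aeval_eq_zero_of_minpoly_eq {x : K} {f : ℤ[X]}
    (h : minpoly ℚ x = f.map (algebraMap ℤ ℚ)) : aeval x f = 0 := by
  rw [← aeval_map_algebraMap ℚ, ← h, minpoly.aeval]

theorem finrank_eq_of_minpoly_eq {x : K} (hx : ℚ⟮x⟯ = ⊤) {f : ℤ[X]} {n : ℕ}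
    (hf : IsMonicOfDegree f n) (h : minpoly ℚ x = f.map (algebraMap ℤ ℚ)) :
    Module.finrank ℚ K = n ∧ (minpoly ℚ x).natDegree = n := by
  have h1 : (minpoly ℚ x).natDegree = n := by rw [h, hf.monic.natDegree_map, hf.natDegree_eq]
  exact ⟨by rw [← (Field.primitive_element_iff_minpoly_natDegree_eq ℚ x).1 hx, h1], h1⟩

theorem ell_le_of_hasSmallRelation {k : ℕ} {p : Quad} (h : HasSmallRelation k p) {η : (𝓞 K)ˣ}
    (hη : ∀ n : ℕ, 0 < n → η ^ n ≠ 1) (hroot : IsQuarticRoot p ((η : 𝓞 K) : K)) :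
    ell K ≤ k := by
  obtain ⟨l, h1, h2, h3⟩ := h.exists_list hroot (Units.coe_ne_zero η)
  exact ell_le_of_sq_add_sq hη h1 h2 h3

theorem QuadraticTest.irreducible {p : Quad} (h : QuadraticTest p) :
    Irreducible ((X ^ 2 + C p.1 * X + C p.2.1 : ℤ[X]).map (algebraMap ℤ ℚ)) := by
  obtain ⟨-, -, h0, h1, h2, -⟩ := h
  have hf := isMonicOfDegree_add_add_two p.1 p.2.1
  refine irreducible_map_of_natDegree_le_three hf.monic hf.natDegree_eq.ge
    (hf.natDegree_eq.trans_le (by norm_num)) (by simpa using h0) ?_ ?_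
  · simpa using h1
  · simp only [eval_add, eval_mul, eval_pow, eval_X, eval_C]
    contrapose! h2
    linarith

theorem QuadraticTest.inFamily_and_ell_le {p : Quad} (h : QuadraticTest p) {k : ℕ}
    (hrel : HasSmallRelation k p) {x : K} (hx : ℚ⟮x⟯ = ⊤)
    (hmin : minpoly ℚ x = (X ^ 2 + C p.1 * X + C p.2.1 : ℤ[X]).map (algebraMap ℤ ℚ)) :
    InFamily K ∧ ell K ≤ k := by
  obtain ⟨hc, hd, h0, h1, h2, hD⟩ := h
  have hf := isMonicOfDegree_add_add_two p.1 p.2.1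
  have hroot := aeval_eq_zero_of_minpoly_eq hmin
  obtain ⟨hrank, hdeg⟩ := finrank_eq_of_minpoly_eq hx hf hmin
  obtain ⟨η, rfl⟩ := exists_unit_eq_of_root hf.monic (by simpa using h0) hroot
  simp only [map_add, map_mul, map_pow, aeval_X, aeval_C] at hroot
  simp only [eq_intCast] at hroot
  refine ⟨Or.inl hrank, ell_le_of_hasSmallRelation hrel (η := η) (fun n hn hpow => ?_) ?_⟩
  · obtain ⟨w⟩ : Nonempty (InfinitePlace K) := inferInstance
    have hreal : star (w.embedding (η : 𝓞 K)) = w.embedding (η : 𝓞 K) := by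
      have h3 : (2 * w.embedding (η : 𝓞 K) + p.1) ^ 2 = ((p.1 ^ 2 - 4 * p.2.1 : ℤ) : ℝ) := by
        have := congrArg w.embedding hroot
        simp only [map_add, map_mul, map_pow, map_intCast, map_zero] at this
        push_cast
        linear_combination 4 * this
      have h4 := star_eq_self_of_sq (by exact_mod_cast hD.le) h3
      simp only [star_add, star_mul', star_ofNat, RCLike.star_def, map_intCast] at h4 ⊢
      linear_combination h4 / 2
    rcases eq_one_or_neg_one_of_real (mem_torsion_of_pow_eq_one hn hpow) hreal with h | h
    · rw [h] at hroot
      have : (1 + p.1 + p.2.1 : K) = 0 := by linear_combination hroot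
      exact h1 (by exact_mod_cast this)
    · rw [h] at hroot
      have : (1 - p.1 + p.2.1 : K) = 0 := by linear_combination hroot
      exact h2 (by exact_mod_cast this)
  · rw [IsQuarticRoot, hc, hd]
    push_cast
    linear_combination ((η : 𝓞 K) : K) ^ 2 * hroot

theorem CubicTest.irreducible {p : Quad} (h : CubicTest p) :
    Irreducible ((cubicPoly p.1 p.2.1 p.2.2.1).map (algebraMap ℤ ℚ)) := by
  obtain ⟨-, h0, h1, h2, -⟩ := h
  have hf := isMonicOfDegree_cubicPoly p.1 p.2.1 p.2.2.1
  refine irreducible_map_of_natDegree_le_three hf.monic (hf.natDegree_eq.ge.trans' (by norm_num))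
    hf.natDegree_eq.le (by simpa [cubicPoly] using h0) ?_ ?_
  · simpa [cubicPoly] using h1
  · simp only [cubicPoly, eval_add, eval_mul, eval_pow, eval_X, eval_C]
    contrapose! h2
    linarith

theorem aeval_cubicPoly_map {A : Type*} [Field A] [CharZero A] (z : A) (a b c : ℤ) :
    aeval z ((cubicPoly a b c).map (algebraMap ℤ ℚ)) = z ^ 3 + a * z ^ 2 + b * z + c := by
  rw [aeval_map_algebraMap]
  simp [cubicPoly]

theorem aeval_quarticPoly_map {A : Type*} [Field A] [CharZero A] (z : A) (a b c d : ℤ) :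
    aeval z ((quarticPoly a b c d).map (algebraMap ℤ ℚ)) =
      z ^ 4 + a * z ^ 3 + b * z ^ 2 + c * z + d := by
  rw [aeval_map_algebraMap]
  simp [quarticPoly]

theorem exists_isComplex_iff_disc {x : K} (hx : ℚ⟮x⟯ = ⊤) {a b c : ℤ}
    (hmin : minpoly ℚ x = (cubicPoly a b c).map (algebraMap ℤ ℚ)) :
    (∃ w : InfinitePlace K, w.IsComplex) ↔
      a ^ 2 * b ^ 2 - 4 * b ^ 3 - 4 * a ^ 3 * c + 18 * a * b * c - 27 * c ^ 2 < 0 := by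
  rw [exists_isComplex_iff_of_adjoin_eq_top hx, hmin]
  have h := exists_nonreal_root_iff (a : ℝ) b c
  simp only [Complex.ofReal_intCast] at h
  simp only [aeval_cubicPoly_map]
  rw [h]
  norm_cast

theorem isTotallyComplex_iff_definiteTest {x : K} (hx : ℚ⟮x⟯ = ⊤) {a b c : ℤ}
    (hmin : minpoly ℚ x = (quarticPoly a b c 1).map (algebraMap ℤ ℚ)) :
    IsTotallyComplex K ↔ DefiniteTest a b c := by
  have hsq : Squarefree (quarticPoly (a : ℝ) b c 1) := by
    have hirr := minpoly.irreducible (Algebra.IsIntegral.isIntegral (R := ℚ) x)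
    have h1 := (hirr.separable.map (f := algebraMap ℚ ℝ)).squarefree
    rw [hmin, Polynomial.map_map] at h1
    simpa [quarticPoly] using h1
  rw [isTotallyComplex_iff_of_adjoin_eq_top hx, definiteTest_iff hsq, hmin]
  simp only [aeval_quarticPoly_map, Int.cast_one]

theorem CubicTest.inFamily_and_ell_le {p : Quad} (h : CubicTest p) {k : ℕ}
    (hrel : HasSmallRelation k p) {x : K} (hx : ℚ⟮x⟯ = ⊤)
    (hmin : minpoly ℚ x = (cubicPoly p.1 p.2.1 p.2.2.1).map (algebraMap ℤ ℚ)) :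
    InFamily K ∧ ell K ≤ k := by
  obtain ⟨hd, h0, h1, h2, hD⟩ := h
  have hf := isMonicOfDegree_cubicPoly p.1 p.2.1 p.2.2.1
  have hroot := aeval_eq_zero_of_minpoly_eq hmin
  obtain ⟨hrank, hdeg⟩ := finrank_eq_of_minpoly_eq hx hf hmin
  have hc := (exists_isComplex_iff_disc hx hmin).2 hD
  obtain ⟨η, rfl⟩ := exists_unit_eq_of_root hf.monic (by simpa [cubicPoly] using h0) hroot
  simp only [cubicPoly, map_add, map_mul, map_pow, aeval_X, aeval_C] at hroot
  simp only [eq_intCast] at hroot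
  refine ⟨Or.inr (Or.inl ⟨hrank, hc⟩),
    ell_le_of_hasSmallRelation hrel (η := η) (fun n hn hpow => ?_) ?_⟩
  · rcases Units.torsion_eq_one_or_neg_one_of_odd_finrank (by rw [hrank]; decide)
      ⟨η, mem_torsion_of_pow_eq_one hn hpow⟩ with h | h
    · simp only at h
      rw [h] at hroot
      have : (1 + p.1 + p.2.1 + p.2.2.1 : K) = 0 := by
        push_cast at hroot
        linear_combination hroot
      exact h1 (by exact_mod_cast this)
    · simp only at h
      rw [h] at hroot
      have : (-1 + p.1 - p.2.1 + p.2.2.1 : K) = 0 := by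
        push_cast at hroot
        linear_combination hroot
      exact h2 (by exact_mod_cast this)
  · rw [IsQuarticRoot, hd]
    push_cast
    linear_combination ((η : 𝓞 K) : K) * hroot

theorem two_le_searchBound (C : ℕ) : 2 ≤ searchBound C := by
  have : 1 ≤ (C + 1) ^ 2 := Nat.one_le_pow _ _ (by omega)
  unfold searchBound
  omega

theorem QuarticTest.irreducible {k : ℕ} {p : Quad} (h : QuarticTest k p) :
    Irreducible ((quarticPoly p.1 p.2.1 p.2.2.1 1).map (algebraMap ℤ ℚ)) := by
  obtain ⟨-, h1, h2, -, h3⟩ := h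
  exact irreducible_quarticPoly (two_le_searchBound _) h1 h2 h3

theorem QuarticTest.inFamily_and_ell_le {k : ℕ} {p : Quad} (h : QuarticTest k p)
    (ha : |p.1| ≤ coeffBound k) (hb : |p.2.1| ≤ coeffBound k) (hc : |p.2.2.1| ≤ coeffBound k)
    (hrel : HasSmallRelation k p) {x : K} (hx : ℚ⟮x⟯ = ⊤)
    (hmin : minpoly ℚ x = (quarticPoly p.1 p.2.1 p.2.2.1 1).map (algebraMap ℤ ℚ)) :
    InFamily K ∧ ell K ≤ k := by
  obtain ⟨hd, h1, h2, hD, hF⟩ := h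
  have hf := isMonicOfDegree_quarticPoly p.1 p.2.1 p.2.2.1 1
  have hroot := aeval_eq_zero_of_minpoly_eq hmin
  obtain ⟨hrank, hdeg⟩ := finrank_eq_of_minpoly_eq hx hf hmin
  have htc := (isTotallyComplex_iff_definiteTest hx hmin).2 hD
  obtain ⟨η, rfl⟩ := exists_unit_eq_of_root hf.monic (by simp [quarticPoly]) hroot
  simp only [quarticPoly, map_add, map_mul, map_pow, aeval_X, aeval_C, map_one] at hroot
  simp only [eq_intCast] at hroot
  have hno := mt (hasForbiddenFactorization_of_quartic hrank hdeg hroot ha hb hc) hF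
  push Not at hno
  refine ⟨Or.inr (Or.inr ⟨⟨hrank, htc⟩, hno.1, not_exists.2 hno.2⟩),
    ell_le_of_hasSmallRelation hrel (η := η) (fun n hn hpow => ?_) ?_⟩
  · have := natDegree_le_two_of_mem_torsion hrank htc hno.1 (mem_torsion_of_pow_eq_one hn hpow)
    omega
  · rw [IsQuarticRoot, hd]
    push_cast
    exact hroot

omit [NumberField K] in
theorem ell_le_three {ζ : (𝓞 K)ˣ} (h : (ζ : 𝓞 K) ^ 2 + ζ + 1 = 0) : ell K ≤ 3 := by
  refine (min_le_left _ _).trans (sInf_le ⟨3, rfl, le_rfl, by decide, ![1, ζ, ζ ^ 2], ?_⟩)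
  rw [Fin.sum_univ_three]
  simp only [Matrix.cons_val_zero, Matrix.cons_val_one, Matrix.cons_val, Units.val_one,
    Units.val_pow_eq_pow_val]
  linear_combination h

theorem inFamily_and_ell_le_of_cyclotomic {x : K} (hx : ℚ⟮x⟯ = ⊤)
    (hmin : minpoly ℚ x = (X ^ 2 + C 1 * X + C 1 : ℤ[X]).map (algebraMap ℤ ℚ)) :
    InFamily K ∧ ell K ≤ 3 := by
  have hf := isMonicOfDegree_add_add_two (1 : ℤ) 1
  have hroot := aeval_eq_zero_of_minpoly_eq hmin
  obtain ⟨hrank, hdeg⟩ := finrank_eq_of_minpoly_eq hx hf hmin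
  obtain ⟨ζ, rfl⟩ := exists_unit_eq_of_root hf.monic (by simp) hroot
  refine ⟨Or.inl hrank, ell_le_three (ζ := ζ) ?_⟩
  apply FaithfulSMul.algebraMap_injective (𝓞 K) K
  simpa using hroot

theorem mem_candidates {n : ℕ} {p : Quad} :
    p ∈ candidates n ↔ |p.1| ≤ n ∧ |p.2.1| ≤ n ∧ |p.2.2.1| ≤ n ∧ |p.2.2.2| ≤ n := by
  obtain ⟨a, b, c, d⟩ := p
  simp [candidates, mem_intsUpTo]

theorem mem_fieldList {k : ℕ} {l : List ℤ} :
    l ∈ fieldList k ↔ l = [1, 1, 1] ∨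
      ∃ p ∈ candidates (coeffBound k), Accepted k p ∧ outputCoeffs p = l := by
  simp [fieldList, and_assoc]

theorem QuadraticTest.polyOfCoeffs_eq {p : Quad} (h : QuadraticTest p) :
    polyOfCoeffs (outputCoeffs p) =
      (X ^ 2 + C p.1 * X + C p.2.1 : ℤ[X]).map (algebraMap ℤ ℚ) := by
  rw [outputCoeffs, if_pos h.2.1, if_pos h.1, polyOfCoeffs_quadratic]

theorem CubicTest.polyOfCoeffs_eq {p : Quad} (h : CubicTest p) :
    polyOfCoeffs (outputCoeffs p) = (cubicPoly p.1 p.2.1 p.2.2.1).map (algebraMap ℤ ℚ) := by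
  have hc : p.2.2.1 ≠ 0 := by
    rcases h.2.1 with h | h <;> omega
  rw [outputCoeffs, if_pos h.1, if_neg hc, polyOfCoeffs_cubic]

theorem QuarticTest.polyOfCoeffs_eq {k : ℕ} {p : Quad} (h : QuarticTest k p) :
    polyOfCoeffs (outputCoeffs p) = (quarticPoly p.1 p.2.1 p.2.2.1 1).map (algebraMap ℤ ℚ) := by
  have hd : p.2.2.2 ≠ 0 := by rw [h.1]; norm_num
  rw [outputCoeffs, if_neg hd, polyOfCoeffs_quartic, h.1]

theorem monic_and_irreducible_of_mem_fieldList {k : ℕ} {l : List ℤ} (hl : l ∈ fieldList k) :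
    (polyOfCoeffs l).Monic ∧ Irreducible (polyOfCoeffs l) := by
  rcases mem_fieldList.1 hl with rfl | ⟨p, -, ⟨h | h | h, -⟩, rfl⟩
  · have hf := isMonicOfDegree_add_add_two (1 : ℤ) 1
    rw [polyOfCoeffs_quadratic]
    refine ⟨hf.monic.map _, irreducible_map_of_natDegree_le_three hf.monic hf.natDegree_eq.ge
      (hf.natDegree_eq.trans_le (by norm_num)) ?_ ?_ ?_⟩ <;> simp
  · rw [h.polyOfCoeffs_eq]
    exact ⟨(isMonicOfDegree_add_add_two _ _).monic.map _, h.irreducible⟩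
  · rw [h.polyOfCoeffs_eq]
    exact ⟨(isMonicOfDegree_cubicPoly _ _ _).monic.map _, h.irreducible⟩
  · rw [h.polyOfCoeffs_eq]
    exact ⟨(isMonicOfDegree_quarticPoly _ _ _ _).monic.map _, h.irreducible⟩

/-- A field defined by a listed polynomial belongs to the family, and the root is a unit of infinite
order (or a third root of unity), so that the relation found by the search bounds `ell`. -/
theorem inFamily_and_ell_le_of_mem_fieldList {k : ℕ} (hk : 3 ≤ k) {l : List ℤ}
    (hl : l ∈ fieldList k) (hK : IsDefinedBy K (polyOfCoeffs l)) : InFamily K ∧ ell K ≤ k := by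
  obtain ⟨x, hx, hmin⟩ := hK
  rcases mem_fieldList.1 hl with rfl | ⟨p, hp, ⟨h | h | h, hrel⟩, rfl⟩
  · rw [polyOfCoeffs_quadratic] at hmin
    exact (inFamily_and_ell_le_of_cyclotomic hx hmin).imp_right fun h =>
      h.trans (by exact_mod_cast hk)
  · rw [h.polyOfCoeffs_eq] at hmin
    exact h.inFamily_and_ell_le hrel hx hmin
  · rw [h.polyOfCoeffs_eq] at hmin
    exact h.inFamily_and_ell_le hrel hx hmin
  · rw [h.polyOfCoeffs_eq] at hmin
    rw [mem_candidates] at hp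
    exact h.inFamily_and_ell_le hp.1 hp.2.1 hp.2.2.1 hrel hx hmin

end Soundness

/-! ### All fields of the family are found -/

section Completeness

open NumberField Polynomial

variable {K : Type*} [Field K] [NumberField K]

/-- The coefficients of the minimal polynomial are elementary symmetric functions of at most four
conjugates, each less than `k + 1` in absolute value. -/
theorem IsRelation.abs_coeff_le {k : ℕ} {η j : 𝓞 K} {l : List (ℤ × ℤ)} (h : IsRelation k η j l)
    (hd : Module.finrank ℚ K ≤ 4) (i : ℕ) : |(minpoly ℤ (η : K)).coeff i| ≤ coeffBound k := by
  have h1 := Embeddings.coeff_bdd_of_norm_le (A := ℂ) (x := (η : K)) (B := (k : ℝ) + 1)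
    (fun φ => (h.norm_lt φ).le) i
  rw [minpoly_rat_eq_map, coeff_map, algebraMap_int_eq, eq_intCast, Int.norm_cast_rat,
    Int.norm_eq_abs, max_eq_left (by linarith [k.cast_nonneg (α := ℝ)])] at h1
  have h2 : (Module.finrank ℚ K).choose (Module.finrank ℚ K / 2) ≤ 6 := by
    interval_cases Module.finrank ℚ K <;> decide
  have h3 : ((k : ℝ) + 1) ^ Module.finrank ℚ K ≤ ((k : ℝ) + 1) ^ 4 :=
    pow_le_pow_right₀ (by linarith [k.cast_nonneg (α := ℝ)]) hd
  have h4 : |(((minpoly ℤ (η : K)).coeff i : ℤ) : ℝ)| ≤ (coeffBound k : ℝ) := by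
    refine h1.trans ?_
    unfold coeffBound
    push_cast
    rw [mul_comm]
    gcongr
    exact_mod_cast h2
  exact_mod_cast h4

theorem eval_minpoly_ne_zero {η : 𝓞 K} (hd : 2 ≤ (minpoly ℚ (η : K)).natDegree) (n : ℤ) :
    (minpoly ℤ (η : K)).eval n ≠ 0 := by
  intro h
  have h1 : (minpoly ℚ (η : K)).IsRoot (n : ℚ) := by
    rw [minpoly_rat_eq_map, IsRoot, ← eq_intCast (algebraMap ℤ ℚ) n, eval_map_algebraMap,
      aeval_algebraMap_apply, coe_aeval_eq_eval, h, map_zero]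
  have h2 := minpoly.root (Algebra.IsIntegral.isIntegral (R := ℚ) (η : K)) h1
  have h3 := minpoly.natDegree_eq_one_iff.2 ⟨_, h2⟩
  omega

/-- The hypothesis `hker` says that a residue modulo the quartic `p` which vanishes at `η` is killed
by `X²`: for `η` of degree `2` or `3` the quartic is `X²` or `X` times the minimal polynomial. -/
theorem exists_mem_fieldList_of_candidate {k : ℕ} {p : Quad} {η : (𝓞 K)ˣ}
    (hadj : ℚ⟮((η : 𝓞 K) : K)⟯ = ⊤) (hp : p ∈ candidates (coeffBound k))
    (htest : QuadraticTest p ∨ CubicTest p ∨ QuarticTest k p)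
    (hmin : minpoly ℚ ((η : 𝓞 K) : K) = polyOfCoeffs (outputCoeffs p))
    (hη : IsQuarticRoot p ((η : 𝓞 K) : K))
    (hker : ∀ v : Quad, quadEval ((η : 𝓞 K) : K) v = 0 → mulX p (mulX p v) = 0)
    {j : 𝓞 K} {l : List (ℤ × ℤ)} (h : IsRelation k (η : 𝓞 K) j l)
    (hlen : l.length ≤ lengthBound k) :
    ∃ c ∈ fieldList k, IsDefinedBy K (polyOfCoeffs c) := by
  have hrel := hasSmallRelation_of_list hη hker hlen h.weight_pos h.weight_le h.sq_add_sq
  exact ⟨outputCoeffs p, mem_fieldList.2 (Or.inr ⟨p, hp, ⟨htest, hrel⟩, rfl⟩), _, hadj, hmin⟩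

theorem exists_mem_fieldList_of_finrank_two {k : ℕ} (hd : Module.finrank ℚ K = 2)
    (h3 : ¬ ∃ ζ : K, IsPrimitiveRoot ζ 3) {η : (𝓞 K)ˣ} (hη : ∀ n : ℕ, 0 < n → η ^ n ≠ 1)
    (hadj : ℚ⟮((η : 𝓞 K) : K)⟯ = ⊤) {j : 𝓞 K} {l : List (ℤ × ℤ)}
    (h : IsRelation k (η : 𝓞 K) j l) (hlen : l.length ≤ lengthBound k) :
    ∃ c ∈ fieldList k, IsDefinedBy K (polyOfCoeffs c) := by
  have hdeg := ((Field.primitive_element_iff_minpoly_natDegree_eq ℚ _).1 hadj).trans hd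
  have hb := h.abs_coeff_le (by omega)
  have h0 := coeff_zero_minpoly_unit η
  have h1 := eval_minpoly_ne_zero hdeg.ge 1
  have h2 := eval_minpoly_ne_zero hdeg.ge (-1)
  have hmin := minpoly_rat_eq_map (η : 𝓞 K)
  have hroot := minpoly.aeval ℤ ((η : 𝓞 K) : K)
  obtain ⟨a, b, hab⟩ := isMonicOfDegree_two_iff.1
    ⟨(natDegree_minpoly_int _).trans hdeg, minpoly.monic (RingOfIntegers.isIntegral_coe (η : 𝓞 K))⟩
  have hb0 := hb 0
  have hb1 := hb 1
  rw [hab] at h0 h1 h2 hmin hroot hb0 hb1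
  simp [coeff_X, coeff_C, -eq_intCast] at h0 h1 h2 hb0 hb1
  simp only [map_add, map_mul, map_pow, aeval_X, aeval_C] at hroot
  simp only [eq_intCast] at hroot
  have hD : 0 < a ^ 2 - 4 * b := by
    have hreal : 0 ≤ a ^ 2 - 4 * b := by
      rcases pow_four_eq_one_or_real hdeg.le h3 with h4 | ⟨-, h4⟩
      · exact absurd h4 (hη 4 (by norm_num))
      obtain ⟨w⟩ : Nonempty (InfinitePlace K) := inferInstance
      obtain ⟨r, hr⟩ := Complex.conj_eq_iff_real.1 (h4 w.embedding)
      have h5 := congrArg w.embedding hroot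
      simp only [map_add, map_mul, map_pow, map_intCast, map_zero] at h5
      rw [hr] at h5
      have h6 : r ^ 2 + a * r + b = 0 := by exact_mod_cast h5
      have h7 : (0 : ℝ) ≤ a ^ 2 - 4 * b := by nlinarith [sq_nonneg (2 * r + a)]
      exact_mod_cast h7
    -- A vanishing discriminant would mean that `η` is `1` or `-1`.
    refine lt_of_le_of_ne hreal fun h5 => ?_
    rcases h0 with rfl | rfl
    · have h6 : (a - 2) * (a + 2) = 0 := by linear_combination -h5
      rcases mul_eq_zero.1 h6 with h7 | h7
      · exact h2 (by linear_combination -h7)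
      · exact h1 (by linear_combination h7)
    · nlinarith [sq_nonneg a]
  have htest : QuadraticTest (a, b, 0, 0) :=
    ⟨rfl, rfl, h0, h1, fun h => h2 (by linear_combination h), hD⟩
  refine exists_mem_fieldList_of_candidate (p := (a, b, 0, 0)) hadj
    (mem_candidates.2 ⟨hb1, hb0, by simp, by simp⟩) (Or.inl htest)
    (hmin.trans htest.polyOfCoeffs_eq.symm) ?_ (fun v hv => ?_) h hlen
  · rw [IsQuarticRoot]
    push_cast
    linear_combination ((η : 𝓞 K) : K) ^ 2 * hroot
  · obtain ⟨v0, v1, v2, v3⟩ := v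
    simp only [quadEval] at hv
    obtain ⟨e0, e1⟩ := eq_zero_of_quadratic_degree hdeg (u := v0 - b * (v2 - a * v3))
      (v := v1 - b * v3 - a * (v2 - a * v3)) (by
        push_cast
        linear_combination hv - (v3 * ((η : 𝓞 K) : K) + (v2 - a * v3)) * hroot)
    have e0' : v0 - b * (v2 - a * v3) = 0 := by exact_mod_cast e0
    have e1' : v1 - b * v3 - a * (v2 - a * v3) = 0 := by exact_mod_cast e1
    simp [mulX, e0', e1']

theorem exists_mem_fieldList_of_finrank_three {k : ℕ} (hd : Module.finrank ℚ K = 3)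
    (hc : ∃ w : InfinitePlace K, w.IsComplex) {η : (𝓞 K)ˣ}
    (hadj : ℚ⟮((η : 𝓞 K) : K)⟯ = ⊤) {j : 𝓞 K} {l : List (ℤ × ℤ)}
    (h : IsRelation k (η : 𝓞 K) j l) (hlen : l.length ≤ lengthBound k) :
    ∃ c ∈ fieldList k, IsDefinedBy K (polyOfCoeffs c) := by
  have hdeg := ((Field.primitive_element_iff_minpoly_natDegree_eq ℚ _).1 hadj).trans hd
  have hb := h.abs_coeff_le (by omega)
  have h0 := coeff_zero_minpoly_unit η
  have h1 := eval_minpoly_ne_zero (η := (η : 𝓞 K)) (by omega) 1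
  have h2 := eval_minpoly_ne_zero (η := (η : 𝓞 K)) (by omega) (-1)
  have hmin := minpoly_rat_eq_map (η : 𝓞 K)
  have hroot := minpoly.aeval ℤ ((η : 𝓞 K) : K)
  have hf := eq_cubicPoly
    ⟨(natDegree_minpoly_int _).trans hdeg, minpoly.monic (RingOfIntegers.isIntegral_coe (η : 𝓞 K))⟩
  obtain ⟨a, ha⟩ : ∃ a, a = (minpoly ℤ ((η : 𝓞 K) : K)).coeff 2 := ⟨_, rfl⟩
  obtain ⟨b, hb'⟩ : ∃ a, a = (minpoly ℤ ((η : 𝓞 K) : K)).coeff 1 := ⟨_, rfl⟩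
  obtain ⟨c, hc'⟩ : ∃ a, a = (minpoly ℤ ((η : 𝓞 K) : K)).coeff 0 := ⟨_, rfl⟩
  rw [← ha, ← hb', ← hc'] at hf
  rw [← hc'] at h0
  have hba := hb 2
  have hbb := hb 1
  have hbc := hb 0
  rw [← ha] at hba
  rw [← hb'] at hbb
  rw [← hc'] at hbc
  rw [hf] at h1 h2 hmin hroot
  simp only [cubicPoly, eval_add, eval_mul, eval_pow, eval_X, eval_C] at h1 h2
  have hD := (exists_isComplex_iff_disc hadj hmin).1 hc
  simp only [cubicPoly, map_add, map_mul, map_pow, aeval_X, aeval_C] at hroot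
  simp only [eq_intCast] at hroot
  have htest : CubicTest (a, b, c, 0) :=
    ⟨rfl, h0, fun h => h1 (by linear_combination h), fun h => h2 (by linear_combination h), hD⟩
  refine exists_mem_fieldList_of_candidate (p := (a, b, c, 0)) hadj
    (mem_candidates.2 ⟨hba, hbb, hbc, by simp⟩) (Or.inr (Or.inl htest))
    (hmin.trans htest.polyOfCoeffs_eq.symm) ?_ (fun v hv => ?_) h hlen
  · rw [IsQuarticRoot]
    push_cast
    linear_combination ((η : 𝓞 K) : K) * hroot
  · obtain ⟨v0, v1, v2, v3⟩ := v
    simp only [quadEval] at hv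
    obtain ⟨e0, e1, e2⟩ := eq_zero_of_cubic_degree hdeg (u := v0 - c * v3) (v := v1 - b * v3)
      (w := v2 - a * v3) (by
        push_cast
        linear_combination hv - v3 * hroot)
    have e0' : v0 - c * v3 = 0 := by exact_mod_cast e0
    have e1' : v1 - b * v3 = 0 := by exact_mod_cast e1
    have e2' : v2 - a * v3 = 0 := by exact_mod_cast e2
    simp [mulX, e0', e1', e2']

theorem exists_mem_fieldList_of_finrank_four {k : ℕ} (hd : Module.finrank ℚ K = 4)
    (hc : IsTotallyComplex K) (hr : ¬ HasRealQuadraticSubfield K)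
    (h3 : ¬ ∃ ζ : K, IsPrimitiveRoot ζ 3) {η : (𝓞 K)ˣ}
    (hadj : ℚ⟮((η : 𝓞 K) : K)⟯ = ⊤) {j : 𝓞 K} {l : List (ℤ × ℤ)}
    (h : IsRelation k (η : 𝓞 K) j l) (hlen : l.length ≤ lengthBound k) :
    ∃ c ∈ fieldList k, IsDefinedBy K (polyOfCoeffs c) := by
  have hdeg := ((Field.primitive_element_iff_minpoly_natDegree_eq ℚ _).1 hadj).trans hd
  have hb := h.abs_coeff_le (by omega)
  have h0 := coeff_zero_minpoly_unit η
  have h1 := eval_minpoly_ne_zero (η := (η : 𝓞 K)) (by omega) 1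
  have h2 := eval_minpoly_ne_zero (η := (η : 𝓞 K)) (by omega) (-1)
  have hmin := minpoly_rat_eq_map (η : 𝓞 K)
  have hroot := minpoly.aeval ℤ ((η : 𝓞 K) : K)
  have hf := eq_quarticPoly
    ⟨(natDegree_minpoly_int _).trans hdeg, minpoly.monic (RingOfIntegers.isIntegral_coe (η : 𝓞 K))⟩
  obtain ⟨a, ha⟩ : ∃ a, a = (minpoly ℤ ((η : 𝓞 K) : K)).coeff 3 := ⟨_, rfl⟩
  obtain ⟨b, hb'⟩ : ∃ a, a = (minpoly ℤ ((η : 𝓞 K) : K)).coeff 2 := ⟨_, rfl⟩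
  obtain ⟨c, hc'⟩ : ∃ a, a = (minpoly ℤ ((η : 𝓞 K) : K)).coeff 1 := ⟨_, rfl⟩
  obtain ⟨d, hd'⟩ : ∃ a, a = (minpoly ℤ ((η : 𝓞 K) : K)).coeff 0 := ⟨_, rfl⟩
  rw [← ha, ← hb', ← hc', ← hd'] at hf
  rw [← hd'] at h0
  have hba := hb 3
  have hbb := hb 2
  have hbc := hb 1
  have hbd := hb 0
  rw [← ha] at hba
  rw [← hb'] at hbb
  rw [← hc'] at hbc
  rw [← hd'] at hbd
  rw [hf] at h1 h2 hmin hroot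
  have hnoroot := (isTotallyComplex_iff_of_adjoin_eq_top hadj).1 hc
  simp only [hmin, aeval_quarticPoly_map] at hnoroot
  have hd1 : d = 1 := by
    have := constant_pos_of_no_real_root hnoroot
    have : 0 < d := by exact_mod_cast this
    omega
  subst hd1
  simp only [quarticPoly, eval_add, eval_mul, eval_pow, eval_X, eval_C] at h1 h2
  have hD := (isTotallyComplex_iff_definiteTest hadj hmin).1 hc
  simp only [quarticPoly, map_add, map_mul, map_pow, aeval_X, aeval_C, map_one] at hroot
  simp only [eq_intCast] at hroot
  have htest : QuarticTest k (a, b, c, 1) :=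
    ⟨rfl, fun h => h1 (by linear_combination h), fun h => h2 (by linear_combination h), hD,
      fun hF => (hF.exists_subfield hdeg hroot).elim hr h3⟩
  refine exists_mem_fieldList_of_candidate (p := (a, b, c, 1)) hadj
    (mem_candidates.2 ⟨hba, hbb, hbc, hbd⟩) (Or.inr (Or.inr htest))
    (hmin.trans htest.polyOfCoeffs_eq.symm) ?_ (fun v hv => ?_) h hlen
  · rw [IsQuarticRoot]
    push_cast
    exact hroot
  · obtain ⟨v0, v1, v2, v3⟩ := v
    simp only [quadEval] at hv
    obtain ⟨e0, e1, e2, e3⟩ := eq_zero_of_quartic_degree hdeg (u := v0) (v := v1)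
      (w := v2) (t := v3) (by exact_mod_cast hv)
    rw [Rat.intCast_eq_zero_iff] at e0 e1 e2 e3
    simp [mulX, e0, e1, e2, e3]

theorem isDefinedBy_of_isPrimitiveRoot_three (hK : InFamily K) {ζ : K}
    (h : IsPrimitiveRoot ζ 3) : IsDefinedBy K (polyOfCoeffs [1, 1, 1]) := by
  have h0 : ζ ^ 2 + ζ + 1 = 0 := by
    have h1 : ζ - 1 ≠ 0 := sub_ne_zero.2 (h.ne_one (by norm_num))
    refine (mul_eq_zero.1 (?_ : (ζ - 1) * (ζ ^ 2 + ζ + 1) = 0)).resolve_left h1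
    linear_combination h.pow_eq_one
  obtain ⟨hm, hirr⟩ := monic_and_irreducible_of_mem_fieldList (k := 0) (l := [1, 1, 1])
    (mem_fieldList.2 (Or.inl rfl))
  have hmin : polyOfCoeffs [1, 1, 1] = minpoly ℚ ζ := by
    refine minpoly.eq_of_irreducible_of_monic hirr ?_ hm
    rw [polyOfCoeffs_quadratic, aeval_map_algebraMap]
    simpa using h0
  have hdeg : (minpoly ℚ ζ).natDegree = 2 := by
    have hf := isMonicOfDegree_add_add_two (1 : ℤ) 1
    rw [← hmin, polyOfCoeffs_quadratic, hf.monic.natDegree_map, hf.natDegree_eq]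
  have hd : Module.finrank ℚ K = 2 := by
    rcases hK with hK | ⟨hK, -⟩ | ⟨-, -, h3⟩
    · exact hK
    · have := minpoly.degree_dvd (K := ℚ) (Algebra.IsIntegral.isIntegral (R := ℚ) ζ)
      rw [hdeg, hK] at this
      omega
    · exact absurd ⟨ζ, h⟩ h3
  exact ⟨ζ, (Field.primitive_element_iff_minpoly_natDegree_eq ℚ ζ).2 (hdeg.trans hd.symm),
    hmin.symm⟩

/-- Every field of the family with `ell K ≤ k` is found: a generator `η` of its units modulo
torsion satisfies a short relation, hence has small conjugates. -/
theorem exists_mem_fieldList {k : ℕ} (hK : InFamily K) (hk : ell K ≤ k) :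
    ∃ c ∈ fieldList k, IsDefinedBy K (polyOfCoeffs c) := by
  by_cases h3 : ∃ ζ : K, IsPrimitiveRoot ζ 3
  · obtain ⟨ζ, h⟩ := h3
    exact ⟨_, mem_fieldList.2 (Or.inl rfl), isDefinedBy_of_isPrimitiveRoot_three hK h⟩
  obtain ⟨m, hm3, hmk, hm⟩ := exists_nondegenerate_of_ell_le hk
  obtain ⟨η, hgen⟩ := exists_generator_of_rank_le_one (rank_le_one_of_inFamily hK)
  by_cases hη : ∀ n : ℕ, 0 < n → η ^ n ≠ 1
  · have hadj := adjoin_eq_top_of_pow_ne_one hK h3 hη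
    obtain ⟨j, l, hl⟩ := hm.exists_isRelation hm3 hmk (η := η) fun u => by
      obtain ⟨ζ, hζ, n, hu⟩ := hgen u
      exact ⟨ζ, n, pow_four_eq_one_of_mem_torsion hK h3 hζ, hu⟩
    have hd : Module.finrank ℚ K ≤ 4 := by
      rcases hK with hK | ⟨hK, -⟩ | ⟨⟨hK, -⟩, -⟩
      · exact hK.trans_le (by norm_num)
      · omega
      · omega
    obtain ⟨l', hl', hlen⟩ := hl.exists_length_le hd
    rcases hK with hK | ⟨hK, hc⟩ | ⟨⟨hK, hc⟩, hr, -⟩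
    · exact exists_mem_fieldList_of_finrank_two hK h3 hη hadj hl' hlen
    · exact exists_mem_fieldList_of_finrank_three hK hc hadj hl' hlen
    · exact exists_mem_fieldList_of_finrank_four hK hc hr h3 hadj hl' hlen
  · push Not at hη
    obtain ⟨n, hn, hpow⟩ := hη
    refine absurd hm (not_hasNondegenerateUnitSum_of_pow_four hm3 fun u => ?_)
    obtain ⟨ζ, hζ, e, rfl⟩ := hgen u
    exact pow_four_eq_one_of_mem_torsion hK h3
      (mul_mem hζ (zpow_mem (mem_torsion_of_pow_eq_one hn hpow) e))

theorem inFamily_and_ell_le_iff {k : ℕ} (hk : 3 ≤ k) : (InFamily K ∧ ell K ≤ k) ↔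
    ∃ c ∈ fieldList k, IsDefinedBy K (polyOfCoeffs c) :=
  ⟨fun h => exists_mem_fieldList h.1 h.2,
    fun ⟨_, hc, hK⟩ => inFamily_and_ell_le_of_mem_fieldList hk hc hK⟩

end Completeness

/-! ### Finiteness -/

section Finiteness

open Polynomial

theorem numberField_of_inFamily {K : Type*} [Field K] [CharZero K] (h : InFamily K) :
    NumberField K := by
  have : 0 < Module.finrank ℚ K := by
    rcases h with h | ⟨h, -⟩ | ⟨⟨h, -⟩, -⟩
    · rw [IsQuadraticField] at h
      omega
    · omega
    · omega
  exact { to_finiteDimensional := Module.finite_of_finrank_pos this }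

theorem exists_root_of_isDefinedBy {K : IntermediateField ℚ ℂ} {f : ℚ[X]} (hf : f ≠ 0)
    (h : IsDefinedBy K f) : ∃ z ∈ f.rootSet ℂ, ℚ⟮z⟯ = K := by
  obtain ⟨x, hx, hmin⟩ := h
  set φ : K →ₐ[ℚ] ℂ := (algebraMap K ℂ).toRatAlgHom with hφ
  refine ⟨φ x, ?_, ?_⟩
  · rw [mem_rootSet_of_ne hf, aeval_algHom_apply, ← hmin, minpoly.aeval, map_zero]
  · have h1 := congrArg (IntermediateField.map φ) hx
    rw [IntermediateField.adjoin_map, Set.image_singleton] at h1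
    rw [h1]
    ext y
    simp only [IntermediateField.mem_map, IntermediateField.mem_top, true_and]
    exact ⟨fun ⟨u, hu⟩ => hu ▸ u.2, fun hy => ⟨⟨y, hy⟩, rfl⟩⟩

theorem finite_setOf_inFamily_and_ell_le {k : ℕ} (hk : 3 ≤ k) :
    {K : IntermediateField ℚ ℂ | InFamily K ∧ ell K ≤ (k : ℕ∞)}.Finite := by
  refine Set.Finite.subset ((fieldList k).finite_toSet.biUnion fun c _ =>
    ((polyOfCoeffs c).rootSet_finite ℂ).image fun z => ℚ⟮z⟯) ?_
  intro K hK
  have := numberField_of_inFamily hK.1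
  obtain ⟨c, hc, hdef⟩ := (inFamily_and_ell_le_iff hk).1 hK
  obtain ⟨z, hz, hzK⟩ := exists_root_of_isDefinedBy
    (monic_and_irreducible_of_mem_fieldList hc).1.ne_zero hdef
  exact Set.mem_biUnion hc ⟨z, hz, hzK⟩

end Finiteness

end UnitSum

theorem theorem4 :
    -- for each `k ≥ 3` there are only finitely many such fields, as subfields of `ℂ`
    (∀ k : ℕ, 3 ≤ k →
      {K : IntermediateField ℚ ℂ | UnitSum.InFamily K ∧ UnitSum.ell K ≤ (k : ℕ∞)}.Finite) ∧
    -- an algorithm computes, for each `k ≥ 3`, a finite list of irreducible monic integer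
    -- polynomials which define exactly these fields, up to isomorphism
    (∃ F : ℕ → List (List ℤ), Computable F ∧
      ∀ k : ℕ, 3 ≤ k →
        (∀ c ∈ F k, (UnitSum.polyOfCoeffs c).Monic ∧ Irreducible (UnitSum.polyOfCoeffs c)) ∧
        ∀ (K : Type*) [Field K] [NumberField K],
          (UnitSum.InFamily K ∧ UnitSum.ell K ≤ (k : ℕ∞)) ↔
            ∃ c ∈ F k, UnitSum.IsDefinedBy K (UnitSum.polyOfCoeffs c)) :=
  ⟨fun _ hk => UnitSum.finite_setOf_inFamily_and_ell_le hk, UnitSum.fieldList,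
    UnitSum.computable_fieldList, fun _ hk =>
      ⟨fun _ hc => UnitSum.monic_and_irreducible_of_mem_fieldList hc,
        fun _ _ _ => UnitSum.inFamily_and_ell_le_iff hk⟩⟩
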